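/- **Conventions.** A *weight sequence* is an increasing sequence $M=(M_k)_{k\ge 0}$ of positive reals with $M_0=1$; it is *log-convex* if $M_k^2\le M_{k-1}M_{k+1}$ for all $k\ge1$. For $U\subseteq\mathbb R$ open, $C^M(U)$ is the set of all $C^\infty$ functions $f$ on $U$ (real or complex valued) such that for each compact $K\subseteq U$ there are $C,\rho>0$ with $|f^{(k)}(x)|\le C\rho^k\,k!\,M_k$ for all $k\in\mathbb N$ and $x\in K$. The sequence $M$ is *quasianalytic* if, for every connected open $U\subseteq\mathbb R$, a real function in $C^M(U)$ all of whose derivatives vanish at one point of $U$ is zero on $U$, and *non-quasianalytic* otherwise; it is *derivation closed* if $f\in C^M(U)$ implies $f'\in C^M(U)$ for all open $U\subseteq\mathbb R$. It is an *$\mathcal L$-intersection* if for each open $U\subseteq\mathbb R$, $C^M(U)=\bigcap_L C^L(U)$, where $L$ runs through all log-convex non-quasianalytic weight sequences with $L_k\ge M_k$ for all $k$. Below, $Q$ denotes a quasianalytic, log-convex, derivation closed weight sequence which is an $\mathcal L$-intersection, and $L$ a non-quasianalytic, log-convex, derivation closed weight sequence. Let $n\in\mathbb N$, let $a_1,\dots,a_n:\mathbb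 R\to\mathbb C$, and let $$P(t)(x)=x^n-a_1(t)x^{n-1}+\dots+(-1)^na_n(t),\qquad t\in\mathbb R.$$ Functions $\lambda_1,\dots,\lambda_n$ *parameterize the roots* of $P$ if for each $t$ the numbers $\lambda_1(t),\dots,\lambda_n(t)$ are the roots of $P(t)$ with multiplicities. $P$ is *hyperbolic* if all roots of all $P(t)$ are real. *No two different roots of $P$ meet of infinite order* means: whenever continuous functions $\lambda_1,\dots,\lambda_n:\mathbb R\to\mathbb C$ parameterize the roots of $P$, and $\lambda_i(t)-\lambda_j(t)=O(|t-t_0|^k)$ as $t\to t_0$ for all $k\in\mathbb N$, then $\lambda_i=\lambda_j$ in a neighborhood of $t_0$ (for all $i,j$ and all $t_0\in\mathbb R$). **Proposition.** (a) If $P$ is hyperbolic and all $a_i$ are $C^Q$ on $\mathbb R$, then there are $C^Q$ functions $\lambda_i:\mathbb R\to\mathbb R$ which parameterize all roots of $P$. (b) If $P$ is hyperbolic, all $a_i$ are $C^L$ on $\mathbb R$, and no two different roots meet of infinite order, then there are $C^L$ functions $\lambda_i:\mathbb R\to\mathbb R$ which parameterize all roots of $P$. (c) If all $a_i$ are $C^Q$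 on $\mathbb R$, then for each $t_0\in\mathbb R$ there exists $N\in\mathbb N_{\ge1}$ such that, for each of the two signs, the roots of $s\mapsto P(t_0\pm s^N)$ can be parameterized by functions which are $C^Q$ in $s$ on a neighborhood of $0$. (d) If all $a_i$ are $C^L$ on $\mathbb R$ and no two different roots meet of infinite order, then for each $t_0\in\mathbb R$ there exists $N\in\mathbb N_{\ge1}$ such that, for each of the two signs, the roots of $s\mapsto P(t_0\pm s^N)$ can be parameterized by functions which are $C^L$ in $s$ on a neighborhood of $0$. Moreover, all such solutions differ by permutations: in (a) and (b), any two families of $C^Q$ (respectively $C^L$) functions on $\mathbb R$ which parameterize the roots of $P$ differ by a constant permutation of the indices; in (c) and (d), for every $N\ge1$, either sign and every $\delta>0$, so do any two families of $C^Q$ (respectively $C^L$) functions on $(-\delta,\delta)$ which parameterize the roots of $s\mapsto P(t_0\pm s^N)$ there. -/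

import Mathlib

open Set Filter Topology Polynomial
open scoped ContDiff Nat

/-- Increasing sequences of positive real numbers with `M 0 = 1`. -/
structure IsWeightSeq (M : ℕ → ℝ) : Prop where
  pos : ∀ k, 0 < M k
  zero : M 0 = 1
  mono : Monotone M

/-- The Denjoy--Carleman class `C^M(U)` on an open set `U ⊆ ℝ`, for functions with values in
`E = ℝ` or `E = ℂ` (only the values of `f` on `U` matter). -/
def IsDC {E : Type*} [NormedAddCommGroup E] [NormedSpace ℝ E]
    (M : ℕ → ℝ) (U : Set ℝ) (f : ℝ → E) : Prop :=
  ContDiffOn ℝ ∞ f U ∧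
    ∀ K : Set ℝ, IsCompact K → K ⊆ U →
      ∃ C > (0 : ℝ), ∃ ρ > (0 : ℝ), ∀ k : ℕ, ∀ x ∈ K,
        ‖iteratedDeriv k f x‖ ≤ C * ρ ^ k * (k ! : ℝ) * M k

/-- Log-convexity of a sequence: `M_k ^ 2 ≤ M_{k-1} M_{k+1}` for `k ≥ 1`. -/
def IsLogConvexSeq (M : ℕ → ℝ) : Prop :=
  ∀ k, M (k + 1) ^ 2 ≤ M k * M (k + 2)

/-- `C^M` is quasianalytic: on a connected open set, a function of the class is determined by its
Taylor series at any one point. -/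
def IsQuasianalytic (M : ℕ → ℝ) : Prop :=
  ∀ U : Set ℝ, IsOpen U → IsPreconnected U → ∀ f : ℝ → ℝ, IsDC M U f →
    ∀ x ∈ U, (∀ k : ℕ, iteratedDeriv k f x = 0) → ∀ y ∈ U, f y = 0

/-- `C^M` is closed under derivation. -/
def IsDerivationClosed (M : ℕ → ℝ) : Prop :=
  ∀ U : Set ℝ, IsOpen U → ∀ f : ℝ → ℝ, IsDC M U f → IsDC M U (deriv f)

/-- `Q` is an `𝓛`-intersection: `C^Q` is the intersection of all `C^L`, where `L ≥ Q` runs through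
the log-convex non-quasianalytic weight sequences. -/
def IsLIntersection (Q : ℕ → ℝ) : Prop :=
  ∀ U : Set ℝ, IsOpen U → ∀ f : ℝ → ℝ,
    (IsDC Q U f ↔
      ∀ L : ℕ → ℝ, IsWeightSeq L → IsLogConvexSeq L → ¬ IsQuasianalytic L →
        (∀ k, Q k ≤ L k) → IsDC L U f)

/-- The sequences `Q`: quasianalytic, log-convex, derivation closed `𝓛`-intersections. -/
structure IsQSeq (Q : ℕ → ℝ) : Prop where
  weight : IsWeightSeq Q
  logConvex : IsLogConvexSeq Q
  quasianalytic : IsQuasianalytic Q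
  derivationClosed : IsDerivationClosed Q
  lIntersection : IsLIntersection Q

/-- The sequences `L`: non-quasianalytic, log-convex, derivation closed. -/
structure IsLSeq (L : ℕ → ℝ) : Prop where
  weight : IsWeightSeq L
  logConvex : IsLogConvexSeq L
  nonQuasianalytic : ¬ IsQuasianalytic L
  derivationClosed : IsDerivationClosed L

/-- The curve of polynomials
`P(t)(x) = x^n - a_1(t) x^(n-1) + a_2(t) x^(n-2) - ... + (-1)^n a_n(t)`;
the function `a_j` is `a (j - 1)`, as `Fin n` starts at `0`. -/
noncomputable def polyCurve {n : ℕ} (a : Fin n → ℝ → ℂ) (t : ℝ) : ℂ[X] :=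
  X ^ n + ∑ i : Fin n, C ((-1) ^ ((i : ℕ) + 1) * a i t) * X ^ (n - ((i : ℕ) + 1))

/-- All roots of all `P(t)` are real. -/
def IsHyperbolic (P : ℝ → ℂ[X]) : Prop :=
  ∀ t, ∀ z : ℂ, (P t).IsRoot z → z.im = 0

/-- The functions `lam i` parameterize all roots of `P(t)`, with multiplicities, for `t ∈ S`. -/
def ParametrizesRoots {n : ℕ} (P : ℝ → ℂ[X]) (S : Set ℝ) (lam : Fin n → ℝ → ℂ) : Prop :=
  ∀ t ∈ S, (P t).roots = (Finset.univ : Finset (Fin n)).val.map (fun i => lam i t)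

/-- `f` and `g` meet of infinite order at `t₀` (the case `k = 1` forces `f t₀ = g t₀`). -/
def MeetInfiniteOrder (f g : ℝ → ℂ) (t₀ : ℝ) : Prop :=
  ∀ k : ℕ, (fun t => f t - g t) =O[𝓝 t₀] (fun t => (t - t₀) ^ k)

/-- No two different roots meet of infinite order: whenever the roots are parameterized
continuously, two of the root functions that meet of infinite order at a point have the same germ
there. -/
def NoInfiniteOrderMeeting (n : ℕ) (P : ℝ → ℂ[X]) : Prop :=
  ∀ lam : Fin n → ℝ → ℂ, (∀ i, Continuous (lam i)) → ParametrizesRoots P univ lam →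
    ∀ (i j : Fin n) (t₀ : ℝ), MeetInfiniteOrder (lam i) (lam j) t₀ → lam i =ᶠ[𝓝 t₀] lam j

/-- `lam` is a (global, real) `C^M` parameterization of the roots of the curve `P`. -/
def IsRealDCSolution {n : ℕ} (M : ℕ → ℝ) (P : ℝ → ℂ[X]) (lam : Fin n → ℝ → ℝ) : Prop :=
  (∀ i, IsDC M univ (lam i)) ∧ ParametrizesRoots P univ (fun i t => (lam i t : ℂ))

/-- `lam` is a `C^M` parameterization of the roots of the curve `P` on the set `U`. -/
def IsDCSolutionOn {n : ℕ} (M : ℕ → ℝ) (P : ℝ → ℂ[X]) (U : Set ℝ) (lam : Fin n → ℝ → ℂ) : Prop :=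
  (∀ i, IsDC M U (lam i)) ∧ ParametrizesRoots P U lam

/-- There are real `C^M` functions on `ℝ` that parameterize all roots of `P`, and any two such
families differ by a permutation. -/
def HasRealDCRoots (n : ℕ) (M : ℕ → ℝ) (P : ℝ → ℂ[X]) : Prop :=
  (∃ lam : Fin n → ℝ → ℝ, IsRealDCSolution M P lam) ∧
    ∀ lam mu : Fin n → ℝ → ℝ, IsRealDCSolution M P lam → IsRealDCSolution M P mu →
      ∃ σ : Equiv.Perm (Fin n), ∀ i t, mu i t = lam (σ i) t

/-- There is `N ≥ 1` such that, for both signs, the roots of `s ↦ P(t₀ ± s^N)` can be parameterized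
`C^M` in `s` near `0`; and, for every exponent `N ≥ 1` and both signs, any two `C^M`
parameterizations on an interval around `0` differ by a permutation. -/
def HasDCRootsAfterPower (n : ℕ) (M : ℕ → ℝ) (P : ℝ → ℂ[X]) (t₀ : ℝ) : Prop :=
  (∃ N : ℕ, 1 ≤ N ∧ ∀ ε : ℝ, (ε = 1 ∨ ε = -1) →
      ∃ δ > (0 : ℝ), ∃ lam : Fin n → ℝ → ℂ,
        IsDCSolutionOn M (fun s => P (t₀ + ε * s ^ N)) (Ioo (-δ) δ) lam) ∧
    ∀ N : ℕ, 1 ≤ N → ∀ ε : ℝ, (ε = 1 ∨ ε = -1) → ∀ δ > (0 : ℝ),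
      ∀ lam mu : Fin n → ℝ → ℂ,
        IsDCSolutionOn M (fun s => P (t₀ + ε * s ^ N)) (Ioo (-δ) δ) lam →
        IsDCSolutionOn M (fun s => P (t₀ + ε * s ^ N)) (Ioo (-δ) δ) mu →
          ∃ σ : Equiv.Perm (Fin n), ∀ i, ∀ s ∈ Ioo (-δ) δ, mu i s = lam (σ i) s

/-! The roots are treated as an unordered tuple `z` of possibly irregular functions, of which only
the elementary symmetric functions are known to be of class C^M (`Adm`). All local work takes place
in the algebra of C^M germs at 0. It is stable under inverses of germs bounded away from zero,
parameter integrals, the substitutions t = ±s^N, and division of a vanishing germ by t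
(`GM.exists_eq_mul`), which rests on closedness under derivation.

Existence up to flat errors is a Puiseux recursion (`Adm.hasExpansion`). Centre the roots to have
sum zero. Unless they are all flat, a substitution t = s^q makes them all O(s^p) but not all o(s^p);
p/q is the smallest slope of the Newton polygon (`Adm.exists_order`). For real roots q = 1 suffices,
because the sum of their squares is nonnegative and so has even order (`Adm.exists_order_of_real`).
After division by s^p the roots at 0 are no longer all equal (`Adm.exists_rescale`), hence fall into
two clusters. The power sums of a cluster are contour integrals of ζ^k P'(ζ)/P(ζ), so both clusters
are again admissible (`Adm.restrict`, `Adm.exists_split`), and the recursion continues with fewer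
roots. The outcome is z(s^N) = ν + r up to permutation, with ν of class C^M and r flat.

The errors r disappear once distinct roots stay apart by a power of the distance to the base point
(`SepAt`, `HasExpansion.exact`). In the quasianalytic case the symmetric functions of z(s^N) and of
ν differ by flat C^M germs, hence agree, and differences of the ν are zero or have finite order
(`Adm.sepAt_of_quasianalytic`). In the other case the roots are first enumerated continuously
(`exists_selection`). On each side of the point a difference of two roots is then flat or bounded
below by a power. If one is flat on the right, the product of all differences forces some pair to be
flat on the left; reconnecting branches at the point yields two continuous roots meeting of infinite
order, so the original pair coincides on the right (`Adm.eventually_eq_of_rightFlat`).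

Separation also gives rigidity: two C^M enumerations over an interval differ by one constant
permutation (`exists_perm_of_sepAt`). This is the uniqueness claim, and it lets local real solutions
be glued to a global one (`IsDCSelectionAt.exists_global`). -/

/-- Log-convex weight sequences `M` for which `C^M` is closed under derivation. -/
structure IsRegularSeq (M : ℕ → ℝ) : Prop where
  weight : IsWeightSeq M
  logConvex : IsLogConvexSeq M
  derivationClosed : IsDerivationClosed M

/-! ### Inequalities for log-convex weight sequences. -/

namespace IsRegularSeq

variable {M : ℕ → ℝ}

theorem pos (hM : IsRegularSeq M) (k : ℕ) : 0 < M k := hM.weight.pos k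

theorem one_le (hM : IsRegularSeq M) (k : ℕ) : 1 ≤ M k := by
  simpa [hM.weight.zero] using hM.weight.mono (Nat.zero_le k)

/-- Log-convexity says that the quotients of consecutive terms increase; this is that monotonicity
without division. -/
theorem ratio_le (hM : IsRegularSeq M) (j k : ℕ) :
    M (j + 1) * M (j + k) ≤ M j * M (j + k + 1) := by
  induction k with
  | zero => simp [mul_comm]
  | succ k ih =>
    have h1 := hM.logConvex (j + k)
    have p0 := hM.pos (j + k)
    have p1 := hM.pos (j + k + 1)
    have p2 := hM.pos (j + 1)
    have p3 := hM.pos j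
    have h2 : M (j + k + 1) ^ 2 * M (j + 1) ≤ (M j * M (j + k + 2)) * M (j + k + 1) := by
      calc M (j + k + 1) ^ 2 * M (j + 1) ≤ M (j + k) * M (j + k + 2) * M (j + 1) := by gcongr
        _ = (M (j + 1) * M (j + k)) * M (j + k + 2) := by ring
        _ ≤ (M j * M (j + k + 1)) * M (j + k + 2) := by
          gcongr
          exact (hM.pos _).le
        _ = _ := by ring
    have h3 : (M (j + 1) * M (j + k + 1)) * M (j + k + 1)
        ≤ (M j * M (j + k + 2)) * M (j + k + 1) := by
      calc _ = M (j + k + 1) ^ 2 * M (j + 1) := by ring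
        _ ≤ _ := h2
    exact le_of_mul_le_mul_right h3 p1

theorem mul_le (hM : IsRegularSeq M) (j k : ℕ) : M j * M k ≤ M (j + k) := by
  induction j with
  | zero => simp [hM.weight.zero]
  | succ j ih =>
    have h1 := hM.ratio_le j k
    have p0 := hM.pos j
    have p1 := hM.pos (j + 1)
    have : (M (j + 1) * M k) * M j ≤ M (j + k + 1) * M j := by
      calc (M (j + 1) * M k) * M j = M (j + 1) * (M j * M k) := by ring
        _ ≤ M (j + 1) * M (j + k) := by gcongr
        _ ≤ _ := by linarith
    have := le_of_mul_le_mul_right this p0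
    rwa [show j + 1 + k = j + k + 1 by ring]

end IsRegularSeq

/-! ### Pointwise derivative bounds: sums, products, inverses. -/

/-- The function `f` is smooth at `x`, and its derivatives at `x` obey the bounds of the class
`C^M` with the constants `C` and `ρ`. -/
def DCBound (M : ℕ → ℝ) (C ρ : ℝ) (f : ℝ → ℂ) (x : ℝ) : Prop :=
  ContDiffAt ℝ ∞ f x ∧ ∀ k : ℕ, ‖iteratedDeriv k f x‖ ≤ C * ρ ^ k * (k ! : ℝ) * M k

namespace DCBound

variable {M : ℕ → ℝ} {C C' ρ ρ' x : ℝ} {f g : ℝ → ℂ}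

theorem contDiffAt (h : DCBound M C ρ f x) (k : ℕ) : ContDiffAt ℝ k f x :=
  h.1.of_le (by exact_mod_cast le_top)

theorem congr (h : DCBound M C ρ f x) (hfg : f =ᶠ[𝓝 x] g) : DCBound M C ρ g x :=
  ⟨h.1.congr_of_eventuallyEq hfg.symm, fun k => by
    rw [← hfg.iteratedDeriv_eq k]; exact h.2 k⟩

theorem mono (hM : ∀ k, 0 < M k) (h : DCBound M C ρ f x) (hC0 : 0 ≤ C') (hρ0 : 0 ≤ ρ)
    (hC : C ≤ C') (hρ : ρ ≤ ρ') : DCBound M C' ρ' f x :=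
  ⟨h.1, fun k => (h.2 k).trans (by have := (hM k).le; gcongr)⟩

theorem add (hM : ∀ k, 0 < M k) (hC : 0 ≤ C) (hC' : 0 ≤ C') (hρ : 0 ≤ ρ) (hρ' : 0 ≤ ρ')
    (hf : DCBound M C ρ f x) (hg : DCBound M C' ρ' g x) :
    DCBound M (C + C') (ρ + ρ') (f + g) x := by
  refine ⟨hf.1.add hg.1, fun k => ?_⟩
  rw [iteratedDeriv_add (hf.contDiffAt k) (hg.contDiffAt k)]
  have h1 := (hf.mono hM hC hρ le_rfl (le_add_of_nonneg_right hρ')).2 k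
  have h2 := (hg.mono hM hC' hρ' le_rfl (le_add_of_nonneg_left hρ)).2 k
  calc _ ≤ _ := norm_add_le _ _
    _ ≤ _ := add_le_add h1 h2
    _ = _ := by ring

theorem mul (hM : ∀ k, 0 < M k) (hmul : ∀ j k, M j * M k ≤ M (j + k))
    (hC : 0 ≤ C) (hC' : 0 ≤ C') (hρ : 0 ≤ ρ) (hρ' : 0 ≤ ρ')
    (hf : DCBound M C ρ f x) (hg : DCBound M C' ρ' g x) :
    DCBound M (C * C') (ρ + ρ') (f * g) x := by
  refine ⟨hf.1.mul hg.1, fun k => ?_⟩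
  rw [iteratedDeriv_mul (hf.contDiffAt k) (hg.contDiffAt k)]
  calc _ ≤ ∑ i ∈ Finset.range (k + 1), ‖(k.choose i : ℂ) * iteratedDeriv i f x *
        iteratedDeriv (k - i) g x‖ := norm_sum_le _ _
    _ ≤ ∑ i ∈ Finset.range (k + 1), C * C' * (k ! : ℝ) * M k * (ρ ^ i * ρ' ^ (k - i)) := by
        refine Finset.sum_le_sum fun i hi => ?_
        have hik : i ≤ k := Nat.lt_succ_iff.1 (Finset.mem_range.1 hi)
        have h1 := hf.2 i
        have h2 := hg.2 (k - i)
        have h3 := hmul i (k - i)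
        rw [Nat.add_sub_cancel' hik] at h3
        have h4 : (k.choose i : ℝ) * (i ! : ℝ) * ((k - i)! : ℝ) = (k ! : ℝ) := by
          exact_mod_cast Nat.choose_mul_factorial_mul_factorial hik
        rw [norm_mul, norm_mul, Complex.norm_natCast]
        have p1 := (hM i).le
        have p2 := (hM (k - i)).le
        calc _ ≤ (k.choose i : ℝ) * (C * ρ ^ i * (i ! : ℝ) * M i) *
              (C' * ρ' ^ (k - i) * ((k - i)! : ℝ) * M (k - i)) := by gcongr
          _ = C * C' * ((k.choose i : ℝ) * (i ! : ℝ) * ((k - i)! : ℝ)) * (M i * M (k - i)) *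
              (ρ ^ i * ρ' ^ (k - i)) := by ring
          _ ≤ C * C' * ((k.choose i : ℝ) * (i ! : ℝ) * ((k - i)! : ℝ)) * M k *
              (ρ ^ i * ρ' ^ (k - i)) := by gcongr
          _ = _ := by rw [h4]
    _ ≤ C * C' * (k ! : ℝ) * M k * (ρ + ρ') ^ k := by
        rw [← Finset.mul_sum, add_pow]
        have := (hM k).le
        refine mul_le_mul_of_nonneg_left (Finset.sum_le_sum fun i hi => ?_) (by positivity)
        have hik : i ≤ k := Nat.lt_succ_iff.1 (Finset.mem_range.1 hi)
        exact le_mul_of_one_le_right (by positivity) (by exact_mod_cast Nat.choose_pos hik)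
    _ = _ := by ring

/-- Leibniz' rule for f · f⁻¹ = 1 expresses each derivative of f⁻¹ through lower ones. The new rate
σ satisfies σ - ρ = ρ c⁻¹ C, so the resulting sum telescopes to σ^k - ρ^k ≤ σ^k and the induction
closes with the constant c⁻¹. -/
theorem inv {c : ℝ} (hM : ∀ k, 0 < M k) (hmul : ∀ j k, M j * M k ≤ M (j + k)) (h0 : M 0 = 1)
    (hC : 0 ≤ C) (hρ : 0 ≤ ρ) (hc : 0 < c) (hf : DCBound M C ρ f x) (hfc : c ≤ ‖f x‖) :
    DCBound M c⁻¹ (ρ + ρ * (c⁻¹ * C)) f⁻¹ x := by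
  have hfx : f x ≠ 0 := norm_pos_iff.1 (hc.trans_le hfc)
  have hs : ContDiffAt ℝ ∞ f⁻¹ x := hf.1.inv hfx
  set σ := ρ + ρ * (c⁻¹ * C) with hσ
  have hρσ : ρ ≤ σ := le_add_of_nonneg_right (by positivity)
  refine ⟨hs, fun k => ?_⟩
  induction k using Nat.strong_induction_on with
  | _ k ih =>
  rcases Nat.eq_zero_or_pos k with rfl | hk
  · simp only [iteratedDeriv_zero, Pi.inv_apply, norm_inv, pow_zero, mul_one, Nat.factorial_zero,
      Nat.cast_one, h0]
    exact inv_anti₀ hc hfc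
  · have hone : iteratedDeriv k (f * f⁻¹) x = 0 := by
      have : f * f⁻¹ =ᶠ[𝓝 x] fun _ => (1 : ℂ) := by
        filter_upwards [hf.1.continuousAt.eventually_ne hfx] with y hy
        simp [hy]
      rw [this.iteratedDeriv_eq k, iteratedDeriv_const]
      simp [hk.ne']
    rw [iteratedDeriv_mul (hf.contDiffAt k) (hs.of_le (by exact_mod_cast le_top)),
      Finset.sum_range_succ'] at hone
    simp only [Nat.choose_zero_right, Nat.cast_one, one_mul, iteratedDeriv_zero, Nat.sub_zero]
      at hone
    have hsum : ‖∑ i ∈ Finset.range k, (k.choose (i + 1) : ℂ) * iteratedDeriv (i + 1) f x *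
        iteratedDeriv (k - (i + 1)) f⁻¹ x‖ ≤ (k ! : ℝ) * M k * σ ^ k := by
      calc _ ≤ ∑ i ∈ Finset.range k, ‖(k.choose (i + 1) : ℂ) * iteratedDeriv (i + 1) f x *
            iteratedDeriv (k - (i + 1)) f⁻¹ x‖ := norm_sum_le _ _
        _ ≤ ∑ i ∈ Finset.range k, (k ! : ℝ) * M k *
            ((σ - ρ) * (ρ ^ i * σ ^ (k - 1 - i))) := by
          refine Finset.sum_le_sum fun i hi => ?_
          have hik : i + 1 ≤ k := Finset.mem_range.1 hi
          have h1 := hf.2 (i + 1)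
          have h2 := ih (k - (i + 1)) (by omega)
          have h3 := hmul (i + 1) (k - (i + 1))
          rw [Nat.add_sub_cancel' hik] at h3
          have h4 : (k.choose (i + 1) : ℝ) * ((i + 1)! : ℝ) * ((k - (i + 1))! : ℝ) = (k ! : ℝ) := by
            exact_mod_cast Nat.choose_mul_factorial_mul_factorial hik
          rw [norm_mul, norm_mul, Complex.norm_natCast]
          have p1 := (hM (i + 1)).le
          have p2 := (hM (k - (i + 1))).le
          calc _ ≤ (k.choose (i + 1) : ℝ) * (C * ρ ^ (i + 1) * ((i + 1)! : ℝ) * M (i + 1)) *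
                (c⁻¹ * σ ^ (k - (i + 1)) * ((k - (i + 1))! : ℝ) * M (k - (i + 1))) := by gcongr
            _ = c⁻¹ * C * ((k.choose (i + 1) : ℝ) * ((i + 1)! : ℝ) * ((k - (i + 1))! : ℝ)) *
                (M (i + 1) * M (k - (i + 1))) * (ρ ^ (i + 1) * σ ^ (k - (i + 1))) := by ring
            _ ≤ c⁻¹ * C * ((k.choose (i + 1) : ℝ) * ((i + 1)! : ℝ) * ((k - (i + 1))! : ℝ)) *
                M k * (ρ ^ (i + 1) * σ ^ (k - (i + 1))) := by
                have : 0 ≤ σ := hρ.trans hρσ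
                gcongr
            _ = _ := by
                rw [h4, hσ, show k - 1 - i = k - (i + 1) by omega]; ring
        _ = (k ! : ℝ) * M k * (σ ^ k - ρ ^ k) := by
          rw [← Finset.mul_sum, ← Finset.mul_sum]
          have := (Commute.all σ ρ).mul_geom_sum₂ k
          congr 1
          rw [← this]
          congr 1
          rw [← Finset.sum_range_reflect]
          refine Finset.sum_congr rfl fun i hi => ?_
          have := Finset.mem_range.1 hi
          rw [show k - 1 - (k - 1 - i) = i by omega]
          ring
        _ ≤ _ := by
          have := (hM k).le
          gcongr
          exact sub_le_self _ (by positivity)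
    have heq : iteratedDeriv k f⁻¹ x = -((f x)⁻¹ * ∑ i ∈ Finset.range k,
        (k.choose (i + 1) : ℂ) * iteratedDeriv (i + 1) f x *
        iteratedDeriv (k - (i + 1)) f⁻¹ x) := by
      field_simp
      linear_combination hone
    rw [heq, norm_neg, norm_mul, norm_inv]
    calc _ ≤ c⁻¹ * ((k ! : ℝ) * M k * σ ^ k) := by gcongr
      _ = _ := by ring

theorem const (hM : ∀ k, 0 < M k) (h0 : M 0 = 1) (a : ℂ) (hρ : 0 ≤ ρ) (ha : ‖a‖ ≤ C) :
    DCBound M C ρ (fun _ => a) x := by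
  refine ⟨contDiffAt_const, fun k => ?_⟩
  have hC : 0 ≤ C := (norm_nonneg a).trans ha
  rw [iteratedDeriv_const]
  split_ifs with hk
  · subst hk; simpa [h0]
  · have := (hM k).le
    rw [norm_zero]
    positivity

theorem ofReal (hM : ∀ k, 1 ≤ M k) (hx : |x| ≤ 1) :
    DCBound M 1 1 (fun s : ℝ => (s : ℂ)) x := by
  refine ⟨Complex.ofRealCLM.contDiff.contDiffAt, fun k => ?_⟩
  have hd : deriv (fun s : ℝ => (s : ℂ)) = fun _ => 1 := by
    funext s
    exact (Complex.ofRealCLM.hasDerivAt).deriv.trans (by simp)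
  have h1 : (1 : ℝ) ≤ k ! := by exact_mod_cast Nat.succ_le_of_lt k.factorial_pos
  have h2 := hM k
  have h3 : 1 ≤ (k ! : ℝ) * M k := one_le_mul_of_one_le_of_one_le h1 h2
  rw [one_pow, one_mul, one_mul]
  refine le_trans ?_ h3
  cases k with
  | zero => simpa using hx
  | succ k =>
    rw [iteratedDeriv_succ', hd, iteratedDeriv_const]
    split_ifs <;> simp

end DCBound

theorem ContDiffAt.iteratedDeriv_infty {E : Type*} [NormedAddCommGroup E] [NormedSpace ℝ E]
    {f : ℝ → E} {x : ℝ} (h : ContDiffAt ℝ ∞ f x) (k : ℕ) :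
    ContDiffAt ℝ ∞ (iteratedDeriv k f) x := by
  rw [iteratedDeriv_eq_equiv_comp]
  exact (LinearIsometryEquiv.contDiff _).contDiffAt.comp x
    (h.iteratedFDeriv_right (m := ∞) (by exact_mod_cast le_top))

theorem ContDiffAt.hasDerivAt_iteratedDeriv {E : Type*} [NormedAddCommGroup E] [NormedSpace ℝ E]
    {f : ℝ → E} {x : ℝ} (h : ContDiffAt ℝ ∞ f x) (k : ℕ) :
    HasDerivAt (iteratedDeriv k f) (iteratedDeriv (k + 1) f x) x := by
  rw [iteratedDeriv_succ]
  exact ((h.iteratedDeriv_infty k).differentiableAt (by simp)).hasDerivAt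

theorem ContinuousLinearMap.iteratedDeriv_comp_left {E F : Type*} [NormedAddCommGroup E]
    [NormedSpace ℝ E] [NormedAddCommGroup F] [NormedSpace ℝ F] (L : E →L[ℝ] F)
    {f : ℝ → E} {x : ℝ} (h : ContDiffAt ℝ ∞ f x) (k : ℕ) :
    iteratedDeriv k (fun y => L (f y)) x = L (iteratedDeriv k f x) := by
  have := L.iteratedFDeriv_comp_left h (i := k) (by exact_mod_cast le_top)
  rw [iteratedDeriv_eq_iteratedFDeriv, iteratedDeriv_eq_iteratedFDeriv]
  exact congrArg (fun q => q fun _ => 1) this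

/-! ### Uniform families of germs and their parameter integrals. -/

/-- A family of functions that is of class `C^M` near `0`, with uniform bounds. -/
def UGerm {Θ : Type*} (M : ℕ → ℝ) (F : Θ → ℝ → ℂ) : Prop :=
  ∃ δ > (0 : ℝ), ∃ C > (0 : ℝ), ∃ ρ > (0 : ℝ), ∀ θ, ∀ x ∈ Ioo (-δ) δ, DCBound M C ρ (F θ) x

/-- The function `f` is of class `C^M` near `0`. -/
def GM (M : ℕ → ℝ) (f : ℝ → ℂ) : Prop := UGerm M fun _ : Unit => f

namespace UGerm

variable {Θ : Type*} {M : ℕ → ℝ} {F G : Θ → ℝ → ℂ}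

theorem add (hM : IsRegularSeq M) (hF : UGerm M F) (hG : UGerm M G) : UGerm M (F + G) := by
  obtain ⟨δ, hδ, C, hC, ρ, hρ, h⟩ := hF
  obtain ⟨δ', hδ', C', hC', ρ', hρ', h'⟩ := hG
  refine ⟨min δ δ', lt_min hδ hδ', C + C', by positivity, ρ + ρ', by positivity, fun θ x hx => ?_⟩
  have h1 := min_le_left δ δ'
  have h2 := min_le_right δ δ'
  exact (h θ x ⟨by linarith [hx.1], by linarith [hx.2]⟩).add hM.pos hC.le hC'.le hρ.le hρ'.le
    (h' θ x ⟨by linarith [hx.1], by linarith [hx.2]⟩)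

theorem mul (hM : IsRegularSeq M) (hF : UGerm M F) (hG : UGerm M G) : UGerm M (F * G) := by
  obtain ⟨δ, hδ, C, hC, ρ, hρ, h⟩ := hF
  obtain ⟨δ', hδ', C', hC', ρ', hρ', h'⟩ := hG
  refine ⟨min δ δ', lt_min hδ hδ', C * C', by positivity, ρ + ρ', by positivity, fun θ x hx => ?_⟩
  have h1 := min_le_left δ δ'
  have h2 := min_le_right δ δ'
  exact (h θ x ⟨by linarith [hx.1], by linarith [hx.2]⟩).mul hM.pos hM.mul_le hC.le hC'.le
    hρ.le hρ'.le (h' θ x ⟨by linarith [hx.1], by linarith [hx.2]⟩)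

theorem inv (hM : IsRegularSeq M) (hF : UGerm M F) {c η : ℝ} (hc : 0 < c) (hη : 0 < η)
    (hb : ∀ θ, ∀ x ∈ Ioo (-η) η, c ≤ ‖F θ x‖) : UGerm M F⁻¹ := by
  obtain ⟨δ, hδ, C, hC, ρ, hρ, h⟩ := hF
  refine ⟨min δ η, lt_min hδ hη, c⁻¹, by positivity, ρ + ρ * (c⁻¹ * C), by positivity,
    fun θ x hx => ?_⟩
  have h1 := min_le_left δ η
  have h2 := min_le_right δ η
  exact (h θ x ⟨by linarith [hx.1], by linarith [hx.2]⟩).inv hM.pos hM.mul_le hM.weight.zero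
    hC.le hρ.le hc (hb θ x ⟨by linarith [hx.1], by linarith [hx.2]⟩)

theorem const (hM : IsRegularSeq M) {a : Θ → ℂ} {A : ℝ} (ha : ∀ θ, ‖a θ‖ ≤ A) :
    UGerm M fun θ _ => a θ :=
  ⟨1, one_pos, |A| + 1, by positivity, 1, one_pos, fun θ _ _ =>
    DCBound.const hM.pos hM.weight.zero _ zero_le_one
      ((ha θ).trans ((le_abs_self A).trans (by linarith)))⟩

theorem comp {Θ' : Type*} (hF : UGerm M F) (e : Θ' → Θ) : UGerm M fun θ => F (e θ) := by
  obtain ⟨δ, hδ, C, hC, ρ, hρ, h⟩ := hF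
  exact ⟨δ, hδ, C, hC, ρ, hρ, fun θ => h (e θ)⟩

/-- The uniform germs form an algebra. -/
def subalgebra (Θ : Type*) (hM : IsRegularSeq M) : Subalgebra ℂ (Θ → ℝ → ℂ) where
  carrier := {F | UGerm M F}
  mul_mem' := fun h h' => h.mul hM h'
  add_mem' := fun h h' => h.add hM h'
  algebraMap_mem' := fun a => const (a := fun _ => a) (A := ‖a‖) hM fun _ => le_rfl

/-- The uniform bounds dominate every derivative by a constant, so one may differentiate under the
integral sign any number of times without changing the rate ρ. -/
theorem integral [MeasurableSpace Θ] {μ : MeasureTheory.Measure Θ}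
    [MeasureTheory.IsFiniteMeasure μ] (hM : IsRegularSeq M) (hF : UGerm M F)
    (hmeas : ∀ x, MeasureTheory.AEStronglyMeasurable (fun θ => F θ x) μ) :
    GM M fun x => ∫ θ, F θ x ∂μ := by
  obtain ⟨δ, hδ, C, hC, ρ, hρ, h⟩ := hF
  have hderiv : ∀ k : ℕ, ∀ θ, ∀ x ∈ Ioo (-δ) δ,
      HasDerivAt (iteratedDeriv k (F θ)) (iteratedDeriv (k + 1) (F θ) x) x := fun k θ x hx =>
    (h θ x hx).1.hasDerivAt_iteratedDeriv k
  -- Derivatives in x remain measurable in the parameter, being limits of difference quotients along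
  -- a sequence.
  have hmeas' : ∀ k : ℕ, ∀ x ∈ Ioo (-δ) δ,
      MeasureTheory.AEStronglyMeasurable (fun θ => iteratedDeriv k (F θ) x) μ := by
    intro k
    induction k with
    | zero => intro x _; simpa using hmeas x
    | succ k ih =>
      intro x hx
      obtain ⟨u, hu0, hu⟩ : ∃ u : ℕ → ℝ, (∀ n, u n ≠ 0 ∧ x + u n ∈ Ioo (-δ) δ) ∧
          Tendsto u atTop (𝓝[≠] 0) := by
        have hev : ∀ᶠ t in 𝓝[≠] (0 : ℝ), t ≠ 0 ∧ x + t ∈ Ioo (-δ) δ := by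
          refine (eventually_mem_nhdsWithin).and (eventually_nhdsWithin_of_eventually_nhds ?_)
          have : Tendsto (fun t : ℝ => x + t) (𝓝 0) (𝓝 x) := by
            simpa using (continuous_const.add continuous_id).tendsto (0 : ℝ) (f := fun t => x + t)
          exact this.eventually (isOpen_Ioo.mem_nhds hx)
        obtain ⟨u, hu⟩ := exists_seq_tendsto (𝓝[≠] (0 : ℝ))
        obtain ⟨N, hN⟩ := eventually_atTop.1 (hu.eventually hev)
        exact ⟨fun n => u (n + N), fun n => hN _ (by omega),
          hu.comp (tendsto_add_atTop_nat N)⟩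
      refine aestronglyMeasurable_of_tendsto_ae atTop
        (f := fun n θ => (u n)⁻¹ • (iteratedDeriv k (F θ) (x + u n) - iteratedDeriv k (F θ) x))
        (fun n => ?_) (Eventually.of_forall fun θ => ?_)
      · exact ((ih _ (hu0 n).2).sub (ih _ hx)).const_smul (u n)⁻¹
      · exact (hasDerivAt_iff_tendsto_slope_zero.1 (hderiv k θ x hx)).comp hu
  have hint : ∀ k : ℕ, ∀ x ∈ Ioo (-δ) δ,
      MeasureTheory.Integrable (fun θ => iteratedDeriv k (F θ) x) μ := fun k x hx =>
    MeasureTheory.Integrable.of_bound (hmeas' k x hx) (C * ρ ^ k * (k ! : ℝ) * M k)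
      (Eventually.of_forall fun θ => (h θ x hx).2 k)
  have hD : ∀ k : ℕ, ∀ x ∈ Ioo (-δ) δ,
      HasDerivAt (fun x => ∫ θ, iteratedDeriv k (F θ) x ∂μ)
        (∫ θ, iteratedDeriv (k + 1) (F θ) x ∂μ) x := fun k x hx =>
    (hasDerivAt_integral_of_dominated_loc_of_deriv_le (isOpen_Ioo.mem_nhds hx)
      (by filter_upwards [isOpen_Ioo.mem_nhds hx] with y hy using hmeas' k y hy)
      (hint k x hx) (hmeas' (k + 1) x hx)
      (bound := fun _ => C * ρ ^ (k + 1) * ((k + 1)! : ℝ) * M (k + 1))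
      (Eventually.of_forall fun θ y hy => (h θ y hy).2 (k + 1))
      (MeasureTheory.integrable_const _)
      (Eventually.of_forall fun θ y hy => hderiv k θ y hy)).2
  have hiter : ∀ k : ℕ, ∀ x ∈ Ioo (-δ) δ,
      iteratedDeriv k (fun x => ∫ θ, F θ x ∂μ) x = ∫ θ, iteratedDeriv k (F θ) x ∂μ := by
    intro k
    induction k with
    | zero => intro x _; simp
    | succ k ih =>
      intro x hx
      rw [iteratedDeriv_succ]
      have : iteratedDeriv k (fun x => ∫ θ, F θ x ∂μ) =ᶠ[𝓝 x]
          fun x => ∫ θ, iteratedDeriv k (F θ) x ∂μ := by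
        filter_upwards [isOpen_Ioo.mem_nhds hx] with y hy using ih y hy
      rw [this.deriv_eq]
      exact (hD k x hx).deriv
  have hsmooth : ContDiffOn ℝ ∞ (fun x => ∫ θ, F θ x ∂μ) (Ioo (-δ) δ) := by
    refine contDiffOn_of_differentiableOn_deriv fun m _ => ?_
    refine DifferentiableOn.congr (f := fun x => ∫ θ, iteratedDeriv m (F θ) x ∂μ)
      (fun x hx => (hD m x hx).differentiableAt.differentiableWithinAt) fun x hx => ?_
    rw [iteratedDerivWithin_of_isOpen isOpen_Ioo hx]
    exact hiter m x hx
  refine ⟨δ, hδ, C * (μ.real univ + 1), by positivity, ρ, hρ, fun _ x hx =>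
    ⟨hsmooth.contDiffAt (isOpen_Ioo.mem_nhds hx), fun k => ?_⟩⟩
  rw [hiter k x hx]
  have h1 := MeasureTheory.norm_integral_le_of_norm_le_const (μ := μ)
    (Eventually.of_forall fun θ => (h θ x hx).2 k)
  have hp : 0 ≤ C * ρ ^ k * (k ! : ℝ) * M k := by have := (hM.pos k).le; positivity
  nlinarith [h1]

end UGerm

namespace GM

variable {M : ℕ → ℝ} {f g : ℝ → ℂ}

theorem iff_exists : GM M f ↔ ∃ δ > (0 : ℝ), ∃ C > (0 : ℝ), ∃ ρ > (0 : ℝ), ∀ x ∈ Ioo (-δ) δ,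
    DCBound M C ρ f x := by
  simp [GM, UGerm]

theorem uGerm {Θ : Type*} (hf : GM M f) : UGerm M fun _ : Θ => f := hf.comp fun _ => ()

theorem congr (hf : GM M f) (hfg : f =ᶠ[𝓝 0] g) : GM M g := by
  obtain ⟨δ, hδ, C, hC, ρ, hρ, h⟩ := iff_exists.1 hf
  obtain ⟨η, hη, h'⟩ := Metric.eventually_nhds_iff_ball.1 hfg.eventually_nhds
  rw [Real.ball_eq_Ioo, zero_sub, zero_add] at h'
  refine iff_exists.2 ⟨min δ η, lt_min hδ hη, C, hC, ρ, hρ, fun x hx => ?_⟩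
  have h1 := min_le_left δ η
  have h2 := min_le_right δ η
  exact (h x ⟨by linarith [hx.1], by linarith [hx.2]⟩).congr
    (h' x ⟨by linarith [hx.1], by linarith [hx.2]⟩)

theorem contDiffAt (hf : GM M f) : ContDiffAt ℝ ∞ f 0 := by
  obtain ⟨δ, hδ, C, hC, ρ, hρ, h⟩ := iff_exists.1 hf
  exact (h 0 ⟨by linarith, hδ⟩).1

theorem continuousAt (hf : GM M f) : ContinuousAt f 0 := hf.contDiffAt.continuousAt

/-- The germs at `0` of class `C^M` form an algebra. -/
def subalgebra (hM : IsRegularSeq M) : Subalgebra ℂ (ℝ → ℂ) where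
  carrier := {f | GM M f}
  mul_mem' := fun h h' => UGerm.mul hM h h'
  add_mem' := fun h h' => UGerm.add hM h h'
  algebraMap_mem' := fun a => UGerm.const (a := fun _ => a) (A := ‖a‖) hM fun _ => le_rfl

theorem add (hM : IsRegularSeq M) (hf : GM M f) (hg : GM M g) : GM M (f + g) := UGerm.add hM hf hg

theorem mul (hM : IsRegularSeq M) (hf : GM M f) (hg : GM M g) : GM M (f * g) := UGerm.mul hM hf hg

theorem const (hM : IsRegularSeq M) (a : ℂ) : GM M fun _ => a :=
  UGerm.const (a := fun _ => a) (A := ‖a‖) hM fun _ => le_rfl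

theorem ofReal (hM : IsRegularSeq M) : GM M fun s : ℝ => (s : ℂ) :=
  iff_exists.2 ⟨1, one_pos, 1, one_pos, 1, one_pos, fun _ hx =>
    DCBound.ofReal hM.one_le (abs_lt.2 hx).le⟩

theorem ofReal_pow (hM : IsRegularSeq M) (m : ℕ) : GM M fun s : ℝ => (s : ℂ) ^ m :=
  (subalgebra hM).pow_mem (ofReal hM) m

theorem sub (hM : IsRegularSeq M) (hf : GM M f) (hg : GM M g) : GM M (f - g) :=
  (subalgebra hM).sub_mem hf hg

end GM

/-! ### Composition with analytically bounded substitutions. -/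

/-- The chain rule turns the derivative of f^(j) ∘ κ into κ' · (f^(j+1) ∘ κ). Treating all j at once
makes Leibniz' rule and strong induction on k sufficient, with no Faà di Bruno formula. The
derivative κ' obeys bounds of the class with all weights 1, and with σ = R + ρA the sum telescopes
as it does for inverses. -/
theorem DCBound.comp_aux {M : ℕ → ℝ} (hM : IsRegularSeq M) {C ρ A R : ℝ} (hC : 0 ≤ C) (hρ : 0 ≤ ρ)
    (hA : 0 ≤ A) (hR : 0 ≤ R) {U V : Set ℝ} (hV : IsOpen V) {f ψ : ℝ → ℂ} {κ κ' : ℝ → ℝ}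
    (hf : ∀ x ∈ U, DCBound M C ρ f x) (hκ : MapsTo κ V U)
    (hκs : ∀ s ∈ V, ContDiffAt ℝ ∞ κ s) (hκ' : ∀ s ∈ V, HasDerivAt κ (κ' s) s)
    (hψ : ∀ s, ψ s = κ' s) (hψb : ∀ s ∈ V, DCBound (fun _ => 1) A R ψ s) (k j : ℕ) :
    ∀ s ∈ V, ‖iteratedDeriv k (fun s => iteratedDeriv j f (κ s)) s‖ ≤
      C * ((k + j)! : ℝ) * M (k + j) * ρ ^ j * (R + ρ * A) ^ k := by
  induction k using Nat.strong_induction_on generalizing j with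
  | _ k ih =>
  intro s hs
  cases k with
  | zero =>
    have := (hf _ (hκ hs)).2 j
    simp only [iteratedDeriv_zero, zero_add, pow_zero, mul_one]
    linarith
  | succ k =>
    have hsm : ∀ j, ContDiffAt ℝ ∞ (fun s => iteratedDeriv j f (κ s)) s := fun j =>
      ((hf _ (hκ hs)).1.iteratedDeriv_infty j).comp s (hκs s hs)
    have hd : deriv (fun s => iteratedDeriv j f (κ s)) =ᶠ[𝓝 s]
        ψ * fun s => iteratedDeriv (j + 1) f (κ s) := by
      filter_upwards [hV.mem_nhds hs] with y hy
      have := ((hf _ (hκ hy)).1.hasDerivAt_iteratedDeriv j).scomp y (hκ' y hy)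
      rw [Pi.mul_apply, hψ, ← Complex.real_smul]
      exact this.deriv
    rw [iteratedDeriv_succ', hd.iteratedDeriv_eq k, iteratedDeriv_mul
      ((hψb s hs).contDiffAt k) ((hsm (j + 1)).of_le (by exact_mod_cast le_top))]
    set σ := R + ρ * A with hσ
    have hσ0 : 0 ≤ σ := by positivity
    calc _ ≤ ∑ i ∈ Finset.range (k + 1), ‖(k.choose i : ℂ) * iteratedDeriv i ψ s *
          iteratedDeriv (k - i) (fun s => iteratedDeriv (j + 1) f (κ s)) s‖ := norm_sum_le _ _
      _ ≤ ∑ i ∈ Finset.range (k + 1), C * ((k + 1 + j)! : ℝ) * M (k + 1 + j) * ρ ^ j *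
          ((σ - R) * (R ^ i * σ ^ (k - i))) := by
        refine Finset.sum_le_sum fun i hi => ?_
        have hik : i ≤ k := Nat.lt_succ_iff.1 (Finset.mem_range.1 hi)
        have h1 := (hψb s hs).2 i
        have h2 := ih (k - i) (by omega) (j + 1) s hs
        have h3 : M (k - i + (j + 1)) ≤ M (k + 1 + j) := hM.weight.mono (by omega)
        have h4 : (k.choose i : ℝ) * (i ! : ℝ) * ((k - i + (j + 1))! : ℝ) ≤ ((k + 1 + j)! : ℝ) := by
          have e1 : k.choose i * i ! * (k - i)! = k ! := Nat.choose_mul_factorial_mul_factorial hik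
          have e2 : k ! * (k - i + (j + 1))! ≤ (k - i)! * (k + 1 + j)! := by
            have e3 := Nat.factorial_mul_ascFactorial (k - i) (j + 1)
            have e4 := Nat.factorial_mul_ascFactorial k (j + 1)
            have e5 : (k - i + 1).ascFactorial (j + 1) ≤ (k + 1).ascFactorial (j + 1) :=
              (Nat.ascFactorial_le _ (by omega))
            rw [← e3, show k + 1 + j = k + (j + 1) by ring, ← e4]
            calc _ = ((k - i)! * k !) * (k - i + 1).ascFactorial (j + 1) := by ring
              _ ≤ ((k - i)! * k !) * (k + 1).ascFactorial (j + 1) := by gcongr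
              _ = _ := by ring
          have e6 : k.choose i * i ! * (k - i + (j + 1))! ≤ (k + 1 + j)! := by
            refine Nat.le_of_mul_le_mul_left ?_ (k - i).factorial_pos
            calc _ = (k.choose i * i ! * (k - i)!) * (k - i + (j + 1))! := by ring
              _ ≤ _ := by rw [e1]; exact e2
          exact_mod_cast e6
        rw [norm_mul, norm_mul, Complex.norm_natCast]
        have p1 := (hM.pos (k - i + (j + 1))).le
        have p2 := (hM.pos (k + 1 + j)).le
        calc _ ≤ (k.choose i : ℝ) * (A * R ^ i * (i ! : ℝ) * 1) *
              (C * ((k - i + (j + 1))! : ℝ) * M (k - i + (j + 1)) * ρ ^ (j + 1) * σ ^ (k - i)) := by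
              gcongr
          _ = ((k.choose i : ℝ) * (i ! : ℝ) * ((k - i + (j + 1))! : ℝ)) * (A * R ^ i) *
              (C * M (k - i + (j + 1)) * ρ ^ (j + 1) * σ ^ (k - i)) := by ring
          _ ≤ ((k + 1 + j)! : ℝ) * (A * R ^ i) *
              (C * M (k + 1 + j) * ρ ^ (j + 1) * σ ^ (k - i)) := by gcongr
          _ = _ := by rw [hσ]; ring
      _ = C * ((k + 1 + j)! : ℝ) * M (k + 1 + j) * ρ ^ j * (σ ^ (k + 1) - R ^ (k + 1)) := by
        rw [← Finset.mul_sum, ← Finset.mul_sum]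
        congr 1
        rw [← (Commute.all σ R).mul_geom_sum₂ (k + 1)]
        congr 1
        rw [← Finset.sum_range_reflect]
        refine Finset.sum_congr rfl fun i hi => ?_
        have := Finset.mem_range.1 hi
        rw [show k - (k + 1 - 1 - i) = i by omega, show k + 1 - 1 - i = k + 1 - 1 - i by rfl]
        ring
      _ ≤ _ := by
        have := (hM.pos (k + 1 + j)).le
        gcongr
        exact sub_le_self _ (by positivity)

namespace GM

variable {M : ℕ → ℝ} {f g : ℝ → ℂ}

/-- Uniformity in θ serves the dilations s ↦ us with u in [0,1]; a single substitution covers s ↦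
εs^N. -/
theorem comp_family {Θ : Type*} (hM : IsRegularSeq M) (hf : GM M f) {κ κ' : Θ → ℝ → ℝ}
    (hκ : ∀ θ, ∀ s ∈ Ioo (-1 : ℝ) 1, |κ θ s| ≤ |s|) (hκs : ∀ θ, ContDiff ℝ ∞ (κ θ))
    (hκ' : ∀ θ s, HasDerivAt (κ θ) (κ' θ s) s) {A R : ℝ} (hA : 0 ≤ A) (hR : 0 < R)
    (hψ : ∀ θ, ∀ s ∈ Ioo (-1 : ℝ) 1, DCBound (fun _ => 1) A R (fun s => (κ' θ s : ℂ)) s) :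
    UGerm M fun θ s => f (κ θ s) := by
  obtain ⟨δ, hδ, C, hC, ρ, hρ, h⟩ := iff_exists.1 hf
  refine ⟨min δ 1, lt_min hδ one_pos, C, hC, R + ρ * A, by positivity, fun θ x hx => ?_⟩
  have hmaps : MapsTo (κ θ) (Ioo (-(min δ 1)) (min δ 1)) (Ioo (-δ) δ) := fun s hs => by
    have h1 : |s| < min δ 1 := abs_lt.2 hs
    have h2 := hκ θ s (abs_lt.1 (h1.trans_le (min_le_right _ _)))
    exact abs_lt.1 (h2.trans_lt (h1.trans_le (min_le_left _ _)))
  refine ⟨(h _ (hmaps hx)).1.comp x (hκs θ).contDiffAt, fun k => ?_⟩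
  have := DCBound.comp_aux hM hC.le hρ.le hA hR.le isOpen_Ioo (ψ := fun s => (κ' θ s : ℂ))
    (U := Ioo (-δ) δ) h hmaps
    (fun s _ => (hκs θ).contDiffAt) (fun s _ => hκ' θ s) (fun _ => rfl)
    (fun s hs => hψ θ s ⟨by linarith [hs.1, min_le_right δ 1], by linarith [hs.2, min_le_right δ 1]⟩)
    k 0 x hx
  simp only [iteratedDeriv_zero, add_zero, pow_zero, mul_one] at this
  linarith

theorem comp_mul_pow (hM : IsRegularSeq M) (hf : GM M f) {ε : ℝ} (hε : |ε| ≤ 1) {N : ℕ}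
    (hN : 1 ≤ N) : GM M fun s => f (ε * s ^ N) := by
  -- Monomials satisfy the bounds with all weights 1 on (-1,1); this controls the derivative of s ↦
  -- εs^N.
  have h1 : ∀ m : ℕ, ∃ R > (0 : ℝ), ∀ s ∈ Ioo (-1 : ℝ) 1,
      DCBound (fun _ => 1) 1 R (fun s : ℝ => (s : ℂ) ^ m) s := by
    intro m
    induction m with
    | zero => exact ⟨1, one_pos, fun s _ => by
        simpa using DCBound.const (M := fun _ => 1) (fun _ => one_pos) rfl 1 zero_le_one (by simp)⟩
    | succ m ih =>
      obtain ⟨R, hR, h⟩ := ih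
      refine ⟨R + 1, by positivity, fun s hs => ?_⟩
      have := (h s hs).mul (fun _ => one_pos) (by simp) zero_le_one zero_le_one hR.le zero_le_one
        (DCBound.ofReal (fun _ => le_rfl) (abs_lt.2 hs).le)
      rw [one_mul] at this
      exact this
  obtain ⟨R, hR, h⟩ := h1 (N - 1)
  refine comp_family (Θ := Unit) hM hf (κ := fun _ s => ε * s ^ N)
    (κ' := fun _ s => ε * (N * s ^ (N - 1))) (A := ‖((ε * N : ℝ) : ℂ)‖ * 1) (R := 1 + R)
    (fun _ s hs => ?_)
    (fun _ => contDiff_const.mul (contDiff_id.pow N))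
    (fun _ s => (hasDerivAt_pow N s).const_mul ε) (by positivity) (by positivity) (fun _ s hs => ?_)
  · have hs' : |s| ≤ 1 := (abs_lt.2 hs).le
    rw [abs_mul, abs_pow]
    calc |ε| * |s| ^ N ≤ 1 * |s| ^ 1 :=
          mul_le_mul hε (pow_le_pow_of_le_one (abs_nonneg s) hs' hN) (by positivity) zero_le_one
      _ = _ := by simp
  · have := (DCBound.const (M := fun _ => 1) (fun _ => one_pos) rfl ((ε * N : ℝ) : ℂ)
      zero_le_one le_rfl).mul (fun _ => one_pos) (by simp) (norm_nonneg _) zero_le_one zero_le_one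
      hR.le (h s hs)
    refine this.congr (Eventually.of_forall fun y => ?_)
    simp only [Pi.mul_apply]
    push_cast
    ring

end GM

/-! ### Passage between C^M on open sets and germs at translated points. -/

theorem IsDC.clm_comp {E F : Type*} [NormedAddCommGroup E] [NormedSpace ℝ E]
    [NormedAddCommGroup F] [NormedSpace ℝ F] {M : ℕ → ℝ} (hM : ∀ k, 0 < M k) {U : Set ℝ}
    (hU : IsOpen U) {f : ℝ → E} (L : E →L[ℝ] F) (h : IsDC M U f) : IsDC M U fun x => L (f x) := by
  refine ⟨L.contDiff.comp_contDiffOn h.1, fun K hK hKU => ?_⟩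
  obtain ⟨C, hC, ρ, hρ, hb⟩ := h.2 K hK hKU
  refine ⟨(‖L‖ + 1) * C, by positivity, ρ, hρ, fun k x hx => ?_⟩
  rw [L.iteratedDeriv_comp_left (h.1.contDiffAt (hU.mem_nhds (hKU hx)))]
  have h1 := hb k x hx
  have := (hM k).le
  calc _ ≤ ‖L‖ * ‖iteratedDeriv k f x‖ := L.le_opNorm _
    _ ≤ (‖L‖ + 1) * (C * ρ ^ k * (k ! : ℝ) * M k) := by
      gcongr
      linarith
    _ = _ := by ring

theorem isDC_ofReal_iff {M : ℕ → ℝ} (hM : ∀ k, 0 < M k) {U : Set ℝ} (hU : IsOpen U) {f : ℝ → ℝ} :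
    IsDC M U (fun x => (f x : ℂ)) ↔ IsDC M U f :=
  ⟨fun h => by simpa using h.clm_comp hM hU Complex.reCLM,
    fun h => by simpa using h.clm_comp hM hU Complex.ofRealCLM⟩

theorem IsDC.gm {M : ℕ → ℝ} {U : Set ℝ} (hU : IsOpen U) {f : ℝ → ℂ} (h : IsDC M U f) {t : ℝ}
    (ht : t ∈ U) : GM M fun s => f (t + s) := by
  obtain ⟨δ, hδ, hb⟩ := Metric.isOpen_iff.1 hU t ht
  have hsub : Icc (t - δ / 2) (t + δ / 2) ⊆ U := fun x hx => hb (by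
    rw [Real.ball_eq_Ioo]; exact ⟨by linarith [hx.1], by linarith [hx.2]⟩)
  obtain ⟨C, hC, ρ, hρ, hK⟩ := h.2 _ isCompact_Icc hsub
  refine GM.iff_exists.2 ⟨δ / 2, by positivity, C, hC, ρ, hρ, fun x hx => ?_⟩
  have hx' : t + x ∈ Icc (t - δ / 2) (t + δ / 2) := ⟨by linarith [hx.1], by linarith [hx.2]⟩
  refine ⟨(h.1.contDiffAt (hU.mem_nhds (hsub hx'))).comp x
    (contDiff_const.add contDiff_id).contDiffAt, fun k => ?_⟩
  rw [iteratedDeriv_comp_const_add]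
  exact hK k _ hx'

theorem DCBound.isDC {M : ℕ → ℝ} {δ C ρ : ℝ} (hC : 0 < C) (hρ : 0 < ρ) {f : ℝ → ℂ}
    (h : ∀ x ∈ Ioo (-δ) δ, DCBound M C ρ f x) : IsDC M (Ioo (-δ) δ) f :=
  ⟨fun x hx => (h x hx).1.contDiffWithinAt, fun _ _ hKU => ⟨C, hC, ρ, hρ, fun k x hx =>
    (h x (hKU hx)).2 k⟩⟩

theorem isDC_of_gm {M : ℕ → ℝ} (hM : ∀ k, 0 < M k) {U : Set ℝ} {f : ℝ → ℂ}
    (h : ∀ t ∈ U, GM M fun s => f (t + s)) : IsDC M U f := by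
  have key : ∀ t ∈ U, ∃ δ > (0 : ℝ), ∃ C > (0 : ℝ), ∃ ρ > (0 : ℝ), ∀ x ∈ Ioo (t - δ) (t + δ),
      DCBound M C ρ f x := by
    intro t ht
    obtain ⟨δ, hδ, C, hC, ρ, hρ, hb⟩ := GM.iff_exists.1 (h t ht)
    refine ⟨δ, hδ, C, hC, ρ, hρ, fun x hx => ?_⟩
    have hb' := hb (x - t) ⟨by linarith [hx.1], by linarith [hx.2]⟩
    refine ⟨?_, fun k => ?_⟩
    · have := ContDiffAt.comp x (g := fun s => f (t + s)) (f := fun y => y - t) hb'.1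
        (contDiff_id.sub contDiff_const).contDiffAt
      simpa [Function.comp_def] using this
    · have := hb'.2 k
      rw [iteratedDeriv_comp_const_add] at this
      simpa using this
  refine ⟨fun t ht => ?_, fun K hK hKU => ?_⟩
  · obtain ⟨δ, hδ, C, hC, ρ, hρ, hb⟩ := key t ht
    exact (hb t ⟨by linarith, by linarith⟩).1.contDiffWithinAt
  · have : ∃ C > (0 : ℝ), ∃ ρ > (0 : ℝ), ∀ x ∈ K, DCBound M C ρ f x := by
      refine hK.induction_on (p := fun s => ∃ C > (0 : ℝ), ∃ ρ > (0 : ℝ), ∀ x ∈ s, DCBound M C ρ f x)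
        ⟨1, one_pos, 1, one_pos, by simp⟩ ?_ ?_ ?_
      · rintro s t hst ⟨C, hC, ρ, hρ, hb⟩
        exact ⟨C, hC, ρ, hρ, fun x hx => hb x (hst hx)⟩
      · rintro s t ⟨C, hC, ρ, hρ, hb⟩ ⟨C', hC', ρ', hρ', hb'⟩
        refine ⟨C + C', by positivity, ρ + ρ', by positivity, fun x hx => ?_⟩
        rcases hx with hx | hx
        · exact (hb x hx).mono hM (by positivity) hρ.le (by linarith) (by linarith)
        · exact (hb' x hx).mono hM (by positivity) hρ'.le (by linarith) (by linarith)
      · intro x hx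
        obtain ⟨δ, hδ, C, hC, ρ, hρ, hb⟩ := key x (hKU hx)
        exact ⟨_, mem_nhdsWithin_of_mem_nhds (Ioo_mem_nhds (by linarith) (by linarith)),
          C, hC, ρ, hρ, hb⟩
    obtain ⟨C, hC, ρ, hρ, hb⟩ := this
    exact ⟨C, hC, ρ, hρ, fun k x hx => (hb x hx).2 k⟩

/-! ### Derivatives of germs and division by the variable. -/

namespace GM

variable {M : ℕ → ℝ} {f g : ℝ → ℂ}

theorem exists_isDC (hf : GM M f) : ∃ δ > (0 : ℝ), IsDC M (Ioo (-δ) δ) f := by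
  obtain ⟨δ, hδ, C, hC, ρ, hρ, h⟩ := iff_exists.1 hf
  exact ⟨δ, hδ, DCBound.isDC hC hρ h⟩

theorem deriv (hM : IsRegularSeq M) (hf : GM M f) : GM M (deriv f) := by
  obtain ⟨δ, hδ, hD⟩ := exists_isDC hf
  -- Closedness under derivation is assumed for real functions only, so it is applied to the real
  -- and imaginary parts.
  have hbound : ∀ L : ℂ →L[ℝ] ℝ, ∃ C > (0 : ℝ), ∃ ρ > (0 : ℝ), ∀ k : ℕ,
      ∀ x ∈ Icc (-(δ / 2)) (δ / 2), |L (iteratedDeriv (k + 1) f x)| ≤ C * ρ ^ k * (k ! : ℝ) * M k := by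
    intro L
    have h1 := hM.derivationClosed _ isOpen_Ioo _ (hD.clm_comp hM.pos isOpen_Ioo L)
    have hsub : Icc (-(δ / 2)) (δ / 2) ⊆ Ioo (-δ) δ := fun x hx =>
      ⟨by linarith [hx.1], by linarith [hx.2]⟩
    obtain ⟨C, hC, ρ, hρ, hK⟩ := h1.2 _ isCompact_Icc hsub
    refine ⟨C, hC, ρ, hρ, fun k x hx => ?_⟩
    have := hK k x hx
    rw [← iteratedDeriv_succ', L.iteratedDeriv_comp_left
      (hD.1.contDiffAt (isOpen_Ioo.mem_nhds (hsub hx)))] at this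
    exact this
  obtain ⟨C, hC, ρ, hρ, h1⟩ := hbound Complex.reCLM
  obtain ⟨C', hC', ρ', hρ', h2⟩ := hbound Complex.imCLM
  refine iff_exists.2 ⟨δ / 2, by positivity, C + C', by positivity, ρ + ρ', by positivity,
    fun x hx => ⟨?_, fun k => ?_⟩⟩
  · have := (hD.1.contDiffAt (isOpen_Ioo.mem_nhds (show x ∈ Ioo (-δ) δ from
      ⟨by linarith [hx.1], by linarith [hx.2]⟩))).iteratedDeriv_infty 1
    rwa [iteratedDeriv_one] at this
  · rw [← iteratedDeriv_succ']
    have hx' : x ∈ Icc (-(δ / 2)) (δ / 2) := ⟨hx.1.le, hx.2.le⟩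
    have h1' := h1 k x hx'
    have h2' := h2 k x hx'
    simp only [Complex.reCLM_apply, Complex.imCLM_apply] at h1' h2'
    have hp := (hM.pos k).le
    calc _ ≤ _ := Complex.norm_le_abs_re_add_abs_im _
      _ ≤ C * ρ ^ k * (k ! : ℝ) * M k + C' * ρ' ^ k * (k ! : ℝ) * M k := add_le_add h1' h2'
      _ ≤ C * (ρ + ρ') ^ k * (k ! : ℝ) * M k + C' * (ρ + ρ') ^ k * (k ! : ℝ) * M k := by
        gcongr <;> linarith
      _ = _ := by ring

/-- Hadamard's lemma: the quotient is ∫₀¹ f'(ut) du, a parameter integral of dilations of f'. -/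
theorem exists_eq_mul (hM : IsRegularSeq M) (hf : GM M f) (h0 : f 0 = 0) :
    ∃ g, GM M g ∧ ∀ t : ℝ, f t = t * g t := by
  have hF : UGerm M fun (u : unitInterval) s => _root_.deriv f (u * s) := by
    refine comp_family hM (hf.deriv hM) (κ := fun (u : unitInterval) s => u * s)
      (κ' := fun u _ => (u : ℝ)) (A := 1) (R := 1) (fun u s _ => ?_)
      (fun u => contDiff_const.mul contDiff_id)
      (fun u s => by simpa using (hasDerivAt_id s).const_mul (u : ℝ)) zero_le_one one_pos
      (fun u s _ => DCBound.const (fun _ => one_pos) rfl _ zero_le_one ?_)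
    · rw [abs_mul, abs_of_nonneg u.2.1]
      exact mul_le_of_le_one_left (abs_nonneg s) u.2.2
    · rw [Complex.norm_real, Real.norm_eq_abs, abs_of_nonneg u.2.1]
      exact u.2.2
  obtain ⟨δ, hδ, C, hC, ρ, hρ, hb⟩ := iff_exists.1 hf
  have hcont : ∀ s ∈ Ioo (-δ) δ, ContinuousAt (_root_.deriv f) s := fun s hs => by
    have := ((hb s hs).1.iteratedDeriv_infty 1).continuousAt
    rwa [iteratedDeriv_one] at this
  have hmem : ∀ u ∈ Icc (0 : ℝ) 1, ∀ s ∈ Ioo (-δ) δ, u * s ∈ Ioo (-δ) δ := fun u hu s hs => by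
    refine abs_lt.1 (lt_of_le_of_lt ?_ (abs_lt.2 hs))
    rw [abs_mul, abs_of_nonneg hu.1]
    exact mul_le_of_le_one_left (abs_nonneg s) hu.2
  -- Far from 0 the quotient is taken literally, so that the factorization holds for every real t
  -- and not only near 0.
  let G : ℝ → ℂ := fun s => if s ∈ Ioo (-δ) δ then ∫ u : unitInterval, _root_.deriv f (u * s)
    else f s / s
  have hmeas : ∀ s ∈ Ioo (-δ) δ, Continuous fun u : unitInterval => _root_.deriv f (u * s) :=
    fun s hs => continuous_iff_continuousAt.2 fun u =>
      ContinuousAt.comp (f := fun u : unitInterval => (u : ℝ) * s) (hcont _ (hmem u u.2 s hs))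
        (by fun_prop)
  -- Cutting off outside the interval keeps the integrand measurable in u at every s without
  -- changing germs at 0.
  have hcut : UGerm M fun (u : unitInterval) s =>
      if s ∈ Ioo (-δ) δ then _root_.deriv f (u * s) else 0 := by
    obtain ⟨η, hη, C, hC, ρ, hρ, h⟩ := hF
    refine ⟨min δ η, lt_min hδ hη, C, hC, ρ, hρ, fun u x hx => ?_⟩
    have h1 := min_le_left δ η
    have h2 := min_le_right δ η
    refine (h u x ⟨by linarith [hx.1], by linarith [hx.2]⟩).congr ?_
    filter_upwards [isOpen_Ioo.mem_nhds (show x ∈ Ioo (-δ) δ from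
      ⟨by linarith [hx.1], by linarith [hx.2]⟩)] with y hy
    rw [if_pos hy]
  refine ⟨G, (UGerm.integral (μ := MeasureTheory.volume) hM hcut fun x => ?_).congr ?_,
    fun t => ?_⟩
  · by_cases hx : x ∈ Ioo (-δ) δ
    · simpa only [if_pos hx] using (hmeas x hx).aestronglyMeasurable
    · simpa only [if_neg hx] using MeasureTheory.aestronglyMeasurable_const
  · filter_upwards [isOpen_Ioo.mem_nhds (show (0 : ℝ) ∈ Ioo (-δ) δ from ⟨by linarith, hδ⟩)] with s hs
    simp only [G, if_pos hs]
  · by_cases ht : t ∈ Ioo (-δ) δ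
    · simp only [G, if_pos ht]
      have e1 : ∫ u : unitInterval, _root_.deriv f (u * t) =
          ∫ u in (0 : ℝ)..1, _root_.deriv f (u * t) := by
        rw [intervalIntegral.integral_of_le zero_le_one,
          ← MeasureTheory.integral_Icc_eq_integral_Ioc]
        exact MeasureTheory.integral_subtype measurableSet_Icc
          (fun u : ℝ => _root_.deriv f (u * t))
      rw [e1, ← intervalIntegral.integral_const_mul]
      have e2 := intervalIntegral.integral_eq_sub_of_hasDerivAt (a := 0) (b := 1)
        (f := fun u : ℝ => f (u * t)) (f' := fun u => (t : ℂ) * _root_.deriv f (u * t))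
        (fun u hu => by
          rw [uIcc_of_le zero_le_one] at hu
          have h1 := ((hb _ (hmem u hu t ht)).1.differentiableAt (by simp)).hasDerivAt
          have h2 : HasDerivAt (fun u : ℝ => u * t) t u := by
            simpa using (hasDerivAt_id u).mul_const t
          have := h1.scomp u h2
          rwa [Complex.real_smul] at this)
        (ContinuousOn.intervalIntegrable fun u hu => by
          rw [uIcc_of_le zero_le_one] at hu
          refine ContinuousAt.continuousWithinAt (continuousAt_const.mul ?_)
          exact ContinuousAt.comp (f := fun u : ℝ => u * t) (hcont _ (hmem u hu t ht))
            (by fun_prop))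
      rw [e2]
      simp [h0]
    · have : t ≠ 0 := fun h => ht (by subst h; exact ⟨by linarith, hδ⟩)
      simp only [G, if_neg ht]
      rw [mul_div_cancel₀ _ (Complex.ofReal_ne_zero.2 this)]

end GM

/-! ### Flat functions and orders of vanishing. -/

/-- The function `f` is flat at `0`: it vanishes there of infinite order. -/
def Flat (f : ℝ → ℂ) : Prop := ∀ k : ℕ, f =O[𝓝 0] fun s : ℝ => s ^ k

theorem tendsto_pow_nhds_zero {N : ℕ} (hN : 1 ≤ N) :
    Tendsto (fun s : ℝ => s ^ N) (𝓝 0) (𝓝 0) := by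
  have := (continuous_pow N).tendsto (0 : ℝ)
  rwa [zero_pow (by omega)] at this

namespace Flat

variable {f g : ℝ → ℂ}

theorem comp_pow (hf : Flat f) {N : ℕ} (hN : 1 ≤ N) : Flat fun s => f (s ^ N) := fun k => by
  have h1 := (hf k).comp_tendsto (tendsto_pow_nhds_zero hN)
  refine h1.trans ?_
  refine Asymptotics.IsBigO.of_bound 1 ?_
  filter_upwards [Metric.ball_mem_nhds (0 : ℝ) one_pos] with s hs
  rw [Metric.mem_ball, dist_zero_right] at hs
  simp only [Function.comp_apply, norm_pow, one_mul]
  rw [← pow_mul]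
  exact pow_le_pow_of_le_one (norm_nonneg s) hs.le (by nlinarith)

theorem congr (hf : Flat f) (h : f =ᶠ[𝓝 0] g) : Flat g := fun k => (hf k).congr' h EventuallyEq.rfl

theorem zero : Flat fun _ => 0 := fun _ => Asymptotics.isBigO_zero _ _

theorem apply_zero (hf : Flat f) : f 0 = 0 := by
  have := (hf 1).eq_zero_imp
  simpa using this.self_of_nhds

theorem add (hf : Flat f) (hg : Flat g) : Flat fun s => f s + g s := fun k => (hf k).add (hg k)

theorem sub (hf : Flat f) (hg : Flat g) : Flat fun s => f s - g s := fun k => (hf k).sub (hg k)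

theorem mul_left (hf : Flat f) (hg : ContinuousAt g 0) : Flat fun s => g s * f s := fun k => by
  simpa using (hg.tendsto.isBigO_one ℝ).mul (hf k)

theorem sum {ι : Type*} {s : Finset ι} {F : ι → ℝ → ℂ} (h : ∀ i ∈ s, Flat (F i)) :
    Flat fun t => ∑ i ∈ s, F i t := fun k => by
  simpa only [Finset.sum_fn] using Asymptotics.IsBigO.sum fun i hi => h i hi k

end Flat

namespace GM

variable {M : ℕ → ℝ} {f : ℝ → ℂ}

/-- Factors of t are split off one at a time: the current quotient tends to 0 along `l`, hence
vanishes at 0 by continuity. Growth information along any filter `l` accumulating at 0, for instance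
from one side, is enough. -/
theorem exists_eq_pow_mul (hM : IsRegularSeq M) (hf : GM M f) {l : Filter ℝ} [l.NeBot]
    (hl : l ≤ 𝓝[≠] 0) {m : ℕ} (h : f =O[l] fun t : ℝ => t ^ m) :
    ∃ u, GM M u ∧ ∀ t : ℝ, f t = t ^ m * u t := by
  suffices H : ∀ j ≤ m, ∃ u, GM M u ∧ ∀ t : ℝ, f t = t ^ j * u t from H m le_rfl
  intro j
  induction j with
  | zero => exact fun _ => ⟨f, hf, by simp⟩
  | succ j ih =>
    intro hj
    obtain ⟨u, hu, hfu⟩ := ih (by omega)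
    have hne : ∀ᶠ t in l, t ≠ 0 := hl eventually_mem_nhdsWithin
    have h1 : u =O[l] fun t : ℝ => t ^ (m - j) := by
      have h3 : (fun t : ℝ => (((t : ℂ) ^ j)⁻¹ : ℂ)) =O[l] fun t : ℝ => (t ^ j)⁻¹ :=
        Asymptotics.IsBigO.of_bound 1 (Eventually.of_forall fun t => by simp)
      have h4 := h.mul h3
      refine h4.congr' ?_ ?_
      · filter_upwards [hne] with t ht
        have : (t : ℂ) ^ j ≠ 0 := pow_ne_zero _ (Complex.ofReal_ne_zero.2 ht)
        rw [hfu]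
        field_simp
      · filter_upwards [hne] with t ht
        rw [show m = (m - j) + j by omega, pow_add, Nat.add_sub_cancel]
        have : t ^ j ≠ 0 := pow_ne_zero _ ht
        field_simp
    have hl0 : l ≤ 𝓝 0 := hl.trans nhdsWithin_le_nhds
    have h5 : Tendsto u l (𝓝 0) :=
      h1.trans_tendsto ((tendsto_pow_nhds_zero (by omega)).mono_left hl0)
    have h6 : u 0 = 0 := tendsto_nhds_unique (hu.continuousAt.tendsto.mono_left hl0) h5
    obtain ⟨v, hv, huv⟩ := hu.exists_eq_mul hM h6
    exact ⟨v, hv, fun t => by rw [hfu, huv]; ring⟩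

theorem isBigO_pow {u : ℝ → ℂ} (hu : GM M u) {m : ℕ} (h : ∀ t : ℝ, f t = t ^ m * u t) :
    f =O[𝓝 0] fun t : ℝ => t ^ m := by
  have h1 : (fun t : ℝ => ((t : ℂ) ^ m)) =O[𝓝 0] fun t : ℝ => t ^ m :=
    Asymptotics.IsBigO.of_bound 1 (Eventually.of_forall fun t => by simp)
  have := h1.mul (hu.continuousAt.tendsto.isBigO_one ℝ)
  simpa [← h] using this

/-- If no finite order is reached, a factor t can be split off indefinitely. -/
theorem flat_or (hM : IsRegularSeq M) (hf : GM M f) :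
    Flat f ∨ ∃ m u, GM M u ∧ u 0 ≠ 0 ∧ ∀ t : ℝ, f t = t ^ m * u t := by
  by_contra! H
  obtain ⟨h1, h2⟩ := H
  refine h1 fun m => ?_
  suffices ∃ u, GM M u ∧ ∀ t : ℝ, f t = t ^ m * u t by
    obtain ⟨u, hu, h⟩ := this
    exact isBigO_pow hu h
  induction m with
  | zero => exact ⟨f, hf, by simp⟩
  | succ m ih =>
    obtain ⟨u, hu, h⟩ := ih
    have h0 : u 0 = 0 := by
      by_contra h0
      obtain ⟨t, ht⟩ := h2 m u hu h0
      exact ht (h t)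
    obtain ⟨v, hv, huv⟩ := hu.exists_eq_mul hM h0
    exact ⟨v, hv, fun t => by rw [h, huv]; ring⟩

theorem eventually_lower {u : ℝ → ℂ} (hu : GM M u) (hu0 : u 0 ≠ 0) {m : ℕ}
    (h : ∀ t : ℝ, f t = t ^ m * u t) :
    ∃ c > (0 : ℝ), ∀ᶠ t in 𝓝 (0 : ℝ), c * |t| ^ m ≤ ‖f t‖ := by
  refine ⟨‖u 0‖ / 2, by positivity, ?_⟩
  have : ∀ᶠ t in 𝓝 (0 : ℝ), ‖u 0‖ / 2 < ‖u t‖ :=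
    hu.continuousAt.norm.eventually (lt_mem_nhds (by linarith [norm_pos_iff.2 hu0]))
  filter_upwards [this] with t ht
  rw [h, norm_mul, norm_pow, Complex.norm_real, Real.norm_eq_abs, mul_comm]
  gcongr

theorem flat_of_isBigO (hM : IsRegularSeq M) (hf : GM M f) {l : Filter ℝ} [l.NeBot]
    (hl : l ≤ 𝓝[≠] 0) (h : ∀ m : ℕ, f =O[l] fun t : ℝ => t ^ m) : Flat f := fun m => by
  obtain ⟨u, hu, hfu⟩ := hf.exists_eq_pow_mul hM hl (h m)
  exact isBigO_pow hu hfu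

theorem iteratedDeriv_eq_zero_of_flat (hM : IsRegularSeq M) (hf : GM M f) (h : Flat f) (k : ℕ) :
    iteratedDeriv k f 0 = 0 := by
  obtain ⟨u, hu, hfu⟩ := hf.exists_eq_pow_mul hM (le_refl (𝓝[≠] (0 : ℝ)))
    ((h (k + 1)).mono nhdsWithin_le_nhds)
  have hp := ofReal_pow hM (k + 1)
  have he : f = (fun t : ℝ => (t : ℂ) ^ (k + 1)) * u := funext hfu
  rw [he, iteratedDeriv_mul (hp.contDiffAt.of_le (by exact_mod_cast le_top))
    (hu.contDiffAt.of_le (by exact_mod_cast le_top))]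
  refine Finset.sum_eq_zero fun i hi => ?_
  have hi' : i < k + 1 := Finset.mem_range.1 hi
  have : iteratedDeriv i (fun t : ℝ => (t : ℂ) ^ (k + 1)) 0 = 0 := by
    have h1 := Complex.ofRealCLM.iteratedDeriv_comp_left (f := fun t : ℝ => t ^ (k + 1)) (x := 0)
      (contDiff_id.pow (k + 1)).contDiffAt i
    simp only [Complex.ofRealCLM_apply, Complex.ofReal_pow] at h1
    rw [h1, iteratedDeriv_fun_pow_zero, if_neg (by omega)]
    simp
  rw [this]
  ring

/-- Quasianalyticity enters the argument through this lemma: flatness annihilates the whole Taylor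
series at 0. -/
theorem eventually_eq_zero_of_flat (hM : IsRegularSeq M) (hq : IsQuasianalytic M) (hf : GM M f)
    (h : Flat f) : f =ᶠ[𝓝 0] 0 := by
  obtain ⟨δ, hδ, hD⟩ := exists_isDC hf
  have h0 : (0 : ℝ) ∈ Ioo (-δ) δ := ⟨by linarith, hδ⟩
  have key : ∀ L : ℂ →L[ℝ] ℝ, ∀ y ∈ Ioo (-δ) δ, L (f y) = 0 := fun L =>
    hq _ isOpen_Ioo isPreconnected_Ioo _ (hD.clm_comp hM.pos isOpen_Ioo L) 0 h0 fun k => by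
      rw [L.iteratedDeriv_comp_left hf.contDiffAt, iteratedDeriv_eq_zero_of_flat hM hf h, map_zero]
  filter_upwards [isOpen_Ioo.mem_nhds h0] with y hy
  exact Complex.ext (key Complex.reCLM y hy) (key Complex.imCLM y hy)

end GM

theorem aeval_pi_apply {κ : Type*} (z : κ → ℝ → ℂ) (F : MvPolynomial κ ℂ) (t : ℝ) :
    MvPolynomial.aeval z F t = MvPolynomial.aeval (fun i => z i t) F :=
  MvPolynomial.comp_aeval_apply (f := z) (Pi.evalAlgHom ℂ (fun _ : ℝ => ℂ) t) F

/-! ### Elementary symmetric functions and admissible root tuples. -/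

section Symmetric

variable {ι : Type} [Fintype ι]

/-- The elementary symmetric function of degree `k` of the numbers `z i`. -/
noncomputable def es (k : ℕ) (z : ι → ℂ) : ℂ := MvPolynomial.aeval z (MvPolynomial.esymm ι ℂ k)

theorem es_eq_sum (k : ℕ) (z : ι → ℂ) :
    es k z = ∑ t ∈ Finset.powersetCard k Finset.univ, ∏ i ∈ t, z i :=
  MvPolynomial.aeval_esymm_eq_multiset_esymm ι ℂ k z |>.trans (Finset.esymm_map_val _ _ _)

theorem continuous_es (k : ℕ) : Continuous (es k : (ι → ℂ) → ℂ) := by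
  have : (es k : (ι → ℂ) → ℂ) = fun z => ∑ t ∈ Finset.powersetCard k Finset.univ, ∏ i ∈ t, z i :=
    _root_.funext (es_eq_sum k)
  rw [this]
  fun_prop

theorem es_mul (k : ℕ) (a : ℂ) (z : ι → ℂ) : es k (fun i => a * z i) = a ^ k * es k z := by
  simp only [es_eq_sum, Finset.mul_sum]
  refine Finset.sum_congr rfl fun t ht => ?_
  rw [Finset.prod_mul_distrib, Finset.prod_const, (Finset.mem_powersetCard.1 ht).2]

theorem prod_X_sub_C_eq (z : ι → ℂ) : ∏ i, (X - C (z i)) =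
    ∑ j ∈ Finset.range (Fintype.card ι + 1),
      (-1) ^ j * (C (es j z) * X ^ (Fintype.card ι - j)) := by
  have := Multiset.prod_X_sub_X_eq_sum_esymm (Finset.univ.val.map z)
  simp only [Multiset.map_map, Multiset.card_map, Finset.card_val, Finset.card_univ] at this
  refine Eq.trans ?_ (this.trans ?_)
  · rfl
  · refine Finset.sum_congr rfl fun j _ => ?_
    rw [← MvPolynomial.aeval_esymm_eq_multiset_esymm ι ℂ, es]

theorem es_perm (k : ℕ) (z : ι → ℂ) (σ : Equiv.Perm ι) : es k (fun i => z (σ i)) = es k z := by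
  have := MvPolynomial.esymm_isSymmetric ι ℂ k σ
  rw [es, es]
  conv_rhs => rw [← this, MvPolynomial.aeval_rename]
  rfl

theorem exists_perm_of_map_eq {α : Type*} {x y : ι → α}
    (h : Finset.univ.val.map x = Finset.univ.val.map y) :
    ∃ σ : Equiv.Perm ι, ∀ i, x i = y (σ i) := by
  classical
  have hc : ∀ v, Nonempty ({i // x i = v} ≃ {i // y i = v}) := fun v => by
    refine Fintype.card_eq.1 ?_
    have := congrArg (Multiset.count v) h
    rw [Multiset.count_map, Multiset.count_map] at this
    simp only [Fintype.card_subtype]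
    simpa [Finset.card_def, eq_comm] using this
  refine ⟨Equiv.ofFiberEquiv fun v => (hc v).some, fun i => ?_⟩
  exact (Equiv.ofFiberEquiv_map _ i).symm

theorem exists_perm_of_es_eq {x y : ι → ℂ} (h : ∀ k, es k x = es k y) :
    ∃ σ : Equiv.Perm ι, ∀ i, x i = y (σ i) := by
  have h1 : ∏ i, (X - C (x i)) = ∏ i, (X - C (y i)) := by
    rw [prod_X_sub_C_eq, prod_X_sub_C_eq]
    simp only [h]
  refine exists_perm_of_map_eq ?_
  have := congrArg Polynomial.roots h1
  have e : ∀ z : ι → ℂ, (∏ i, (X - C (z i))).roots = Finset.univ.val.map z := fun z => by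
    have := Polynomial.roots_multiset_prod_X_sub_C (Finset.univ.val.map z)
    rwa [Multiset.map_map] at this
  rwa [e, e] at this

/-- If |z i| > 2B, the polynomial equation gives |z i|^(n+1) ≤ B·S with S = Σ B^k |z i|^(n-k),
whereas (|z i| - B)·S ≤ |z i|^(n+1) and |z i| - B > B. -/
theorem norm_le_of_es_le {z : ι → ℂ} {B : ℝ} (hB : 0 ≤ B)
    (h : ∀ k, 1 ≤ k → k ≤ Fintype.card ι → ‖es k z‖ ≤ B ^ k) (i : ι) : ‖z i‖ ≤ 2 * B := by
  by_contra! hlt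
  obtain ⟨n, hn⟩ : ∃ n, Fintype.card ι = n + 1 :=
    ⟨Fintype.card ι - 1, by have := Fintype.card_pos_iff.2 ⟨i⟩; omega⟩
  have h0 : (∏ j, (X - C (z j))).eval (z i) = 0 := by
    rw [eval_prod]
    exact Finset.prod_eq_zero (Finset.mem_univ i) (by simp)
  rw [prod_X_sub_C_eq, eval_finsetSum, hn, Finset.sum_range_succ'] at h0
  have e0 : es 0 z = 1 := by simp [es]
  simp only [eval_mul, eval_pow, eval_neg, eval_one, eval_C, eval_X, pow_zero, one_mul, e0,
    Nat.sub_zero] at h0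
  set S := ∑ k ∈ Finset.range (n + 1), B ^ k * ‖z i‖ ^ (n + 1 - 1 - k) with hS
  have h1 : ‖z i‖ ^ (n + 1) ≤ B * S := by
    rw [← norm_pow, eq_neg_of_add_eq_zero_right h0, norm_neg, hS, Finset.mul_sum]
    refine (norm_sum_le _ _).trans (Finset.sum_le_sum fun k hk => ?_)
    have hk' := Finset.mem_range.1 hk
    have := h (k + 1) (by omega) (by omega)
    rw [norm_mul, norm_mul, norm_pow, norm_neg, norm_one, one_pow, one_mul, norm_pow,
      show n + 1 - (k + 1) = n + 1 - 1 - k by omega, ← mul_assoc, ← pow_succ']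
    gcongr
  have h2 : (‖z i‖ - B) * S = ‖z i‖ ^ (n + 1) - B ^ (n + 1) := by
    have := (Commute.all B ‖z i‖).mul_geom_sum₂ (n + 1)
    linarith
  have hz : 0 < ‖z i‖ := by linarith
  have h3 : 0 < S := by
    rw [hS, Finset.sum_range_succ']
    have : 0 ≤ ∑ k ∈ Finset.range n, B ^ (k + 1) * ‖z i‖ ^ (n + 1 - 1 - (k + 1)) :=
      Finset.sum_nonneg fun _ _ => by positivity
    have h4 : 0 < B ^ 0 * ‖z i‖ ^ (n + 1 - 1 - 0) := by positivity
    linarith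
  have h5 : 0 ≤ B ^ (n + 1) := by positivity
  nlinarith

/-- The root functions `z i` have elementary symmetric functions of class `C^M` near `0`. -/
def Adm (M : ℕ → ℝ) (z : ι → ℝ → ℂ) : Prop := ∀ k, GM M fun t => es k fun i => z i t

variable {M : ℕ → ℝ} {z : ι → ℝ → ℂ}

/-- By the fundamental theorem of symmetric polynomials, such an expression is a polynomial in the
elementary symmetric functions. -/
theorem Adm.symm (hM : IsRegularSeq M) (hz : Adm M z) {F : MvPolynomial ι ℂ} (hF : F.IsSymmetric) :
    GM M fun t => MvPolynomial.aeval (fun i => z i t) F := by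
  obtain ⟨G, hG⟩ := MvPolynomial.esymmAlgHom_surjective ℂ (σ := ι) (le_refl (Fintype.card ι))
    ⟨F, hF⟩
  have hG' : F = MvPolynomial.aeval
      (fun i : Fin (Fintype.card ι) => MvPolynomial.esymm ι ℂ (i + 1)) G := by
    rw [← MvPolynomial.esymmAlgHom_apply, hG]
  have h1 : (fun t => MvPolynomial.aeval (fun i => z i t) F) = MvPolynomial.aeval
      (fun (i : Fin (Fintype.card ι)) (t : ℝ) => es (i + 1) fun j => z j t) G := by
    funext t
    rw [aeval_pi_apply, hG', MvPolynomial.comp_aeval_apply]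
    rfl
  rw [h1]
  have h2 : MvPolynomial.aeval
      (fun (i : Fin (Fintype.card ι)) (t : ℝ) => es (i + 1) fun j => z j t) G ∈
      GM.subalgebra hM := by
    have h3 : ∀ i : Fin (Fintype.card ι), (fun t : ℝ => es (i + 1) fun j => z j t) ∈
        GM.subalgebra hM := fun i => hz _
    have := Subalgebra.mvPolynomial_aeval_coe (GM.subalgebra hM)
      (fun i : Fin (Fintype.card ι) => ⟨_, h3 i⟩) G
    rw [this]
    exact Subtype.property _
  exact h2

/-- Newton's identities, solved for the elementary symmetric functions by dividing by k. -/
theorem adm_of_psum (hM : IsRegularSeq M) (h : ∀ k, GM M fun t => ∑ i, z i t ^ k) : Adm M z := by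
  intro k
  induction k using Nat.strong_induction_on with
  | _ k ih =>
  rcases Nat.eq_zero_or_pos k with rfl | hk
  · simpa [es] using GM.const hM 1
  have h1 : (fun t => es k fun i => z i t) = ((k : ℂ)⁻¹ * (-1) ^ (k + 1)) •
      ∑ a ∈ Finset.HasAntidiagonal.antidiagonal k with a.1 < k, ((-1 : ℂ) ^ a.1) •
        ((fun t => es a.1 fun i => z i t) * fun t => ∑ i, z i t ^ a.2) := by
    funext t
    have := congrArg (MvPolynomial.aeval fun i => z i t) (MvPolynomial.mul_esymm_eq_sum ι ℂ k)
    simp only [map_mul, map_natCast, map_pow, map_neg, map_one, map_sum, MvPolynomial.psum,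
      MvPolynomial.aeval_X] at this
    have hk' : (k : ℂ) ≠ 0 := by exact_mod_cast hk.ne'
    simp only [Pi.smul_apply, Finset.sum_apply, Pi.mul_apply, smul_eq_mul]
    simp only [es]
    rw [mul_assoc, eq_inv_mul_iff_mul_eq₀ hk', this]
    simp only [mul_assoc]
  rw [h1]
  refine (GM.subalgebra hM).smul_mem ((GM.subalgebra hM).sum_mem fun a ha => ?_) _
  exact (GM.subalgebra hM).smul_mem ((GM.subalgebra hM).mul_mem
    (ih _ (Finset.mem_filter.1 ha).2) (h _)) _

theorem Adm.psum (hM : IsRegularSeq M) (hz : Adm M z) (k : ℕ) : GM M fun t => ∑ i, z i t ^ k := by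
  simpa [MvPolynomial.psum] using hz.symm hM (MvPolynomial.psum_isSymmetric ι ℂ k)

end Symmetric

/-! ### Continuity of the root tuple and splitting by contour integrals. -/

section Roots

variable {ι : Type} [Fintype ι]

theorem exists_tendsto_of_bounded {ι : Type} {z : ι → ℝ → ℂ} (g : Ultrafilter ℝ) {R : ℝ}
    (h : ∀ᶠ t in (g : Filter ℝ), ∀ i, ‖z i t‖ ≤ R) :
    ∃ y : ι → ℂ, Tendsto (fun t i => z i t) g (𝓝 y) := by
  have hK : IsCompact (Set.pi univ fun _ : ι => Metric.closedBall (0 : ℂ) R) :=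
    isCompact_univ_pi fun _ => isCompact_closedBall _ _
  obtain ⟨y, -, hy⟩ := hK.ultrafilter_le_nhds (g.map fun t i => z i t) (by
    rw [le_principal_iff]
    refine Filter.mem_map.2 ?_
    filter_upwards [h] with t ht
    exact fun i _ => by simpa using ht i)
  exact ⟨y, hy⟩

theorem eventually_bounded {z : ι → ℝ → ℂ} {t₀ : ℝ}
    (h : ∀ k, ContinuousAt (fun t => es k fun i => z i t) t₀) :
    ∃ R, ∀ᶠ t in 𝓝 t₀, ∀ i, ‖z i t‖ ≤ R := by
  set B : ℝ := 1 + ∑ k ∈ Finset.range (Fintype.card ι + 1), (‖es k fun i => z i t₀‖ + 1) with hB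
  refine ⟨2 * B, ?_⟩
  have h1 : ∀ᶠ t in 𝓝 t₀, ∀ k ∈ Finset.range (Fintype.card ι + 1),
      ‖es k fun i => z i t‖ < ‖es k fun i => z i t₀‖ + 1 :=
    (Finset.eventually_all _).2 fun k _ => (h k).norm.eventually (gt_mem_nhds (by linarith))
  have hnn : ∀ k ∈ Finset.range (Fintype.card ι + 1), 0 ≤ ‖es k fun i => z i t₀‖ + 1 :=
    fun k _ => by positivity
  have hB1 : 1 ≤ B := by linarith [Finset.sum_nonneg hnn]
  filter_upwards [h1] with t ht i
  refine norm_le_of_es_le (z := fun i => z i t) (zero_le_one.trans hB1) (fun k hk1 hk2 => ?_) i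
  have hk : k ∈ Finset.range (Fintype.card ι + 1) := Finset.mem_range.2 (by omega)
  calc _ ≤ ‖es k fun i => z i t₀‖ + 1 := (ht k hk).le
    _ ≤ B := by
      have := Finset.single_le_sum hnn hk
      linarith
    _ ≤ B ^ k := le_self_pow₀ hB1 (by omega)

/-- Roots of polynomials with bounded coefficients are bounded, so along every ultrafilter tending
to t₀ they converge. The limit has the same symmetric functions as the tuple at t₀, hence is a
permutation of it. -/
theorem eventually_perm_near {z : ι → ℝ → ℂ} {t₀ : ℝ}
    (h : ∀ k, ContinuousAt (fun t => es k fun i => z i t) t₀) {ε : ℝ} (hε : 0 < ε) :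
    ∀ᶠ t in 𝓝 t₀, ∃ σ : Equiv.Perm ι, ∀ i, ‖z (σ i) t - z i t₀‖ < ε := by
  obtain ⟨R, hR⟩ := eventually_bounded h
  refine mem_iff_ultrafilter.2 fun g hg => ?_
  obtain ⟨y, hy⟩ := exists_tendsto_of_bounded g (hg hR)
  have h1 : ∀ k, es k (fun i => z i t₀) = es k y := fun k =>
    tendsto_nhds_unique ((h k).mono_left hg) (((continuous_es k).tendsto y).comp hy)
  obtain ⟨σ, hσ⟩ := exists_perm_of_es_eq h1
  have h2 : ∀ᶠ t in (g : Filter ℝ), ∀ i, ‖z i t - y i‖ < ε := by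
    refine eventually_all.2 fun i => ?_
    have h3 : Tendsto (fun t => ‖z i t - y i‖) g (𝓝 0) := by
      have := ((tendsto_pi_nhds.1 hy i).sub_const (y i)).norm
      simpa using this
    exact h3.eventually (gt_mem_nhds hε)
  filter_upwards [h2] with t ht
  exact ⟨σ, fun i => by rw [hσ i]; exact ht (σ i)⟩

theorem roots_prod_X_sub_C' (z : ι → ℂ) : (∏ i, (X - C (z i))).roots = Finset.univ.val.map z := by
  have := Polynomial.roots_multiset_prod_X_sub_C (Finset.univ.val.map z)
  rwa [Multiset.map_map] at this

theorem derivative_div_eval (z : ι → ℂ) {ζ : ℂ} (h : ∀ i, ζ ≠ z i) :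
    (∏ i, (X - C (z i))).derivative.eval ζ / (∏ i, (X - C (z i))).eval ζ = ∑ i, 1 / (ζ - z i) := by
  have h0 : (∏ i, (X - C (z i))).eval ζ ≠ 0 := by
    rw [eval_prod]
    exact Finset.prod_ne_zero_iff.2 fun i _ => by simpa [sub_eq_zero] using h i
  have hs : (∏ i, (X - C (z i))).Splits := Polynomial.Splits.prod fun i _ => Splits.X_sub_C _
  rw [hs.eval_derivative_div_eval_of_ne_zero h0, roots_prod_X_sub_C', Multiset.map_map]
  rfl

/-- Cauchy's formula for each summand: the roots satisfying `p` lie inside the circle of radius 2r,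
the others outside. -/
theorem circleIntegral_pow_mul_sum (z : ι → ℂ) (p : ι → Prop) [DecidablePred p] {w : ℂ} {r : ℝ}
    (hr : 0 < r) (h : ∀ i, (p i → ‖z i - w‖ < r) ∧ (¬ p i → 3 * r < ‖z i - w‖)) (k : ℕ) :
    (∮ ζ in C(w, 2 * r), ζ ^ k * ∑ i, 1 / (ζ - z i)) =
      2 * Real.pi * Complex.I * ∑ i : {i // p i}, z i ^ k := by
  have hne : ∀ i, ∀ ζ ∈ Metric.sphere w (2 * r), ζ ≠ z i := by
    rintro i _ hζ rfl
    rw [mem_sphere_iff_norm] at hζ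
    by_cases hp : p i
    · linarith [(h i).1 hp]
    · linarith [(h i).2 hp]
  have hint : ∀ i, CircleIntegrable (fun ζ => ζ ^ k / (ζ - z i)) w (2 * r) := fun i =>
    ContinuousOn.circleIntegrable (by positivity)
      (ContinuousOn.div (by fun_prop) (by fun_prop) fun ζ hζ => sub_ne_zero.2 (hne i ζ hζ))
  have e1 : (∮ ζ in C(w, 2 * r), ζ ^ k * ∑ i, 1 / (ζ - z i)) =
      ∑ i, ∮ ζ in C(w, 2 * r), ζ ^ k / (ζ - z i) := by
    rw [← circleIntegral.integral_fun_sum fun i _ => hint i]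
    refine circleIntegral.integral_congr (by positivity) fun ζ _ => ?_
    simp only [Finset.mul_sum, mul_one_div]
  have e2 : ∀ i, (∮ ζ in C(w, 2 * r), ζ ^ k / (ζ - z i)) =
      if p i then 2 * Real.pi * Complex.I * z i ^ k else 0 := by
    intro i
    split_ifs with hp
    · exact Complex.circleIntegral_div_sub_of_differentiable_on_off_countable (s := ∅)
        countable_empty (by rw [Metric.mem_ball, dist_eq_norm]; linarith [(h i).1 hp])
        (by fun_prop) (fun ζ _ => by fun_prop)
    · have hne' : ∀ ζ ∈ Metric.closedBall w (2 * r), ζ - z i ≠ 0 := fun ζ hζ h0 => by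
        rw [sub_eq_zero] at h0
        rw [Metric.mem_closedBall, dist_eq_norm, h0] at hζ
        linarith [(h i).2 hp]
      exact Complex.circleIntegral_eq_zero_of_differentiable_on_off_countable (by positivity)
        (s := ∅) countable_empty
        (ContinuousOn.div (by fun_prop) (by fun_prop) hne')
        (fun ζ hζ => DifferentiableAt.div (by fun_prop) (by fun_prop)
          (hne' ζ (Metric.ball_subset_closedBall hζ.1)))
  rw [e1, Finset.mul_sum, Finset.sum_congr rfl fun i _ => e2 i, ← Finset.sum_filter]
  exact (Finset.sum_subtype _ (by simp) _)

variable {M : ℕ → ℝ} {z : ι → ℝ → ℂ}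

/-- The power sums of the selected roots are (2πi)⁻¹ ∮ ζ^k P'(ζ)/P(ζ) dζ. On the circle of radius 2r
every root has distance at least r from ζ, so |P(ζ)| ≥ r^n and the integrand is a uniform family of
C^M germs. Newton's identities then give the symmetric functions. -/
theorem Adm.restrict (hM : IsRegularSeq M) (hz : Adm M z) (p : ι → Prop) [DecidablePred p] {w : ℂ}
    {r : ℝ} (hr : 0 < r)
    (h : ∀ᶠ t in 𝓝 (0 : ℝ), ∀ i, (p i → ‖z i t - w‖ < r) ∧ (¬ p i → 3 * r < ‖z i t - w‖)) :
    Adm M fun i : {i // p i} => z i := by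
  refine adm_of_psum hM fun k => ?_
  set n := Fintype.card ι
  let c : ℝ → ℂ := circleMap w (2 * r)
  have hc : Continuous c := continuous_circleMap _ _
  have hcb : ∀ θ, ‖c θ‖ ≤ ‖w‖ + 2 * r := fun θ => by
    have : ‖c θ - w‖ = 2 * r := by
      rw [← mem_sphere_iff_norm]
      exact circleMap_mem_sphere _ (by positivity) _
    calc ‖c θ‖ = ‖w + (c θ - w)‖ := by ring_nf
      _ ≤ _ := (norm_add_le _ _).trans (by rw [this])
  have hcG : UGerm M fun (θ : ℝ) (_ : ℝ) => c θ := UGerm.const hM hcb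
  have hes : ∀ j, UGerm M fun (_ : ℝ) (t : ℝ) => es j fun i => z i t := fun j => (hz j).uGerm
  let S := UGerm.subalgebra ℝ hM
  let A : ℝ → ℝ → ℂ := fun θ t => (∏ i, (X - C (z i t))).eval (c θ)
  let B : ℝ → ℝ → ℂ := fun θ t => (∏ i, (X - C (z i t))).derivative.eval (c θ)
  have hAeq : A = ∑ j ∈ Finset.range (n + 1), ((-1 : ℂ) ^ j) •
      ((fun (_ : ℝ) (t : ℝ) => es j fun i => z i t) * (fun (θ : ℝ) (_ : ℝ) => c θ) ^ (n - j)) := by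
    funext θ t
    simp only [A, prod_X_sub_C_eq, eval_finsetSum, Finset.sum_apply, Pi.smul_apply, Pi.mul_apply,
      Pi.pow_apply, smul_eq_mul]
    simp [n]
  have hBeq : B = ∑ j ∈ Finset.range (n + 1), ((-1 : ℂ) ^ j * (n - j : ℕ)) •
      ((fun (_ : ℝ) (t : ℝ) => es j fun i => z i t) *
        (fun (θ : ℝ) (_ : ℝ) => c θ) ^ (n - j - 1)) := by
    funext θ t
    simp only [B, prod_X_sub_C_eq, derivative_sum, eval_finsetSum, Finset.sum_apply, Pi.smul_apply,
      Pi.mul_apply, Pi.pow_apply, smul_eq_mul]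
    refine Finset.sum_congr rfl fun j _ => ?_
    have : ((-1 : ℂ[X]) ^ j) = C ((-1) ^ j) := by simp
    rw [this, derivative_C_mul, derivative_C_mul, derivative_X_pow]
    simp only [eval_mul, eval_C, eval_pow, eval_X, n]
    ring
  have hA : UGerm M A := by
    rw [hAeq]
    exact S.sum_mem fun j _ => S.smul_mem (S.mul_mem (hes j) (S.pow_mem hcG _)) _
  have hB : UGerm M B := by
    rw [hBeq]
    exact S.sum_mem fun j _ => S.smul_mem (S.mul_mem (hes j) (S.pow_mem hcG _)) _
  obtain ⟨η, hη, hball⟩ := Metric.eventually_nhds_iff_ball.1 h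
  rw [Real.ball_eq_Ioo, zero_sub, zero_add] at hball
  have hdist : ∀ θ, ∀ t ∈ Ioo (-η) η, ∀ i, r ≤ ‖c θ - z i t‖ := by
    intro θ t ht i
    have h1 : ‖c θ - w‖ = 2 * r := by
      rw [← mem_sphere_iff_norm]
      exact circleMap_mem_sphere _ (by positivity) _
    by_cases hp : p i
    · have h2 := (hball t ht i).1 hp
      have h3 := norm_sub_norm_le (c θ - w) (z i t - w)
      rw [sub_sub_sub_cancel_right] at h3
      linarith
    · have h2 := (hball t ht i).2 hp
      have h3 := norm_sub_norm_le (z i t - w) (c θ - w)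
      rw [sub_sub_sub_cancel_right, norm_sub_rev (z i t) (c θ)] at h3
      linarith
  have hAinv : UGerm M A⁻¹ := by
    refine hA.inv hM (c := r ^ n) (by positivity) hη fun θ t ht => ?_
    simp only [A, eval_prod, eval_sub, eval_X, eval_C, norm_prod]
    calc r ^ n = ∏ _i : ι, r := by simp [n]
      _ ≤ _ := Finset.prod_le_prod (fun _ _ => hr.le) fun i _ => hdist θ t ht i
  have hdc : UGerm M fun (θ : ℝ) (_ : ℝ) => deriv c θ := by
    refine UGerm.const (A := 2 * r) hM fun θ => ?_
    simp [c, deriv_circleMap, abs_of_pos hr]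
  let F : ℝ → ℝ → ℂ := (fun (θ : ℝ) (_ : ℝ) => deriv c θ) *
    ((fun (θ : ℝ) (_ : ℝ) => c θ) ^ k * (B * A⁻¹))
  have hF : UGerm M F := S.mul_mem hdc (S.mul_mem (S.pow_mem hcG _) (S.mul_mem hB hAinv))
  have hI := hF.integral (μ := MeasureTheory.volume.restrict (Ioc 0 (2 * Real.pi))) hM fun t => by
    have m1 : Measurable fun θ => A θ t :=
      ((∏ i, (X - C (z i t))).continuous.comp hc).measurable
    have m2 : Measurable fun θ => B θ t :=
      ((∏ i, (X - C (z i t))).derivative.continuous.comp hc).measurable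
    exact ((measurable_deriv c).mul ((hc.measurable.pow_const k).mul
      (m2.mul m1.inv))).aestronglyMeasurable
  have := (GM.subalgebra hM).smul_mem hI (2 * Real.pi * Complex.I : ℂ)⁻¹
  refine GM.congr this ?_
  filter_upwards [Ioo_mem_nhds (neg_neg_of_pos hη) hη] with t ht
  have e1 := circleIntegral_pow_mul_sum (fun i => z i t) p hr (hball t ht) k
  have e2 : (∮ ζ in C(w, 2 * r), ζ ^ k * ∑ i, 1 / (ζ - z i t)) =
      ∫ θ, F θ t ∂(MeasureTheory.volume.restrict (Ioc 0 (2 * Real.pi))) := by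
    rw [circleIntegral, intervalIntegral.integral_of_le (by positivity)]
    refine MeasureTheory.integral_congr_ae (Eventually.of_forall fun θ => ?_)
    have hne : ∀ i, c θ ≠ z i t := fun i h0 => by
      have := hdist θ t ht i
      rw [h0, sub_self, norm_zero] at this
      linarith
    simp only [F, Pi.mul_apply, Pi.pow_apply, Pi.inv_apply, smul_eq_mul]
    rw [← div_eq_mul_inv]
    simp only [A, B]
    rw [derivative_div_eval _ hne]
  rw [Pi.smul_apply, ← e2, e1, smul_eq_mul, inv_mul_cancel_left₀]
  simp [Real.pi_ne_zero]

end Roots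

/-! ### Clusters, rescaling and Newton polygon orders. -/

section Rescaling

variable {ι : Type} [Fintype ι] {M : ℕ → ℝ} {z : ι → ℝ → ℂ}

theorem Adm.continuousAt (hz : Adm M z) (k : ℕ) : ContinuousAt (fun t => es k fun i => z i t) 0 :=
  GM.continuousAt (hz k)

theorem Adm.comp_mul_pow (hM : IsRegularSeq M) (hz : Adm M z) {ε : ℝ} (hε : |ε| ≤ 1) {N : ℕ}
    (hN : 1 ≤ N) : Adm M fun i s => z i (ε * s ^ N) :=
  fun k => (hz k).comp_mul_pow hM hε hN

theorem Adm.comp_pow (hM : IsRegularSeq M) (hz : Adm M z) {N : ℕ} (hN : 1 ≤ N) :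
    Adm M fun i s => z i (s ^ N) := by
  simpa using hz.comp_mul_pow hM (ε := 1) (by simp) hN

theorem Adm.congr (hz : Adm M z) {x : ι → ℝ → ℂ}
    (h : ∀ᶠ t in 𝓝 (0 : ℝ), ∃ σ : Equiv.Perm ι, ∀ i, x i t = z (σ i) t) : Adm M x := fun k => by
  refine (hz k).congr ?_
  filter_upwards [h] with t ht
  obtain ⟨σ, hσ⟩ := ht
  simp only [hσ]
  exact (es_perm k (fun i => z i t) σ).symm

theorem Adm.center (hM : IsRegularSeq M) (hz : Adm M z) (c : ℂ) :
    Adm M fun i t => z i t - c * ∑ j, z j t := fun k => by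
  let g : ι → MvPolynomial ι ℂ := fun i => MvPolynomial.X i - MvPolynomial.C c * ∑ j, MvPolynomial.X j
  have hsymm : (MvPolynomial.aeval g (MvPolynomial.esymm ι ℂ k)).IsSymmetric := fun σ => by
    have h1 : ∀ i, MvPolynomial.rename σ (g i) = g (σ i) := fun i => by
      simp only [g, map_sub, map_mul, map_sum, MvPolynomial.rename_X, MvPolynomial.rename_C]
      rw [Equiv.sum_comp σ (fun j => (MvPolynomial.X j : MvPolynomial ι ℂ))]
    rw [MvPolynomial.comp_aeval_apply]
    simp only [h1]
    conv_rhs => rw [← MvPolynomial.esymm_isSymmetric ι ℂ k σ, MvPolynomial.aeval_rename]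
    rfl
  have := hz.symm hM hsymm
  simp only [MvPolynomial.comp_aeval_apply] at this
  simpa [es, g] using this

theorem exists_separation {y : ι → ℂ} (w : ℂ) : ∃ r > (0 : ℝ), ∀ i, y i ≠ w → 4 * r < ‖y i - w‖ := by
  classical
  have : ∀ᶠ r in 𝓝[>] (0 : ℝ), ∀ i, y i ≠ w → 4 * r < ‖y i - w‖ := by
    refine eventually_all.2 fun i => ?_
    by_cases h : y i = w
    · simp [h]
    · have hp : 0 < ‖y i - w‖ := norm_pos_iff.2 (sub_ne_zero.2 h)
      have : ∀ᶠ r : ℝ in 𝓝 0, 4 * r < ‖y i - w‖ := by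
        have ht : Tendsto (fun r : ℝ => 4 * r) (𝓝 0) (𝓝 (4 * 0)) := tendsto_id.const_mul 4
        rw [mul_zero] at ht
        exact ht.eventually (gt_mem_nhds hp)
      filter_upwards [nhdsWithin_le_nhds this] with r hr _ using hr
  obtain ⟨r, hr, h⟩ := (this.and eventually_mem_nhdsWithin).exists
  exact ⟨r, h, hr⟩

theorem Adm.exists_split (hM : IsRegularSeq M) (hz : Adm M z) {i₀ i₁ : ι} (h : z i₀ 0 ≠ z i₁ 0) :
    ∃ (p : ι → Prop) (_ : DecidablePred p) (x : ι → ℝ → ℂ), p i₀ ∧ ¬ p i₁ ∧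
      (∀ᶠ t in 𝓝 (0 : ℝ), ∃ σ : Equiv.Perm ι, ∀ i, x i t = z (σ i) t) ∧
      Adm M (fun i : {i // p i} => x i) ∧ Adm M (fun i : {i // ¬ p i} => x i) := by
  classical
  obtain ⟨r, hr, hsep⟩ := exists_separation (y := fun i => z i 0) (z i₀ 0)
  have hnear := eventually_perm_near (fun k => hz.continuousAt k) hr
  -- Relabel the roots at each t by closeness to the roots at 0. The choice need not be continuous
  -- in t, since symmetric functions do not see it.
  let τ : ℝ → Equiv.Perm ι := fun t =>
    if h : ∃ σ : Equiv.Perm ι, ∀ i, ‖z (σ i) t - z i 0‖ < r then h.choose else 1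
  have hx : ∀ t, ∃ σ : Equiv.Perm ι, ∀ i, z (τ t i) t = z (σ i) t := fun t => ⟨τ t, fun _ => rfl⟩
  have hxA : Adm M fun i t => z (τ t i) t := hz.congr (Eventually.of_forall hx)
  have hp : Adm M fun i : {i // z i 0 = z i₀ 0} => fun t => z (τ t i) t := by
    refine hxA.restrict hM (fun i => z i 0 = z i₀ 0) (w := z i₀ 0) hr ?_
    filter_upwards [hnear] with t ht i
    have h1 : ‖z (τ t i) t - z i 0‖ < r := by
      simp only [τ, dif_pos ht]
      exact ht.choose_spec i
    refine ⟨fun hi => by rwa [hi] at h1, fun hi => ?_⟩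
    have h2 := hsep i hi
    have h3 := norm_sub_norm_le (z i 0 - z i₀ 0) (z i 0 - z (τ t i) t)
    rw [sub_sub_sub_cancel_left, norm_sub_rev (z i 0) (z (τ t i) t)] at h3
    linarith
  refine ⟨fun i => z i 0 = z i₀ 0, inferInstance, fun i t => z (τ t i) t, rfl, fun h' => h h'.symm,
    Eventually.of_forall hx, hp, adm_of_psum hM fun k => ?_⟩
  -- The complementary cluster needs no contour: its power sums are the total ones minus those of
  -- the first cluster.
  have := (hxA.psum hM k).sub hM (hp.psum hM k)
  refine this.congr (Eventually.of_forall fun t => ?_)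
  rw [Pi.sub_apply, sub_eq_iff_eq_add, add_comm,
    Fintype.sum_subtype_add_sum_subtype (fun i => z i 0 = z i₀ 0) fun i => z (τ t i) t ^ k]

theorem isBigO_es {l : Filter ℝ} {p : ℕ} (h : ∀ i, z i =O[l] fun s : ℝ => s ^ p) (k : ℕ) :
    (fun s => es k fun i => z i s) =O[l] fun s : ℝ => s ^ (p * k) := by
  simp only [es_eq_sum]
  have : ∀ t ∈ Finset.powersetCard k (Finset.univ : Finset ι),
      (fun s => ∏ i ∈ t, z i s) =O[l] fun s : ℝ => s ^ (p * k) := fun t ht => by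
    have := Asymptotics.IsBigO.finsetProd (s := t) (f := z) (g := fun _ => fun s : ℝ => s ^ p)
      (fun i _ => h i)
    simpa [Finset.prod_const, (Finset.mem_powersetCard.1 ht).2, ← pow_mul, Finset.prod_fn]
      using this
  simpa only [Finset.sum_fn] using Asymptotics.IsBigO.sum this

/-- This is the root bound `norm_le_of_es_le` with B replaced by B|s|^p. -/
theorem isBigO_of_es {p : ℕ} (h : ∀ k, 1 ≤ k → k ≤ Fintype.card ι →
    (fun s => es k fun i => z i s) =O[𝓝 0] fun s : ℝ => s ^ (p * k)) (i : ι) :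
    z i =O[𝓝 0] fun s : ℝ => s ^ p := by
  have h' : ∀ k, ∃ C : ℝ, 0 ≤ C ∧ (1 ≤ k → k ≤ Fintype.card ι →
      ∀ᶠ s in 𝓝 (0 : ℝ), ‖es k fun i => z i s‖ ≤ C * ‖s ^ (p * k)‖) := fun k => by
    by_cases hk : 1 ≤ k ∧ k ≤ Fintype.card ι
    · obtain ⟨C, hC, hb⟩ := (h k hk.1 hk.2).exists_nonneg
      exact ⟨C, hC, fun _ _ => hb.bound⟩
    · exact ⟨0, le_rfl, fun h1 h2 => absurd ⟨h1, h2⟩ hk⟩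
  choose C hC0 hC using h'
  set B : ℝ := 1 + ∑ k ∈ Finset.range (Fintype.card ι + 1), C k with hB
  have hB1 : 1 ≤ B := by linarith [Finset.sum_nonneg fun k (_ : k ∈ Finset.range (Fintype.card ι + 1)) => hC0 k]
  have hall : ∀ᶠ s in 𝓝 (0 : ℝ), ∀ k ∈ Finset.range (Fintype.card ι + 1), 1 ≤ k →
      ‖es k fun i => z i s‖ ≤ C k * ‖s ^ (p * k)‖ := by
    refine (Finset.eventually_all _).2 fun k hk => ?_
    by_cases h1 : 1 ≤ k
    · filter_upwards [hC k h1 (by have := Finset.mem_range.1 hk; omega)] with s hs _ using hs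
    · exact Eventually.of_forall fun s h2 => absurd h2 h1
  refine Asymptotics.IsBigO.of_bound (2 * B) ?_
  filter_upwards [hall] with s hs
  rw [mul_assoc]
  refine norm_le_of_es_le (z := fun i => z i s) (by positivity) (fun k hk1 hk2 => ?_) i
  have hk : k ∈ Finset.range (Fintype.card ι + 1) := Finset.mem_range.2 (by omega)
  refine (hs k hk hk1).trans ?_
  rw [mul_pow, ← norm_pow, ← pow_mul]
  gcongr
  calc C k ≤ B := by
        have := Finset.single_le_sum (fun k _ => hC0 k) hk
        linarith
    _ ≤ B ^ k := le_self_pow₀ hB1 (by omega)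

/-- The symmetric functions of z/s^p are the quotients by s^(pk), which are C^M. The value at 0 is a
limit along an ultrafilter on which one root stays of exact size s^p; this limit tuple is nonzero
with sum zero, so its entries are not all equal. -/
theorem Adm.exists_rescale (hM : IsRegularSeq M) (hz : Adm M z) (hsum : ∀ t, ∑ i, z i t = 0) {p : ℕ}
    (hO : ∀ i, z i =O[𝓝 0] fun s : ℝ => s ^ p)
    (ho : ∃ i, ¬ z i =o[𝓝[≠] 0] fun s : ℝ => s ^ p) :
    ∃ y : ι → ℝ → ℂ, Adm M y ∧ (∃ i j, y i 0 ≠ y j 0) ∧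
      (∀ s, ∃ σ : Equiv.Perm ι, ∀ i, z i s = s ^ p * y (σ i) s) ∧
      ((∀ᶠ t in 𝓝 (0 : ℝ), ∀ i, (z i t).im = 0) → ∀ᶠ t in 𝓝 (0 : ℝ), ∀ i, (y i t).im = 0) := by
  obtain ⟨i₀, hi₀⟩ := ho
  rw [Asymptotics.isLittleO_iff] at hi₀
  push Not at hi₀
  obtain ⟨c, hc, hfreq⟩ := hi₀
  have hne : (𝓝[≠] (0 : ℝ) ⊓ 𝓟 {s | c * ‖s ^ p‖ < ‖z i₀ s‖}).NeBot := by
    rw [inf_principal_neBot_iff]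
    intro U hU
    obtain ⟨s, hs1, hs2⟩ := (hfreq.and_eventually hU).exists
    exact ⟨s, hs2, hs1⟩
  -- The root functions need not be continuous, so the limit is taken along an ultrafilter on which
  -- |z i₀| > c|s|^p.
  let g : Ultrafilter ℝ := Ultrafilter.of (𝓝[≠] (0 : ℝ) ⊓ 𝓟 {s | c * ‖s ^ p‖ < ‖z i₀ s‖})
  have hg : (g : Filter ℝ) ≤ 𝓝[≠] (0 : ℝ) ⊓ 𝓟 {s | c * ‖s ^ p‖ < ‖z i₀ s‖} := Ultrafilter.of_le _
  have hg1 : (g : Filter ℝ) ≤ 𝓝[≠] (0 : ℝ) := hg.trans inf_le_left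
  have hg0 : (g : Filter ℝ) ≤ 𝓝 (0 : ℝ) := hg1.trans nhdsWithin_le_nhds
  have hgc : ∀ᶠ s in (g : Filter ℝ), c * ‖s ^ p‖ < ‖z i₀ s‖ :=
    (hg.trans inf_le_right) (mem_principal_self _)
  have hgne : ∀ᶠ s in (g : Filter ℝ), s ≠ 0 := hg1 eventually_mem_nhdsWithin
  have hb : ∀ k, ∃ b, GM M b ∧ ∀ t : ℝ, es k (fun i => z i t) = t ^ (p * k) * b t := fun k =>
    GM.exists_eq_pow_mul hM (hz k) (le_refl (𝓝[≠] (0 : ℝ))) ((isBigO_es hO k).mono nhdsWithin_le_nhds)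
  choose b hbG hb using hb
  let Y : ι → ℝ → ℂ := fun i s => z i s / s ^ p
  have hYb : ∃ R, ∀ᶠ s in (g : Filter ℝ), ∀ i, ‖Y i s‖ ≤ R := by
    choose C hC using fun i => (hO i).bound
    refine ⟨∑ i, |C i|, ?_⟩
    filter_upwards [hg0 (eventually_all.2 hC), hgne] with s hs hs0 i
    have hp : 0 < ‖s ^ p‖ := norm_pos_iff.2 (pow_ne_zero _ hs0)
    have e : ‖(s : ℂ) ^ p‖ = ‖s ^ p‖ := by simp
    simp only [Y, norm_div, e]
    rw [div_le_iff₀ hp]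
    refine (hs i).trans ?_
    gcongr
    exact (le_abs_self _).trans
      (Finset.single_le_sum (f := fun i => |C i|) (fun i _ => abs_nonneg _) (Finset.mem_univ i))
  obtain ⟨R, hR⟩ := hYb
  obtain ⟨y₀, hy₀⟩ := exists_tendsto_of_bounded g hR
  have hy₀i : ∀ i, Tendsto (fun s => Y i s) g (𝓝 (y₀ i)) := tendsto_pi_nhds.1 hy₀
  have hYes : ∀ k (s : ℝ), s ≠ 0 → es k (fun i => Y i s) = b k s := fun k s hs => by
    have h1 : (s : ℂ) ^ p ≠ 0 := pow_ne_zero _ (Complex.ofReal_ne_zero.2 hs)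
    have h2 : (fun i => z i s) = fun i => (s : ℂ) ^ p * Y i s := by
      funext i
      simp only [Y]
      field_simp
    have h3 := hb k s
    rw [h2, es_mul, pow_mul] at h3
    exact mul_left_cancel₀ (pow_ne_zero k h1) h3
  have hy0es : ∀ k, es k y₀ = b k 0 := fun k => by
    refine tendsto_nhds_unique (((continuous_es k).tendsto y₀).comp hy₀) ?_
    refine ((hbG k).continuousAt.tendsto.mono_left hg0).congr' ?_
    filter_upwards [hgne] with s hs
    exact (hYes k s hs).symm
  let y : ι → ℝ → ℂ := fun i s => if s = 0 then y₀ i else Y i s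
  have hyes : ∀ k s, es k (fun i => y i s) = b k s := fun k s => by
    by_cases hs : s = 0
    · simp only [y, hs, if_true]
      exact hy0es k
    · simp only [y, hs, if_false]
      exact hYes k s hs
  refine ⟨y, fun k => (hbG k).congr (Eventually.of_forall fun s => (hyes k s).symm), ?_, ?_, ?_⟩
  · have h1 : c ≤ ‖y₀ i₀‖ := by
      refine ge_of_tendsto (hy₀i i₀).norm ?_
      filter_upwards [hgc, hgne] with s hs hs0
      have hp : 0 < ‖s ^ p‖ := norm_pos_iff.2 (pow_ne_zero _ hs0)
      have e : ‖(s : ℂ) ^ p‖ = ‖s ^ p‖ := by simp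
      simp only [Y, norm_div, e]
      rw [le_div_iff₀ hp]
      exact hs.le
    have h2 : ∑ i, y₀ i = 0 := by
      refine tendsto_nhds_unique (tendsto_finsetSum _ fun i _ => hy₀i i) ?_
      refine tendsto_const_nhds.congr fun s => ?_
      simp only [Y]
      rw [← Finset.sum_div, hsum, zero_div]
    by_contra! hall
    have h3 : ∀ i, y₀ i = y₀ i₀ := fun i => by simpa [y] using hall i i₀
    simp only [h3, Finset.sum_const, Finset.card_univ, nsmul_eq_mul, mul_eq_zero, Nat.cast_eq_zero]
      at h2
    rcases h2 with h2 | h2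
    · have := Fintype.card_pos_iff.2 ⟨i₀⟩
      omega
    · rw [h2, norm_zero] at h1
      linarith
  · intro s
    refine exists_perm_of_es_eq (y := fun i => (s : ℂ) ^ p * y i s) fun k => ?_
    rw [es_mul, hyes, hb, pow_mul]
  · intro hreal
    have hY : ∀ s, (∀ i, (z i s).im = 0) → ∀ i, (Y i s).im = 0 := fun s hs i => by
      simp only [Y]
      rw [← Complex.ofReal_pow, Complex.div_ofReal_im, hs, zero_div]
    have hy0 : ∀ i, (y₀ i).im = 0 := fun i => by
      refine tendsto_nhds_unique ((Complex.continuous_im.tendsto _).comp (hy₀i i)) ?_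
      refine tendsto_const_nhds.congr' ?_
      filter_upwards [hg0 hreal] with s hs
      exact (hY s hs i).symm
    filter_upwards [hreal] with s hs i
    by_cases h0 : s = 0
    · simp only [y, h0, if_true]
      exact hy0 i
    · simp only [y, h0, if_false]
      exact hY s hs i

/-- Let m k be the order of the k-th symmetric function and let k₀ minimize m k / k. With t = s^k₀
this slope becomes the integer m k₀, and the root bound gives O(s^(m k₀)). If all roots were o of
it, the k₀-th symmetric function would have too large an order. -/
theorem Adm.exists_order (hM : IsRegularSeq M) (hz : Adm M z) (hflat : ¬ ∀ i, Flat (z i)) :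
    ∃ q p : ℕ, 1 ≤ q ∧ (∀ i, (fun s => z i (s ^ q)) =O[𝓝 0] fun s : ℝ => s ^ p) ∧
      ∃ i, ¬ (fun s => z i (s ^ q)) =o[𝓝[≠] 0] fun s : ℝ => s ^ p := by
  classical
  have hd : ∀ k, ∃ m : ℕ, ¬ Flat (fun t => es k fun i => z i t) →
      ∃ u, GM M u ∧ u 0 ≠ 0 ∧ ∀ t : ℝ, es k (fun i => z i t) = t ^ m * u t := fun k => by
    rcases GM.flat_or hM (hz k) with h | ⟨m, h⟩
    · exact ⟨0, fun h' => absurd h h'⟩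
    · exact ⟨m, fun _ => h⟩
  choose m hm using hd
  -- Flat symmetric functions have no order and are left out of the minimum. If all of positive
  -- degree were flat, so would be the roots.
  let K := (Finset.Icc 1 (Fintype.card ι)).filter fun k => ¬ Flat (fun t => es k fun i => z i t)
  have hK : K.Nonempty := by
    by_contra hK
    rw [Finset.not_nonempty_iff_eq_empty] at hK
    refine hflat fun i p => isBigO_of_es (fun k hk1 hk2 => ?_) i
    have : k ∉ K := by simp [hK]
    simp only [K, Finset.mem_filter, Finset.mem_Icc, hk1, hk2, true_and, not_not] at this
    exact this _
  obtain ⟨k₀, hk₀, hmin⟩ := Finset.exists_min_image K (fun k => (m k : ℚ) / k) hK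
  simp only [K, Finset.mem_filter, Finset.mem_Icc] at hk₀ hmin
  have hk₀pos : (0 : ℚ) < k₀ := by exact_mod_cast hk₀.1.1
  refine ⟨k₀, m k₀, hk₀.1.1, fun i => ?_, ?_⟩
  · refine isBigO_of_es (z := fun i s => z i (s ^ k₀)) (fun k hk1 hk2 => ?_) i
    by_cases hf : Flat (fun t => es k fun i => z i t)
    · exact hf.comp_pow hk₀.1.1 _
    · obtain ⟨u, hu, -, hmu⟩ := hm k hf
      have h1 := (GM.isBigO_pow hu hmu).comp_tendsto (tendsto_pow_nhds_zero hk₀.1.1)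
      refine h1.trans ?_
      have hle : m k₀ * k ≤ k₀ * m k := by
        have h2 := hmin k ⟨⟨hk1, hk2⟩, hf⟩
        have hkpos : (0 : ℚ) < k := by exact_mod_cast hk1
        rw [div_le_div_iff₀ hk₀pos hkpos] at h2
        have h3 : m k₀ * k ≤ m k * k₀ := by exact_mod_cast h2
        linarith
      refine Asymptotics.IsBigO.of_bound 1 ?_
      filter_upwards [Metric.ball_mem_nhds (0 : ℝ) one_pos] with s hs
      rw [Metric.mem_ball, dist_zero_right] at hs
      simp only [Function.comp_apply, norm_pow, one_mul]
      rw [← pow_mul]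
      exact pow_le_pow_of_le_one (norm_nonneg s) hs.le hle
  · by_contra! hall
    obtain ⟨u, hu, hu0, hmu⟩ := hm k₀ hk₀.2
    obtain ⟨c, hc, hlow⟩ := hu.eventually_lower hu0 hmu
    have h1 : Tendsto (fun s : ℝ => es k₀ fun i => z i (s ^ k₀) / (s : ℂ) ^ m k₀) (𝓝[≠] 0)
        (𝓝 (es k₀ (0 : ι → ℂ))) := by
      refine ((continuous_es k₀).tendsto 0).comp (tendsto_pi_nhds.2 fun i => ?_)
      have h2 := (hall i).norm_norm
      refine squeeze_zero_norm' (a := fun s : ℝ => ‖z i (s ^ k₀)‖ / ‖s ^ m k₀‖)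
        (Eventually.of_forall fun s => by simp) h2.tendsto_div_nhds_zero
    have h0 : es k₀ (0 : ι → ℂ) = 0 := by
      have := es_mul k₀ 0 (0 : ι → ℂ)
      rw [zero_pow (by omega), zero_mul] at this
      rw [← this]
      congr 1
      simp
      rfl
    rw [h0] at h1
    have h3 : ∀ᶠ s in 𝓝[≠] (0 : ℝ), c ≤ ‖es k₀ fun i => z i (s ^ k₀) / (s : ℂ) ^ m k₀‖ := by
      filter_upwards [nhdsWithin_le_nhds ((tendsto_pow_nhds_zero hk₀.1.1).eventually hlow),
        eventually_mem_nhdsWithin] with s hs hs0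
      have hs0' : s ≠ 0 := hs0
      have h4 : (fun i => z i (s ^ k₀) / (s : ℂ) ^ m k₀) =
          fun i => ((s : ℂ) ^ m k₀)⁻¹ * z i (s ^ k₀) := by
        funext i
        rw [div_eq_inv_mul]
      have hp : 0 < |s| := abs_pos.2 hs0'
      rw [h4, es_mul, norm_mul, norm_pow, norm_inv, norm_pow, Complex.norm_real, Real.norm_eq_abs,
        inv_pow, le_inv_mul_iff₀ (by positivity), ← pow_mul, mul_comm]
      rwa [abs_pow, ← pow_mul, mul_comm k₀] at hs
    have := ge_of_tendsto h1.norm h3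
    rw [norm_zero] at this
    linarith

end Rescaling

/-! ### Integrality of the order for real roots. -/

section Expansion

variable {ι : Type} [Fintype ι] {M : ℕ → ℝ} {z : ι → ℝ → ℂ}

/-- Otherwise O(s^p) for all roots always improves to o(s^p), and then to O(s^(p+1)): the sum of
squares is C^M and nonnegative, so its order, which exceeds 2p, is at least 2p + 2. By induction all
roots would be flat. -/
theorem Adm.exists_order_of_real (hM : IsRegularSeq M) (hz : Adm M z)
    (hreal : ∀ᶠ t in 𝓝 (0 : ℝ), ∀ i, (z i t).im = 0) (hflat : ¬ ∀ i, Flat (z i)) :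
    ∃ p : ℕ, (∀ i, z i =O[𝓝 0] fun s : ℝ => s ^ p) ∧
      ∃ i, ¬ z i =o[𝓝[≠] 0] fun s : ℝ => s ^ p := by
  by_contra! H
  refine hflat fun i p => ?_
  suffices ∀ i, z i =O[𝓝 0] fun s : ℝ => s ^ p from this i
  clear i
  induction p with
  | zero =>
    intro i
    obtain ⟨R, hR⟩ := eventually_bounded fun k => hz.continuousAt k
    refine Asymptotics.IsBigO.of_bound R ?_
    filter_upwards [hR] with t ht
    simpa using ht i
  | succ p ih =>
    have ho := H p ih
    have hA := hz.psum hM 2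
    have hsq : ∀ᶠ t in 𝓝 (0 : ℝ), ∑ i, z i t ^ 2 = ((∑ i, ‖z i t‖ ^ 2 : ℝ) : ℂ) := by
      filter_upwards [hreal] with t ht
      rw [Complex.ofReal_sum]
      refine Finset.sum_congr rfl fun i _ => ?_
      have : z i t = ((z i t).re : ℂ) := Complex.ext rfl (by simp [ht i])
      rw [this, Complex.norm_real, Real.norm_eq_abs, sq_abs, Complex.ofReal_pow]
    have hAO : (fun t => ∑ i, z i t ^ 2) =O[𝓝[≠] 0] fun t : ℝ => t ^ (2 * p) := by
      have h1 := Asymptotics.IsBigO.sum (s := Finset.univ) fun i _ => (ih i).pow 2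
      refine (h1.mono nhdsWithin_le_nhds).congr (fun t => ?_) (fun t => ?_)
      · simp
      · rw [← pow_mul, mul_comm]
    obtain ⟨u, hu, hAu⟩ := GM.exists_eq_pow_mul hM hA (le_refl (𝓝[≠] (0 : ℝ))) hAO
    have hu0 : u 0 = 0 := by
      have h1 : Tendsto (fun t : ℝ => ∑ i, (z i t / (t : ℂ) ^ p) ^ 2) (𝓝[≠] 0)
          (𝓝 (∑ _i : ι, (0 : ℂ) ^ 2)) := by
        refine tendsto_finsetSum _ fun i _ => Tendsto.pow ?_ 2
        exact squeeze_zero_norm' (a := fun s : ℝ => ‖z i s‖ / ‖s ^ p‖)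
          (Eventually.of_forall fun s => by simp) (ho i).norm_norm.tendsto_div_nhds_zero
      have h2 : ∑ _i : ι, (0 : ℂ) ^ 2 = 0 := by simp
      rw [h2] at h1
      refine tendsto_nhds_unique (hu.continuousAt.tendsto.mono_left nhdsWithin_le_nhds)
        (h1.congr' ?_)
      filter_upwards [eventually_mem_nhdsWithin] with t ht
      have ht' : (t : ℂ) ^ p ≠ 0 := pow_ne_zero _ (Complex.ofReal_ne_zero.2 ht)
      have h3 := hAu t
      simp only [div_pow]
      rw [← Finset.sum_div, h3, ← pow_mul, mul_comm p 2]
      rw [mul_comm 2 p, pow_mul]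
      field_simp
    obtain ⟨v, hv, huv⟩ := hu.exists_eq_mul hM hu0
    have hrel : ∀ᶠ t in 𝓝 (0 : ℝ), ((∑ i, ‖z i t‖ ^ 2 : ℝ) : ℂ) = ((t ^ (2 * p + 1) : ℝ) : ℂ) * v t := by
      filter_upwards [hsq] with t ht
      rw [← ht, hAu, huv]
      push_cast
      ring
    have hform : ∀ᶠ t in 𝓝[≠] (0 : ℝ), v t = (((∑ i, ‖z i t‖ ^ 2) / t ^ (2 * p + 1) : ℝ) : ℂ) := by
      filter_upwards [nhdsWithin_le_nhds hrel, eventually_mem_nhdsWithin] with t ht h0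
      have : ((t ^ (2 * p + 1) : ℝ) : ℂ) ≠ 0 :=
        Complex.ofReal_ne_zero.2 (pow_ne_zero _ h0)
      rw [Complex.ofReal_div, ht]
      field_simp
    have hcont : Tendsto v (𝓝 0) (𝓝 (v 0)) := hv.continuousAt.tendsto
    have hgt : 𝓝[>] (0 : ℝ) ≤ 𝓝[≠] 0 := nhdsWithin_mono _ fun x hx => ne_of_gt hx
    have hlt : 𝓝[<] (0 : ℝ) ≤ 𝓝[≠] 0 := nhdsWithin_mono _ fun x hx => ne_of_lt hx
    have hnn : ∀ t, 0 ≤ ∑ i, ‖z i t‖ ^ 2 := fun t => Finset.sum_nonneg fun i _ => by positivity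
    -- Here v is a nonnegative quantity over an odd power of t, so its real part changes sign across
    -- 0.
    have hv0 : v 0 = 0 := by
      refine Complex.ext (le_antisymm ?_ ?_) ?_
      · refine le_of_tendsto ((Complex.continuous_re.tendsto _).comp
          (hcont.mono_left (hlt.trans nhdsWithin_le_nhds))) ?_
        filter_upwards [hlt hform, eventually_mem_nhdsWithin] with t ht h0
        rw [Function.comp_apply, ht, Complex.ofReal_re]
        exact div_nonpos_of_nonneg_of_nonpos (hnn t)
          ((Odd.pow_neg ⟨p, rfl⟩ h0).le)
      · refine ge_of_tendsto ((Complex.continuous_re.tendsto _).comp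
          (hcont.mono_left (hgt.trans nhdsWithin_le_nhds))) ?_
        filter_upwards [hgt hform, eventually_mem_nhdsWithin] with t ht h0
        rw [Function.comp_apply, ht, Complex.ofReal_re]
        have : (0 : ℝ) < t := h0
        exact div_nonneg (hnn t) (by positivity)
      · refine tendsto_nhds_unique ((Complex.continuous_im.tendsto _).comp
          (hcont.mono_left (hgt.trans nhdsWithin_le_nhds))) ?_
        refine tendsto_const_nhds.congr' ?_
        filter_upwards [hgt hform] with t ht
        rw [Function.comp_apply, ht, Complex.ofReal_im, Complex.zero_im]
    obtain ⟨v', hv', hvv'⟩ := hv.exists_eq_mul hM hv0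
    have hO2 : (fun t => ∑ i, z i t ^ 2) =O[𝓝 0] fun t : ℝ => t ^ (2 * p + 2) :=
      GM.isBigO_pow hv' fun t => by rw [hAu, huv, hvv']; ring
    obtain ⟨C, hC0, hC⟩ := hO2.exists_nonneg
    intro i
    refine Asymptotics.IsBigO.of_bound (Real.sqrt C) ?_
    filter_upwards [hC.bound, hsq] with t h1 h2
    rw [h2, Complex.norm_real, Real.norm_of_nonneg (hnn t)] at h1
    have h3 : ‖z i t‖ ^ 2 ≤ C * ‖t ^ (2 * p + 2)‖ :=
      (Finset.single_le_sum (f := fun i => ‖z i t‖ ^ 2) (fun i _ => by positivity)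
        (Finset.mem_univ i)).trans h1
    refine le_of_sq_le_sq ?_ (by positivity)
    calc ‖z i t‖ ^ 2 ≤ C * ‖t ^ (2 * p + 2)‖ := h3
      _ = (Real.sqrt C * ‖t ^ (p + 1)‖) ^ 2 := by
        rw [mul_pow, Real.sq_sqrt hC0, ← norm_pow, ← pow_mul]
        ring_nf

end Expansion

/-! ### Expansions of the roots up to flat errors. -/

section

variable {ι : Type} {M : ℕ → ℝ} {z : ι → ℝ → ℂ}

/-- After substitution of a power, the root functions `z i` have expansions `ν i + r i` where the
`ν i` are of class `C^M` and the `r i` are flat; and the `r i` vanish wherever the `r i` that belong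
to the same `ν i` agree. -/
def HasExpansion (M : ℕ → ℝ) (z : ι → ℝ → ℂ) (N : ℕ) : Prop :=
  ∃ ν r : ι → ℝ → ℂ, (∀ i, GM M (ν i)) ∧ (∀ i, Flat (r i)) ∧
    ∀ᶠ s in 𝓝 (0 : ℝ), (∃ σ : Equiv.Perm ι, ∀ i, z i (s ^ N) = ν (σ i) s + r (σ i) s) ∧
      ((∀ i j, ν i = ν j → r i s = r j s) → ∀ i, r i s = 0)

namespace HasExpansion

variable {N : ℕ}

theorem comp_pow (hM : IsRegularSeq M) (h : HasExpansion M z N) {N' : ℕ} (hN' : 1 ≤ N') :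
    HasExpansion M z (N * N') := by
  obtain ⟨ν, r, hν, hr, h⟩ := h
  refine ⟨fun i s => ν i (s ^ N'), fun i s => r i (s ^ N'), fun i => ?_,
    fun i => (hr i).comp_pow hN', ?_⟩
  · simpa using (hν i).comp_mul_pow hM (ε := 1) (by simp) hN'
  · filter_upwards [(tendsto_pow_nhds_zero hN').eventually h] with s hs
    obtain ⟨⟨σ, hσ⟩, h2⟩ := hs
    refine ⟨⟨σ, fun i => by rw [mul_comm, pow_mul]; exact hσ i⟩, fun h3 => h2 fun i j hij => ?_⟩
    exact h3 i j (by rw [hij])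

theorem congr (hN : 1 ≤ N) (h : HasExpansion M z N) {x : ι → ℝ → ℂ}
    (hx : ∀ᶠ t in 𝓝 (0 : ℝ), ∃ σ : Equiv.Perm ι, ∀ i, x i t = z (σ i) t) : HasExpansion M x N := by
  obtain ⟨ν, r, hν, hr, h⟩ := h
  refine ⟨ν, r, hν, hr, ?_⟩
  filter_upwards [h, (tendsto_pow_nhds_zero hN).eventually hx] with s hs hxs
  obtain ⟨⟨σ, hσ⟩, h2⟩ := hs
  obtain ⟨τ, hτ⟩ := hxs
  exact ⟨⟨τ.trans σ, fun i => by rw [hτ, hσ]; rfl⟩, h2⟩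

theorem of_sub (hM : IsRegularSeq M) (hN : 1 ≤ N) {w : ℝ → ℂ} (hw : GM M w)
    (h : HasExpansion M (fun i t => z i t - w t) N) : HasExpansion M z N := by
  obtain ⟨ν, r, hν, hr, h⟩ := h
  have hw' : GM M fun s => w (s ^ N) := by simpa using hw.comp_mul_pow hM (ε := 1) (by simp) hN
  refine ⟨fun i s => ν i s + w (s ^ N), r, fun i => (hν i).add hM hw', hr, ?_⟩
  filter_upwards [h] with s hs
  obtain ⟨⟨σ, hσ⟩, h2⟩ := hs
  refine ⟨⟨σ, fun i => by linear_combination hσ i⟩, fun h3 => h2 fun i j hij => h3 i j ?_⟩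
  simp only [hij]

/-- In the clause on the errors, the factor s^(Np) cancels for s ≠ 0, and at s = 0 flat functions
vanish anyway. -/
theorem of_rescale (hM : IsRegularSeq M) {y : ι → ℝ → ℂ} {q p : ℕ}
    (h : HasExpansion M y N)
    (hy : ∀ s, ∃ σ : Equiv.Perm ι, ∀ i, z i (s ^ q) = s ^ p * y (σ i) s) :
    HasExpansion M z (q * N) := by
  obtain ⟨ν, r, hν, hr, h⟩ := h
  have hp := GM.ofReal_pow hM (N * p)
  refine ⟨fun i s => (s : ℂ) ^ (N * p) * ν i s, fun i s => (s : ℂ) ^ (N * p) * r i s,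
    fun i => hp.mul hM (hν i), fun i => (hr i).mul_left hp.continuousAt, ?_⟩
  filter_upwards [h] with s hs
  obtain ⟨⟨σ, hσ⟩, h2⟩ := hs
  obtain ⟨τ, hτ⟩ := hy (s ^ N)
  refine ⟨⟨τ.trans σ, fun i => ?_⟩, fun h3 i => ?_⟩
  · rw [mul_comm q N, pow_mul, hτ, hσ, Complex.ofReal_pow, ← pow_mul]
    simp only [Equiv.trans_apply]
    ring
  · by_cases hs0 : s = 0
    · rw [hs0, (hr i).apply_zero, mul_zero]
    · have hne : (s : ℂ) ^ (N * p) ≠ 0 := pow_ne_zero _ (Complex.ofReal_ne_zero.2 hs0)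
      rw [h2 (fun i j hij => mul_left_cancel₀ hne (h3 i j (by rw [hij]))) i, mul_zero]

theorem of_subtypes {p : ι → Prop} [DecidablePred p] {x : ι → ℝ → ℂ}
    (h₁ : HasExpansion M (fun i : {i // p i} => x i) N)
    (h₂ : HasExpansion M (fun i : {i // ¬ p i} => x i) N) : HasExpansion M x N := by
  obtain ⟨ν₁, r₁, hν₁, hr₁, h₁⟩ := h₁
  obtain ⟨ν₂, r₂, hν₂, hr₂, h₂⟩ := h₂
  refine ⟨fun i => if h : p i then ν₁ ⟨i, h⟩ else ν₂ ⟨i, h⟩,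
    fun i => if h : p i then r₁ ⟨i, h⟩ else r₂ ⟨i, h⟩, fun i => ?_, fun i => ?_, ?_⟩
  · by_cases h : p i
    · simpa only [dif_pos h] using hν₁ _
    · simpa only [dif_neg h] using hν₂ _
  · by_cases h : p i
    · simpa only [dif_pos h] using hr₁ _
    · simpa only [dif_neg h] using hr₂ _
  · filter_upwards [h₁, h₂] with s hs₁ hs₂
    obtain ⟨⟨σ₁, hσ₁⟩, k₁⟩ := hs₁
    obtain ⟨⟨σ₂, hσ₂⟩, k₂⟩ := hs₂
    refine ⟨⟨σ₁.subtypeCongr σ₂, fun i => ?_⟩, fun h3 i => ?_⟩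
    · by_cases h : p i
      · have e : σ₁.subtypeCongr σ₂ i = σ₁ ⟨i, h⟩ := Equiv.Perm.subtypeCongr.left_apply _ _ h
        rw [e]
        simp only [dif_pos (σ₁ ⟨i, h⟩).2]
        exact hσ₁ ⟨i, h⟩
      · have e : σ₁.subtypeCongr σ₂ i = σ₂ ⟨i, h⟩ := Equiv.Perm.subtypeCongr.right_apply _ _ h
        rw [e]
        simp only [dif_neg (σ₂ ⟨i, h⟩).2]
        exact hσ₂ ⟨i, h⟩
    · by_cases h : p i
      · simp only [dif_pos h]
        refine k₁ (fun i j hij => ?_) _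
        have := h3 i j
        simp only [dif_pos i.2, dif_pos j.2] at this
        exact this hij
      · simp only [dif_neg h]
        refine k₂ (fun i j hij => ?_) _
        have := h3 i j
        simp only [dif_neg i.2, dif_neg j.2] at this
        exact this hij

end HasExpansion

end

/-- Strong induction on the number of roots: centre, find the order, rescale, split. The recursion
ends when the centred roots are all flat; then ν = 0, and since the errors sum to zero they vanish
wherever they all agree, which is the second clause of `HasExpansion`. Real roots stay real and
never require a power. -/
theorem Adm.hasExpansion {ι : Type} [Fintype ι] {M : ℕ → ℝ} {z : ι → ℝ → ℂ} (hM : IsRegularSeq M) (hz : Adm M z) :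
    ∃ N : ℕ, 1 ≤ N ∧ ((∀ᶠ t in 𝓝 (0 : ℝ), ∀ i, (z i t).im = 0) → N = 1) ∧ HasExpansion M z N := by
  classical
  obtain ⟨n, hn⟩ : ∃ n, Fintype.card ι = n := ⟨_, rfl⟩
  induction n using Nat.strong_induction_on generalizing ι with
  | _ n ih =>
  rcases isEmpty_or_nonempty ι with hι | ⟨⟨i₀⟩⟩
  · exact ⟨1, le_rfl, fun _ => rfl, fun i => hι.elim i, fun i => hι.elim i, fun i => hι.elim i,
      fun i => hι.elim i, Eventually.of_forall fun s => ⟨⟨1, fun i => hι.elim i⟩,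
        fun _ i => hι.elim i⟩⟩
  have hn0 : (n : ℂ) ≠ 0 := by
    have := Fintype.card_pos_iff.2 ⟨i₀⟩
    exact_mod_cast (hn ▸ this).ne'
  let w : ℝ → ℂ := fun t => (n : ℂ)⁻¹ * ∑ j, z j t
  have hw : GM M w := by
    have := (GM.const hM (n : ℂ)⁻¹).mul hM (hz.psum hM 1)
    simp only [pow_one] at this
    exact this
  let x : ι → ℝ → ℂ := fun i t => z i t - w t
  have hx : Adm M x := hz.center hM _
  have hxsum : ∀ t, ∑ i, x i t = 0 := fun t => by
    simp only [x, w, Finset.sum_sub_distrib, Finset.sum_const, Finset.card_univ, hn, nsmul_eq_mul]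
    rw [mul_inv_cancel_left₀ hn0, sub_self]
  have hxreal : (∀ᶠ t in 𝓝 (0 : ℝ), ∀ i, (z i t).im = 0) →
      ∀ᶠ t in 𝓝 (0 : ℝ), ∀ i, (x i t).im = 0 := fun hr => by
    filter_upwards [hr] with t ht i
    have h1 : (∑ j, z j t).im = 0 := by
      rw [Complex.im_sum]
      exact Finset.sum_eq_zero fun j _ => ht j
    have h2 : ((n : ℂ)⁻¹).im = 0 := by
      rw [← Complex.ofReal_natCast, ← Complex.ofReal_inv, Complex.ofReal_im]
    simp only [x, w, Complex.sub_im, Complex.mul_im, h1, h2, ht i]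
    ring
  suffices ∃ N : ℕ, 1 ≤ N ∧ ((∀ᶠ t in 𝓝 (0 : ℝ), ∀ i, (x i t).im = 0) → N = 1) ∧
      HasExpansion M x N by
    obtain ⟨N, hN, h1, h2⟩ := this
    exact ⟨N, hN, fun hr => h1 (hxreal hr), h2.of_sub hM hN hw⟩
  by_cases hflat : ∀ i, Flat (x i)
  · refine ⟨1, le_rfl, fun _ => rfl, fun _ _ => 0, x, fun _ => GM.const hM 0, hflat,
      Eventually.of_forall fun s => ⟨⟨1, fun i => by simp⟩, fun h i => ?_⟩⟩
    have h1 := hxsum s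
    rw [Finset.sum_congr rfl fun j _ => h j i rfl, Finset.sum_const, Finset.card_univ, hn,
      nsmul_eq_mul] at h1
    exact (mul_eq_zero.1 h1).resolve_left hn0
  have horder : ∃ q p : ℕ, 1 ≤ q ∧ ((∀ᶠ t in 𝓝 (0 : ℝ), ∀ i, (x i t).im = 0) → q = 1) ∧
      (∀ i, (fun s => x i (s ^ q)) =O[𝓝 0] fun s : ℝ => s ^ p) ∧
      ∃ i, ¬ (fun s => x i (s ^ q)) =o[𝓝[≠] 0] fun s : ℝ => s ^ p := by
    by_cases hr : ∀ᶠ t in 𝓝 (0 : ℝ), ∀ i, (x i t).im = 0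
    · obtain ⟨p, h1, h2⟩ := hx.exists_order_of_real hM hr hflat
      exact ⟨1, p, le_rfl, fun _ => rfl, by simpa using h1, by simpa using h2⟩
    · obtain ⟨q, p, hq, h1, h2⟩ := hx.exists_order hM hflat
      exact ⟨q, p, hq, fun h => absurd h hr, h1, h2⟩
  obtain ⟨q, p, hq, hq1, hO, ho⟩ := horder
  obtain ⟨y, hy, ⟨i₁, i₂, hne⟩, hxy, hyreal⟩ :=
    (hx.comp_pow hM hq).exists_rescale hM (fun t => hxsum _) hO ho
  obtain ⟨P, hP, v, hP1, hP2, hperm, hA1, hA2⟩ := hy.exists_split hM hne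
  obtain ⟨N₁, hN₁, hr₁, hE₁⟩ := ih _ (by
    rw [← hn]
    exact Fintype.card_subtype_lt hP2) hA1 rfl
  obtain ⟨N₂, hN₂, hr₂, hE₂⟩ := ih _ (by
    rw [← hn]
    exact Fintype.card_subtype_lt (x := i₁) (by simpa using hP1)) hA2 rfl
  -- The two clusters may need different powers; the product serves both.
  have hEv : HasExpansion M v (N₁ * N₂) :=
    HasExpansion.of_subtypes (hE₁.comp_pow hM hN₂) (mul_comm N₂ N₁ ▸ hE₂.comp_pow hM hN₁)
  have hN : 1 ≤ N₁ * N₂ := Nat.one_le_iff_ne_zero.2 (by positivity)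
  have hyv : ∀ᶠ t in 𝓝 (0 : ℝ), ∃ σ : Equiv.Perm ι, ∀ i, y i t = v (σ i) t := by
    filter_upwards [hperm] with t ht
    obtain ⟨σ, hσ⟩ := ht
    exact ⟨σ.symm, fun i => by rw [hσ, Equiv.apply_symm_apply]⟩
  refine ⟨q * (N₁ * N₂), Nat.one_le_iff_ne_zero.2 (by positivity), fun hr => ?_,
    (hEv.congr hN hyv).of_rescale hM hxy⟩
  have hq' := hq1 hr
  subst hq'
  have hvreal : ∀ᶠ t in 𝓝 (0 : ℝ), ∀ i, (v i t).im = 0 := by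
    filter_upwards [hyreal (by simpa using hr), hperm] with t ht hp i
    obtain ⟨σ, hσ⟩ := hp
    rw [hσ, ht]
  rw [hr₁ (hvreal.mono fun t ht i => ht i), hr₂ (hvreal.mono fun t ht i => ht i)]

/-! ### Separation of distinct roots and rigidity of enumerations. -/

theorem Flat.eventually_lt {f : ℝ → ℂ} (hf : Flat f) (m : ℕ) :
    ∀ᶠ s in 𝓝[≠] (0 : ℝ), ‖f s‖ < |s| ^ m := by
  obtain ⟨C, hC0, hC⟩ := (hf (m + 1)).exists_nonneg
  have h1 : ∀ᶠ s : ℝ in 𝓝 0, C * |s| < 1 := by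
    have : Tendsto (fun s : ℝ => C * |s|) (𝓝 0) (𝓝 (C * |(0 : ℝ)|)) :=
      Continuous.tendsto (by fun_prop) 0
    rw [abs_zero, mul_zero] at this
    exact this.eventually (gt_mem_nhds one_pos)
  filter_upwards [nhdsWithin_le_nhds hC.bound, nhdsWithin_le_nhds h1, eventually_mem_nhdsWithin]
    with s hs h1 hs0
  have hp : 0 < |s| ^ m := pow_pos (abs_pos.2 hs0) m
  rw [norm_pow, Real.norm_eq_abs, pow_succ] at hs
  nlinarith

theorem GM.flat_or_lower {M : ℕ → ℝ} (hM : IsRegularSeq M) {f ρ : ℝ → ℂ} (hf : GM M f)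
    (hρ : Flat ρ) :
    Flat (fun s => f s + ρ s) ∨ ∃ m : ℕ, ∀ᶠ t in 𝓝[≠] (0 : ℝ), |t| ^ m ≤ ‖f t + ρ t‖ := by
  rcases hf.flat_or hM with h | ⟨m, u, hu, hu0, hfu⟩
  · exact Or.inl (h.add hρ)
  · right
    obtain ⟨c, hc, hlow⟩ := hu.eventually_lower hu0 hfu
    -- The extra factor |s| absorbs the constant c and the flat perturbation.
    refine ⟨m + 1, ?_⟩
    have h1 : ∀ᶠ s : ℝ in 𝓝 0, |s| < c / 2 := by
      have : Tendsto (fun s : ℝ => |s|) (𝓝 0) (𝓝 |(0 : ℝ)|) := continuous_abs.tendsto 0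
      rw [abs_zero] at this
      exact this.eventually (gt_mem_nhds (by positivity))
    filter_upwards [nhdsWithin_le_nhds hlow, nhdsWithin_le_nhds h1, hρ.eventually_lt (m + 1),
      eventually_mem_nhdsWithin] with s h2 h3 h4 hs0
    have hp : 0 < |s| ^ m := pow_pos (abs_pos.2 hs0) m
    have h5 := norm_sub_norm_le (f s) (-ρ s)
    rw [norm_neg, sub_neg_eq_add] at h5
    rw [pow_succ] at h4 ⊢
    nlinarith

/-- Near `t₀`, the distance of different values `z i t`, `z j t` is bounded below by a power of the
distance of `t` to `t₀`. -/
def SepAt {ι : Type} (z : ι → ℝ → ℂ) (t₀ : ℝ) : Prop :=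
  ∃ m : ℕ, ∀ᶠ t in 𝓝[≠] t₀, ∀ i j, z i t ≠ z j t → |t - t₀| ^ m ≤ ‖z i t - z j t‖

section Separation

variable {ι : Type} {M : ℕ → ℝ} {z : ι → ℝ → ℂ}

theorem SepAt.comp {t₀ s₀ : ℝ} (h : SepAt z t₀) {κ : ℝ → ℝ} (hκ : Tendsto κ (𝓝[≠] s₀) (𝓝[≠] t₀))
    {k : ℕ} (hk : ∀ᶠ s in 𝓝[≠] s₀, |s - s₀| ^ k ≤ |κ s - t₀|) : SepAt (fun i s => z i (κ s)) s₀ := by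
  obtain ⟨m, hm⟩ := h
  refine ⟨k * m, ?_⟩
  filter_upwards [hκ.eventually hm, hk] with s hs hks i j hij
  refine le_trans ?_ (hs i j hij)
  rw [pow_mul]
  gcongr

theorem SepAt.congr {t₀ : ℝ} (h : SepAt z t₀) {x : ι → ℝ → ℂ}
    (hx : ∀ᶠ t in 𝓝[≠] t₀, ∃ σ : Equiv.Perm ι, ∀ i, x i t = z (σ i) t) : SepAt x t₀ := by
  obtain ⟨m, hm⟩ := h
  refine ⟨m, ?_⟩
  filter_upwards [hm, hx] with t ht hxt i j hij
  obtain ⟨σ, hσ⟩ := hxt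
  rw [hσ, hσ] at hij ⊢
  exact ht _ _ hij

theorem tendsto_pow_punctured {N : ℕ} (hN : 1 ≤ N) :
    Tendsto (fun s : ℝ => s ^ N) (𝓝[≠] 0) (𝓝[≠] 0) :=
  tendsto_nhdsWithin_iff.2 ⟨(tendsto_pow_nhds_zero hN).mono_left nhdsWithin_le_nhds,
    eventually_mem_nhdsWithin.mono fun _ hs => pow_ne_zero N hs⟩

theorem SepAt.comp_add_mul_pow {t₀ ε : ℝ} (h : SepAt z t₀) (hε : ε = 1 ∨ ε = -1) {N : ℕ}
    (hN : 1 ≤ N) : SepAt (fun i s => z i (t₀ + ε * s ^ N)) 0 := by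
  have hε1 : |ε| = 1 := by rcases hε with rfl | rfl <;> simp
  have hε0 : ε ≠ 0 := by rintro rfl; simp at hε1
  refine h.comp (κ := fun s => t₀ + ε * s ^ N) (k := N) ?_ ?_
  · refine tendsto_nhdsWithin_iff.2 ⟨?_, ?_⟩
    · have : Tendsto (fun s : ℝ => t₀ + ε * s ^ N) (𝓝 0) (𝓝 (t₀ + ε * 0)) :=
        ((tendsto_pow_nhds_zero hN).const_mul ε).const_add t₀
      rw [mul_zero, add_zero] at this
      exact this.mono_left nhdsWithin_le_nhds
    · filter_upwards [eventually_mem_nhdsWithin] with s hs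
      have : ε * s ^ N ≠ 0 := mul_ne_zero hε0 (pow_ne_zero N hs)
      simpa using this
  · refine Eventually.of_forall fun s => ?_
    rw [sub_zero, add_sub_cancel_left, abs_mul, hε1, one_mul, abs_pow]

/-- Two roots with the same ν differ by a flat amount, which separation forces to be zero. So errors
belonging to equal ν agree, and the second clause of `HasExpansion` makes all errors vanish. -/
theorem HasExpansion.exact {N : ℕ} (hN : 1 ≤ N) (h : HasExpansion M z N) (hsep : SepAt z 0)
    [Fintype ι] : ∃ ν : ι → ℝ → ℂ, (∀ i, GM M (ν i)) ∧
      ∀ᶠ s in 𝓝 (0 : ℝ), ∃ σ : Equiv.Perm ι, ∀ i, z i (s ^ N) = ν (σ i) s := by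
  obtain ⟨ν, r, hν, hr, h⟩ := h
  refine ⟨ν, hν, ?_⟩
  obtain ⟨m, hm⟩ := hsep
  have h1 : ∀ i j, ∀ᶠ s in 𝓝[≠] (0 : ℝ), ‖r i s - r j s‖ < |s| ^ (N * m) := fun i j =>
    ((hr i).sub (hr j)).eventually_lt _
  have h2 : ∀ᶠ s in 𝓝[≠] (0 : ℝ), ∀ i, r i s = 0 := by
    filter_upwards [nhdsWithin_le_nhds h, (tendsto_pow_punctured hN).eventually hm,
      eventually_all.2 fun i => eventually_all.2 (h1 i)] with s hs hms hlt
    obtain ⟨⟨σ, hσ⟩, k⟩ := hs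
    refine k fun i j hij => ?_
    by_contra hne
    have h3 := hms (σ.symm i) (σ.symm j)
    simp only [hσ, Equiv.apply_symm_apply, hij, sub_zero, add_sub_add_left_eq_sub] at h3
    have h4 := h3 fun h => hne (add_left_cancel h)
    rw [abs_pow, ← pow_mul] at h4
    exact absurd (hlt i j) (not_lt.2 h4)
  have h3 : ∀ᶠ s in 𝓝 (0 : ℝ), ∀ i, r i s = 0 := by
    rw [eventually_nhdsWithin_iff] at h2
    filter_upwards [h2] with s hs i
    by_cases h0 : s = 0
    · rw [h0, (hr i).apply_zero]
    · exact hs h0 i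
  filter_upwards [h, h3] with s hs h3
  obtain ⟨⟨σ, hσ⟩, -⟩ := hs
  exact ⟨σ, fun i => by rw [hσ, h3, add_zero]⟩

/-- A fixed permutation that matches the families at points accumulating at t₀ matches them near t₀
(`hloc`). As there are finitely many permutations, some one works near each point; the set where a
given one works locally is open and relatively closed, and connectedness finishes. -/
theorem exists_perm_of_sepAt [Fintype ι] (hM : IsRegularSeq M) {U : Set ℝ} (hU : IsOpen U)
    (hUc : IsPreconnected U) {lam mu : ι → ℝ → ℂ}
    (hl : ∀ i, ∀ t ∈ U, GM M fun s => lam i (t + s)) (hm : ∀ i, ∀ t ∈ U, GM M fun s => mu i (t + s))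
    (hperm : ∀ t ∈ U, ∃ σ : Equiv.Perm ι, ∀ i, mu i t = lam (σ i) t)
    (hsep : ∀ t ∈ U, SepAt lam t) : ∃ σ : Equiv.Perm ι, ∀ t ∈ U, ∀ i, mu i t = lam (σ i) t := by
  classical
  have hloc : ∀ t₀ ∈ U, ∀ σ : Equiv.Perm ι, (∃ᶠ t in 𝓝[≠] t₀, ∀ i, mu i t = lam (σ i) t) →
      ∀ᶠ t in 𝓝 t₀, ∀ i, mu i t = lam (σ i) t := by
    intro t₀ ht₀ σ hfreq
    have htend : Tendsto (fun s : ℝ => s - t₀) (𝓝[≠] t₀) (𝓝[≠] 0) := by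
      refine tendsto_nhdsWithin_iff.2 ⟨?_, ?_⟩
      · have : Tendsto (fun s : ℝ => s - t₀) (𝓝 t₀) (𝓝 (t₀ - t₀)) :=
          Continuous.tendsto (by fun_prop) t₀
        rw [sub_self] at this
        exact this.mono_left nhdsWithin_le_nhds
      · filter_upwards [eventually_mem_nhdsWithin] with s hs
        exact sub_ne_zero.2 hs
    -- A difference that vanishes at points accumulating at t₀ has no power lower bound, hence is
    -- flat. Both terms are values of the separated tuple `lam`, so they must then coincide.
    have hflat : ∀ i, Flat fun s => mu i (t₀ + s) - lam (σ i) (t₀ + s) := fun i => by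
      have hG : GM M fun s => mu i (t₀ + s) - lam (σ i) (t₀ + s) := (hm i t₀ ht₀).sub hM (hl _ t₀ ht₀)
      rcases hG.flat_or_lower hM Flat.zero with h | ⟨m, h⟩
      · simpa using h
      · exfalso
        refine hfreq ?_
        filter_upwards [htend.eventually h, eventually_mem_nhdsWithin] with t ht hne hall
        rw [add_sub_cancel, hall i, sub_self, add_zero, norm_zero] at ht
        have : 0 < |t - t₀| ^ m := pow_pos (abs_pos.2 (sub_ne_zero.2 hne)) m
        linarith
    obtain ⟨m, hmsep⟩ := hsep t₀ ht₀
    have h1 : ∀ᶠ t in 𝓝[≠] t₀, ∀ i, mu i t = lam (σ i) t := by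
      filter_upwards [htend.eventually (eventually_all.2 fun i => (hflat i).eventually_lt m), hmsep,
        nhdsWithin_le_nhds (hU.mem_nhds ht₀)] with t h2 h3 ht i
      obtain ⟨τ, hτ⟩ := hperm t ht
      have h4 := h2 i
      rw [add_sub_cancel, hτ] at h4
      rw [hτ]
      by_contra hne
      exact absurd (h3 _ _ hne) (not_le.2 h4)
    rw [eventually_nhdsWithin_iff] at h1
    filter_upwards [h1] with t ht i
    by_cases h0 : t = t₀
    · have := (hflat i).apply_zero
      rw [add_zero, sub_eq_zero] at this
      rw [h0, this]
    · exact ht h0 i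
  rcases U.eq_empty_or_nonempty with rfl | ⟨t₁, ht₁⟩
  · exact ⟨1, by simp⟩
  have hex : ∀ t₀ ∈ U, ∃ σ : Equiv.Perm ι, ∀ᶠ t in 𝓝 t₀, ∀ i, mu i t = lam (σ i) t := by
    intro t₀ ht₀
    have h1 : ∀ᶠ t in 𝓝[≠] t₀, ∃ σ : Equiv.Perm ι, ∀ i, mu i t = lam (σ i) t := by
      filter_upwards [nhdsWithin_le_nhds (hU.mem_nhds ht₀)] with t ht using hperm t ht
    by_contra! hno
    have h2 : ∀ σ : Equiv.Perm ι, ∀ᶠ t in 𝓝[≠] t₀, ¬ ∀ i, mu i t = lam (σ i) t := fun σ =>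
      not_frequently.1 fun h => (hno σ).and_eventually (hloc t₀ ht₀ σ h) |>.exists.elim
        fun t ht => by
          obtain ⟨⟨i, hi⟩, h3⟩ := ht
          exact hi (h3 i)
    obtain ⟨t, ⟨σ, hσ⟩, h3⟩ := (h1.and (eventually_all.2 h2)).exists
    exact h3 σ hσ
  obtain ⟨σ, hσ⟩ := hex t₁ ht₁
  refine ⟨σ, ?_⟩
  let A : Set ℝ := {t | ∀ᶠ s in 𝓝 t, ∀ i, mu i s = lam (σ i) s}
  have hA : IsOpen A := isOpen_setOfPred_eventually_nhds
  have hsub : U ⊆ A := by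
    refine hUc.subset_of_closure_inter_subset hA ⟨t₁, ht₁, hσ⟩ ?_
    rintro t ⟨htc, htU⟩
    refine hloc t htU σ ?_
    rw [Filter.frequently_iff]
    intro V hV
    obtain ⟨W, hW, hWV⟩ := mem_nhdsWithin_iff_exists_mem_nhds_inter.1 hV
    obtain ⟨O, hOW, hO, htO⟩ := mem_nhds_iff.1 hW
    obtain ⟨a, haO, haA⟩ := mem_closure_iff.1 htc O hO htO
    have h5 : ∀ᶠ s in 𝓝[≠] a, s ∈ O ∧ s ≠ t ∧ ∀ i, mu i s = lam (σ i) s := by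
      have h6 : ∀ᶠ s in 𝓝[≠] a, s ≠ t := by
        by_cases hat : a = t
        · subst hat; exact eventually_mem_nhdsWithin
        · exact nhdsWithin_le_nhds (isOpen_ne.mem_nhds hat)
      filter_upwards [nhdsWithin_le_nhds (hO.mem_nhds haO), h6, nhdsWithin_le_nhds haA] with s a b c
        using ⟨a, b, c⟩
    obtain ⟨s, hsO, hst, hs⟩ := h5.exists
    exact ⟨s, hWV ⟨hOW hsO, hst⟩, hs⟩
  exact fun t ht => (hsub ht).self_of_nhds

end Separation

/-! ### One-sided separation and the quasianalytic case. -/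

section OneSided

variable {ι : Type} [Fintype ι] {M : ℕ → ℝ} {z : ι → ℝ → ℂ}

theorem eventually_right_of_pow {P : ℝ → Prop} {N : ℕ} (hN : 1 ≤ N)
    (h : ∀ᶠ s in 𝓝[>] (0 : ℝ), P (s ^ N)) : ∀ᶠ t in 𝓝[>] (0 : ℝ), P t := by
  have h1 : Tendsto (fun t : ℝ => t ^ ((N : ℝ)⁻¹)) (𝓝[>] 0) (𝓝[>] 0) := by
    refine tendsto_nhdsWithin_iff.2 ⟨?_, ?_⟩
    · have : Tendsto (fun t : ℝ => t ^ ((N : ℝ)⁻¹)) (𝓝 0) (𝓝 ((0 : ℝ) ^ ((N : ℝ)⁻¹))) :=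
        (Real.continuousAt_rpow_const 0 _ (Or.inr (by positivity))).tendsto
      rw [Real.zero_rpow (by positivity)] at this
      exact this.mono_left nhdsWithin_le_nhds
    · filter_upwards [eventually_mem_nhdsWithin] with t ht
      exact Real.rpow_pos_of_pos ht _
  filter_upwards [h1.eventually h, eventually_mem_nhdsWithin] with t ht h0
  rwa [Real.rpow_inv_natCast_pow (le_of_lt h0) (by omega)] at ht

theorem sepAt_zero_of_right {ι : Type} {z : ι → ℝ → ℂ}
    (h₁ : ∃ m : ℕ, ∀ᶠ t in 𝓝[>] (0 : ℝ), ∀ i j, z i t ≠ z j t → t ^ m ≤ ‖z i t - z j t‖)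
    (h₂ : ∃ m : ℕ, ∀ᶠ t in 𝓝[>] (0 : ℝ), ∀ i j, z i (-t) ≠ z j (-t) →
      t ^ m ≤ ‖z i (-t) - z j (-t)‖) : SepAt z 0 := by
  obtain ⟨m₁, h₁⟩ := h₁
  obtain ⟨m₂, h₂⟩ := h₂
  refine ⟨m₁ + m₂, ?_⟩
  have h1 : ∀ᶠ t : ℝ in 𝓝 0, |t| < 1 := by
    have : Tendsto (fun s : ℝ => |s|) (𝓝 0) (𝓝 |(0 : ℝ)|) := continuous_abs.tendsto 0
    rw [abs_zero] at this
    exact this.eventually (gt_mem_nhds one_pos)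
  have hneg : Tendsto (fun t : ℝ => -t) (𝓝[<] 0) (𝓝[>] 0) := by
    refine tendsto_nhdsWithin_iff.2 ⟨?_, ?_⟩
    · have : Tendsto (fun t : ℝ => -t) (𝓝 0) (𝓝 (-0)) := continuous_neg.tendsto 0
      rw [neg_zero] at this
      exact this.mono_left nhdsWithin_le_nhds
    · filter_upwards [eventually_mem_nhdsWithin] with t ht
      exact neg_pos.2 (show t < 0 from ht)
  rw [← Iio_union_Ioi, nhdsWithin_union, eventually_sup]
  constructor
  · filter_upwards [hneg.eventually h₂, nhdsWithin_le_nhds h1, eventually_mem_nhdsWithin]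
      with t ht h1 h0 i j hij
    have h0' : t < 0 := h0
    simp only [neg_neg] at ht
    refine le_trans ?_ (ht i j hij)
    rw [sub_zero, abs_of_neg h0'] at *
    exact pow_le_pow_of_le_one (by linarith) h1.le (by omega)
  · filter_upwards [h₁, nhdsWithin_le_nhds h1, eventually_mem_nhdsWithin] with t ht h1 h0 i j hij
    have h0' : 0 < t := h0
    refine le_trans ?_ (ht i j hij)
    rw [sub_zero, abs_of_pos h0'] at *
    exact pow_le_pow_of_le_one (by linarith) h1.le (by omega)

theorem right_sep_of_pairs {N : ℕ} (hN : 1 ≤ N) {w : ι → ℝ → ℂ}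
    (h : ∀ᶠ s in 𝓝[>] (0 : ℝ), ∃ σ : Equiv.Perm ι, ∀ i, z i (s ^ N) = w (σ i) s)
    (hw : ∀ i j, ∃ m : ℕ, ∀ᶠ s in 𝓝[>] (0 : ℝ), w i s ≠ w j s → s ^ m ≤ ‖w i s - w j s‖) :
    ∃ m : ℕ, ∀ᶠ t in 𝓝[>] (0 : ℝ), ∀ i j, z i t ≠ z j t → t ^ m ≤ ‖z i t - z j t‖ := by
  choose m hm using hw
  refine ⟨∑ i, ∑ j, m i j, eventually_right_of_pow hN ?_⟩
  have h1 : ∀ᶠ s in 𝓝[>] (0 : ℝ), s < 1 := nhdsWithin_le_nhds (gt_mem_nhds one_pos)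
  filter_upwards [h, eventually_all.2 fun i => eventually_all.2 (hm i), h1,
    eventually_mem_nhdsWithin] with s hs hms hs1 hs0 i j hij
  obtain ⟨σ, hσ⟩ := hs
  have hs0' : 0 < s := hs0
  rw [hσ, hσ] at hij ⊢
  refine le_trans ?_ (hms _ _ hij)
  rw [← pow_mul]
  refine pow_le_pow_of_le_one hs0'.le hs1.le ?_
  calc m (σ i) (σ j) ≤ ∑ j, m (σ i) j :=
        Finset.single_le_sum (f := fun j => m (σ i) j) (fun _ _ => Nat.zero_le _) (Finset.mem_univ _)
    _ ≤ ∑ i, ∑ j, m i j := Finset.single_le_sum (f := fun i => ∑ j, m i j)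
        (fun _ _ => Nat.zero_le _) (Finset.mem_univ _)
    _ ≤ N * _ := Nat.le_mul_of_pos_left _ (by omega)

theorem Adm.neg (hM : IsRegularSeq M) (hz : Adm M z) : Adm M fun i s => z i (-s) := by
  simpa using hz.comp_mul_pow hM (ε := -1) (by simp) le_rfl

/-- The symmetric functions of z(s^N) and of the C^M parts ν differ by flat C^M germs, hence agree:
the ν are exact roots even before separation is known. Their differences vanish near 0 or have
finite order. Only positive values of s are used, so the left side is treated by reflection. -/
theorem Adm.sepAt_of_quasianalytic (hM : IsRegularSeq M) (hq : IsQuasianalytic M) (hz : Adm M z) :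
    SepAt z 0 := by
  have hright : ∀ x : ι → ℝ → ℂ, Adm M x → ∃ m : ℕ, ∀ᶠ t in 𝓝[>] (0 : ℝ),
      ∀ i j, x i t ≠ x j t → t ^ m ≤ ‖x i t - x j t‖ := by
    intro x hx
    obtain ⟨N, hN, -, ν, r, hν, hr, h⟩ := hx.hasExpansion hM
    have hνA : ∀ k, GM M fun s => es k fun i => ν i s := fun k => by
      have : (fun s => es k fun i => ν i s) =
          ∑ t ∈ Finset.powersetCard k (Finset.univ : Finset ι), ∏ i ∈ t, ν i := by
        funext s
        simp [es_eq_sum, Finset.sum_apply, Finset.prod_apply]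
      rw [this]
      exact (GM.subalgebra hM).sum_mem fun t _ => (GM.subalgebra hM).prod_mem fun i _ => hν i
    have hflat : ∀ k, Flat fun s => es k (fun i => ν i s + r i s) - es k fun i => ν i s := by
      intro k
      have hprod : ∀ t : Finset ι,
          Flat fun s => (∏ i ∈ t, (ν i s + r i s)) - ∏ i ∈ t, ν i s := by
        classical
        intro t
        induction t using Finset.induction_on with
        | empty => simpa using Flat.zero
        | insert a t ha ih =>
          have hc : ContinuousAt (fun s => ∏ i ∈ t, (ν i s + r i s)) 0 :=
            tendsto_finsetProd _ fun i _ => (hν i).continuousAt.tendsto.add (by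
              have : Tendsto (r i) (𝓝 0) (𝓝 0) :=
                (hr i 1).trans_tendsto (by simpa using tendsto_pow_nhds_zero le_rfl)
              simpa [(hr i).apply_zero] using this)
          refine ((ih.mul_left (hν a).continuousAt).add ((hr a).mul_left hc)).congr
            (Eventually.of_forall fun s => ?_)
          simp only [Finset.prod_insert ha]
          ring
      simp only [es_eq_sum, ← Finset.sum_sub_distrib]
      exact Flat.sum fun t _ => hprod t
    have hzero : ∀ k, ∀ᶠ s in 𝓝 (0 : ℝ), es k (fun i => x i (s ^ N)) = es k fun i => ν i s := by
      intro k
      have hG := ((hx.comp_pow hM hN) k).sub hM (hνA k)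
      have hF : Flat ((fun s => es k fun i => x i (s ^ N)) - fun s => es k fun i => ν i s) := by
        refine (hflat k).congr ?_
        filter_upwards [h] with s hs
        obtain ⟨⟨σ, hσ⟩, -⟩ := hs
        rw [Pi.sub_apply]
        simp only [hσ]
        rw [es_perm k (fun i => ν i s + r i s) σ]
      filter_upwards [hG.eventually_eq_zero_of_flat hM hq hF] with s hs
      exact sub_eq_zero.1 hs
    have hperm : ∀ᶠ s in 𝓝 (0 : ℝ), ∃ σ : Equiv.Perm ι, ∀ i, x i (s ^ N) = ν (σ i) s := by
      have h1 : ∀ᶠ s in 𝓝 (0 : ℝ), ∀ k ∈ Finset.range (Fintype.card ι + 1),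
          es k (fun i => x i (s ^ N)) = es k fun i => ν i s :=
        (Finset.eventually_all _).2 fun k _ => hzero k
      filter_upwards [h1] with s hs
      refine exists_perm_of_es_eq (x := fun i => x i (s ^ N)) (y := fun i => ν i s) fun k => ?_
      by_cases hk : k ∈ Finset.range (Fintype.card ι + 1)
      · exact hs k hk
      · rw [Finset.mem_range] at hk
        rw [es_eq_sum, es_eq_sum, Finset.powersetCard_eq_empty.2 (by rw [Finset.card_univ]; omega),
          Finset.sum_empty, Finset.sum_empty]
    have hgt : 𝓝[>] (0 : ℝ) ≤ 𝓝[≠] 0 := nhdsWithin_mono _ fun x hx => ne_of_gt hx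
    refine right_sep_of_pairs hN (nhdsWithin_le_nhds hperm) fun i j => ?_
    have hG : GM M fun s => ν i s - ν j s := (hν i).sub hM (hν j)
    rcases hG.flat_or_lower hM Flat.zero with hf | ⟨m, hm⟩
    · refine ⟨0, ?_⟩
      filter_upwards [nhdsWithin_le_nhds (hG.eventually_eq_zero_of_flat hM hq (by simpa using hf))]
        with s hs hne
      exact absurd (sub_eq_zero.1 hs) hne
    · refine ⟨m, ?_⟩
      filter_upwards [hgt hm, eventually_mem_nhdsWithin] with s hs hs0 _
      simpa [abs_of_pos (show (0 : ℝ) < s from hs0)] using hs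
  exact sepAt_zero_of_right (hright z hz) (hright _ (hz.neg hM))

end OneSided

/-! ### Gluing local solutions over an interval. -/

section Gluing

variable {Y : Type*} {Sol : (ℝ → Y) → Set ℝ → Prop} {I : Set ℝ}

theorem exists_sol_uIcc (hI : IsPreconnected I)
    (mono : ∀ f S T, S ⊆ T → Sol f T → Sol f S)
    (glue : ∀ f g a b c, a ≤ b → b ≤ c → Icc a c ⊆ I → Sol f (Icc a b) → Sol g (Icc b c) →
      ∃ h, Sol h (Icc a c))
    (loc : ∀ t ∈ I, ∃ f, ∃ ε > 0, Sol f (Icc (t - ε) (t + ε))) {a b : ℝ} (ha : a ∈ I) (hb : b ∈ I) :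
    ∃ f, Sol f (uIcc a b) := by
  have hord : OrdConnected I := isPreconnected_iff_ordConnected.1 hI
  refine hI.induction₂ (fun x y => ∃ f, Sol f (uIcc x y)) ?_ ?_ ?_ ha hb
  · intro x hx
    obtain ⟨f, ε, hε, hf⟩ := loc x hx
    refine nhdsWithin_le_nhds ?_
    filter_upwards [Icc_mem_nhds (show x - ε < x by linarith) (show x < x + ε by linarith)] with y hy
    exact ⟨f, mono _ _ _ (uIcc_subset_Icc ⟨by linarith, by linarith⟩ hy) hf⟩
  · rintro x y z hx hy hz ⟨f, hf⟩ ⟨g, hg⟩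
    rcases le_total x y with hxy | hxy <;> rcases le_total y z with hyz | hyz
    · rw [uIcc_of_le hxy] at hf
      rw [uIcc_of_le hyz] at hg
      rw [uIcc_of_le (hxy.trans hyz)]
      exact glue f g x y z hxy hyz (hord.out hx hz) hf hg
    · rcases le_total x z with hxz | hxz
      · exact ⟨f, mono _ _ _ (uIcc_subset_uIcc_left (mem_uIcc_of_le hxz hyz)) hf⟩
      · exact ⟨g, mono _ _ _ (uIcc_subset_uIcc_right (mem_uIcc_of_ge hxz hxy)) hg⟩
    · rcases le_total x z with hxz | hxz
      · exact ⟨g, mono _ _ _ (uIcc_subset_uIcc_right (mem_uIcc_of_le hxy hxz)) hg⟩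
      · exact ⟨f, mono _ _ _ (uIcc_subset_uIcc_left (mem_uIcc_of_ge hyz hxz)) hf⟩
    · rw [uIcc_of_ge hxy] at hf
      rw [uIcc_of_ge hyz] at hg
      rw [uIcc_of_ge (hyz.trans hxy)]
      exact glue g f z y x hyz hxy (hord.out hz hx) hg hf
  · rintro x y hx hy ⟨f, hf⟩
    exact ⟨f, by rwa [uIcc_comm]⟩

/-- A solution on a compact interval is extended successively so as to reach every point of a dense
sequence, never changing on the interval already covered. Hence either the left or the right piece
must be preservable when gluing. -/
theorem exists_glued (hIo : IsOpen I) (hI : IsPreconnected I) [Nonempty Y]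
    (mono : ∀ f S T, S ⊆ T → Sol f T → Sol f S)
    (glue : ∀ f g a b c, a ≤ b → b ≤ c → Icc a c ⊆ I → Sol f (Icc a b) → Sol g (Icc b c) →
      (∃ h, Sol h (Icc a c) ∧ EqOn h f (Icc a b)) ∧ ∃ h, Sol h (Icc a c) ∧ EqOn h g (Icc b c))
    (loc : ∀ t ∈ I, ∃ f, ∃ ε > 0, Sol f (Icc (t - ε) (t + ε))) :
    ∃ h : ℝ → Y, ∀ t ∈ I, ∃ f, ∃ ε > 0, Sol f (Icc (t - ε) (t + ε)) ∧
      EqOn h f (Icc (t - ε) (t + ε)) := by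
  have hord : OrdConnected I := isPreconnected_iff_ordConnected.1 hI
  rcases I.eq_empty_or_nonempty with rfl | ⟨t₀, ht₀⟩
  · exact ⟨fun _ => Classical.arbitrary Y, by simp⟩
  have hexi : ∀ a b, a ∈ I → b ∈ I → a ≤ b → ∃ f, Sol f (Icc a b) := fun a b ha hb hab => by
    have := exists_sol_uIcc hI mono
      (fun f g a b c h1 h2 h3 h4 h5 => (glue f g a b c h1 h2 h3 h4 h5).1.imp fun _ h => h.1) loc ha hb
    rwa [uIcc_of_le hab] at this
  let State := {p : ℝ × ℝ × (ℝ → Y) // p.1 ∈ I ∧ p.2.1 ∈ I ∧ p.1 ≤ p.2.1 ∧ Sol p.2.2 (Icc p.1 p.2.1)}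
  have : Nonempty I := ⟨⟨t₀, ht₀⟩⟩
  let e : ℕ → I := TopologicalSpace.denseSeq I
  have hstep : ∀ (p : State) (x : I), ∃ q : State, q.1.1 ≤ p.1.1 ∧ p.1.2.1 ≤ q.1.2.1 ∧
      (x : ℝ) ∈ Icc q.1.1 q.1.2.1 ∧ EqOn q.1.2.2 p.1.2.2 (Icc p.1.1 p.1.2.1) := by
    rintro ⟨⟨c, d, f⟩, hc, hd, hcd, hf⟩ ⟨x, hx⟩
    simp only at hc hd hcd hf
    rcases lt_or_ge x c with hxc | hxc
    · obtain ⟨g, hg⟩ := hexi x c hx hc hxc.le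
      obtain ⟨-, h, hh, hhf⟩ := glue g f x c d hxc.le hcd (hord.out hx hd) hg hf
      exact ⟨⟨(x, d, h), hx, hd, hxc.le.trans hcd, hh⟩, hxc.le, le_rfl, ⟨le_rfl, hxc.le.trans hcd⟩, hhf⟩
    rcases le_or_gt x d with hxd | hxd
    · exact ⟨⟨(c, d, f), hc, hd, hcd, hf⟩, le_rfl, le_rfl, ⟨hxc, hxd⟩, fun _ _ => rfl⟩
    · obtain ⟨g, hg⟩ := hexi d x hd hx hxd.le
      obtain ⟨⟨h, hh, hhf⟩, -⟩ := glue f g c d x hcd hxd.le (hord.out hc hx) hf hg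
      exact ⟨⟨(c, x, h), hc, hx, hcd.trans hxd.le, hh⟩, le_rfl, hxd.le, ⟨hcd.trans hxd.le, le_rfl⟩, hhf⟩
  choose step hs1 hs2 hs3 hs4 using hstep
  obtain ⟨f₀, hf₀⟩ := hexi t₀ t₀ ht₀ ht₀ le_rfl
  let s : ℕ → State := fun k => Nat.rec ⟨(t₀, t₀, f₀), ht₀, ht₀, le_rfl, hf₀⟩ (fun k p => step p (e k)) k
  have hsucc : ∀ k, s (k + 1) = step (s k) (e k) := fun k => rfl
  have hmono : ∀ k m, k ≤ m → (s m).1.1 ≤ (s k).1.1 ∧ (s k).1.2.1 ≤ (s m).1.2.1 ∧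
      EqOn (s m).1.2.2 (s k).1.2.2 (Icc (s k).1.1 (s k).1.2.1) := by
    intro k m hkm
    induction m, hkm using Nat.le_induction with
    | base => exact ⟨le_rfl, le_rfl, fun _ _ => rfl⟩
    | succ m _ ih =>
      obtain ⟨h1, h2, h3⟩ := ih
      rw [hsucc]
      exact ⟨(hs1 _ _).trans h1, h2.trans (hs2 _ _),
        ((hs4 _ _).mono (Icc_subset_Icc h1 h2)).trans h3⟩
  -- Dense points on both sides of t put it in the interior of some interval.
  have hcov : ∀ t ∈ I, ∃ k, t ∈ Ioo (s k).1.1 (s k).1.2.1 := by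
    intro t ht
    have hd : DenseRange e := TopologicalSpace.denseRange_denseSeq I
    have hne : ∀ J : Set ℝ, IsOpen J → (I ∩ J).Nonempty → ∃ k, (e k : ℝ) ∈ J := by
      rintro J hJ ⟨y, hyI, hyJ⟩
      exact hd.exists_mem_open (hJ.preimage continuous_subtype_val) ⟨⟨y, hyI⟩, hyJ⟩
    obtain ⟨ε, hε, hεI⟩ := Metric.isOpen_iff.1 hIo t ht
    obtain ⟨i, hi⟩ := hne (Iio t) isOpen_Iio ⟨t - ε / 2, hεI (by
      rw [Metric.mem_ball, Real.dist_eq, abs_lt]; constructor <;> linarith), by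
      show t - ε / 2 < t; linarith⟩
    obtain ⟨j, hj⟩ := hne (Ioi t) isOpen_Ioi ⟨t + ε / 2, hεI (by
      rw [Metric.mem_ball, Real.dist_eq, abs_lt]; constructor <;> linarith), by
      show t < t + ε / 2; linarith⟩
    have h1 := hs3 (s i) (e i)
    have h2 := hs3 (s j) (e j)
    rw [← hsucc] at h1 h2
    refine ⟨max (i + 1) (j + 1), ?_, ?_⟩
    · exact (hmono _ _ (le_max_left _ _)).1.trans_lt (h1.1.trans_lt hi)
    · exact lt_of_lt_of_le (lt_of_lt_of_le hj h2.2)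
        (hmono (j + 1) (max (i + 1) (j + 1)) (le_max_right _ _)).2.1
  classical
  let h : ℝ → Y := fun t => if ht : t ∈ I then (s (hcov t ht).choose).1.2.2 t else f₀ t
  have hh : ∀ k, EqOn h (s k).1.2.2 (Icc (s k).1.1 (s k).1.2.1) := by
    intro k t ht
    have htI : t ∈ I := hord.out (s k).2.1 (s k).2.2.1 ht
    have h1 : h t = (s (hcov t htI).choose).1.2.2 t := dif_pos htI
    rw [h1]
    have h2 := (hcov t htI).choose_spec
    rcases le_total k (hcov t htI).choose with h3 | h3
    · exact (hmono _ _ h3).2.2 ht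
    · exact ((hmono _ _ h3).2.2 (Ioo_subset_Icc_self h2)).symm
  refine ⟨h, fun t ht => ?_⟩
  obtain ⟨k, hk⟩ := hcov t ht
  have h5 : ∃ ε > 0, Icc (t - ε) (t + ε) ⊆ Icc (s k).1.1 (s k).1.2.1 := by
    refine ⟨min (t - (s k).1.1) ((s k).1.2.1 - t), lt_min (sub_pos.2 hk.1) (sub_pos.2 hk.2),
      Icc_subset_Icc ?_ ?_⟩
    · linarith [min_le_left (t - (s k).1.1) ((s k).1.2.1 - t)]
    · linarith [min_le_right (t - (s k).1.1) ((s k).1.2.1 - t)]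
  obtain ⟨ε, hε, hsub⟩ := h5
  exact ⟨(s k).1.2.2, ε, hε, mono _ _ _ hsub (s k).2.2.2.2, (hh k).mono hsub⟩

/-- When pieces fit after permuting the second one, undoing the permutation on the whole glued
solution preserves the second piece instead of the first. -/
theorem exists_glued_perm {ι : Type} {Sol : (ℝ → ι → ℂ) → Set ℝ → Prop} (hIo : IsOpen I)
    (hI : IsPreconnected I) (mono : ∀ f S T, S ⊆ T → Sol f T → Sol f S)
    (perm : ∀ f S (ρ : Equiv.Perm ι), Sol f S → Sol (fun t i => f t (ρ i)) S)
    (glue : ∀ f g a b c, a ≤ b → b ≤ c → Icc a c ⊆ I → Sol f (Icc a b) → Sol g (Icc b c) →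
      ∃ (ρ : Equiv.Perm ι) (h : _), Sol h (Icc a c) ∧ EqOn h f (Icc a b) ∧
        EqOn h (fun t i => g t (ρ i)) (Icc b c))
    (loc : ∀ t ∈ I, ∃ f, ∃ ε > 0, Sol f (Icc (t - ε) (t + ε))) :
    ∃ h : ℝ → ι → ℂ, ∀ t ∈ I, ∃ f, ∃ ε > 0, Sol f (Icc (t - ε) (t + ε)) ∧
      EqOn h f (Icc (t - ε) (t + ε)) := by
  refine exists_glued hIo hI mono (fun f g a b c hab hbc hac hf hg => ?_) loc
  obtain ⟨ρ, h, hh, h1, h2⟩ := glue f g a b c hab hbc hac hf hg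
  refine ⟨⟨h, hh, h1⟩, fun t i => h t (ρ.symm i), perm _ _ _ hh, fun t ht => ?_⟩
  funext i
  simp [h2 ht]

end Gluing

/-! ### Continuous enumeration of continuous unordered tuples. -/

section Kato

variable {ι : Type} {z : ι → ℝ → ℂ} {t₀ : ℝ}

/-- The unordered tuple `z · t` depends continuously on `t` at `t₀`. -/
def TupleContinuousAt (z : ι → ℝ → ℂ) (t₀ : ℝ) : Prop :=
  ∀ ε > 0, ∀ᶠ t in 𝓝 t₀, ∃ σ : Equiv.Perm ι, ∀ i, ‖z (σ i) t - z i t₀‖ < ε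

theorem TupleContinuousAt.reorder (h : TupleContinuousAt z t₀) (σ : ℝ → Equiv.Perm ι) :
    TupleContinuousAt (fun i t => z (σ t i) t) t₀ := by
  intro ε hε
  filter_upwards [h ε hε] with t ⟨τ, hτ⟩
  refine ⟨(σ t₀).trans (τ.trans (σ t).symm), fun i => ?_⟩
  simpa using hτ (σ t₀ i)

/-- A matching that moves entries by less than r cannot cross the gap between radii r and 3r, so it
respects `p`. -/
theorem TupleContinuousAt.restrict {x : ι → ℝ → ℂ} {t₁ : ℝ} (h : TupleContinuousAt x t₁) {w : ℂ}
    {r : ℝ} (hr : 0 < r) (p : ι → Prop)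
    (hx : ∀ᶠ t in 𝓝 t₁, ∀ i, (p i → ‖x i t - w‖ < r) ∧ (¬ p i → 3 * r < ‖x i t - w‖)) :
    TupleContinuousAt (fun i : {i // p i} => x i) t₁ ∧
      TupleContinuousAt (fun i : {i // ¬ p i} => x i) t₁ := by
  have key : ∀ ε > 0, ∀ᶠ t in 𝓝 t₁, ∃ τ : Equiv.Perm ι, (∀ i, p (τ i) ↔ p i) ∧
      ∀ i, ‖x (τ i) t - x i t₁‖ < ε := by
    intro ε hε
    filter_upwards [h _ (lt_min hε hr), hx] with t ⟨τ, hτ⟩ hxt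
    refine ⟨τ, fun i => ?_, fun i => (hτ i).trans_le (min_le_left _ _)⟩
    have h1 := (hτ i).trans_le (min_le_right _ _)
    have h2 := hx.self_of_nhds i
    have h3 := hxt (τ i)
    have h4 := norm_sub_le_norm_sub_add_norm_sub (x (τ i) t) (x i t₁) w
    have h5 := norm_sub_le_norm_sub_add_norm_sub (x i t₁) (x (τ i) t) w
    have h6 := norm_sub_rev (x i t₁) (x (τ i) t)
    by_cases ha : p i <;> by_cases hb : p (τ i) <;> simp only [ha, hb]
    · have := h2.1 ha; have := h3.2 hb; linarith
    · have := h2.2 ha; have := h3.1 hb; linarith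
  constructor
  · intro ε hε
    filter_upwards [key ε hε] with t ⟨τ, hτ, hε⟩
    exact ⟨τ.subtypePerm hτ, fun i => hε i⟩
  · intro ε hε
    filter_upwards [key ε hε] with t ⟨τ, hτ, hε⟩
    exact ⟨τ.subtypePerm fun i => not_congr (hτ i), fun i => hε i⟩

/-- `f` is a continuous enumeration on `S` of the unordered tuples `z · t`. -/
def IsSelection (z : ι → ℝ → ℂ) (f : ℝ → ι → ℂ) (S : Set ℝ) : Prop :=
  ContinuousOn f S ∧ ∀ t ∈ S, ∃ σ : Equiv.Perm ι, ∀ i, f t i = z (σ i) t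

theorem exists_selection_of_local {I : Set ℝ} (hIo : IsOpen I) (hI : IsPreconnected I)
    (loc : ∀ t ∈ I, ∃ f, ∃ ε > 0, IsSelection z f (Icc (t - ε) (t + ε))) :
    ∃ f, IsSelection z f I := by
  obtain ⟨h, hh⟩ := exists_glued_perm (Sol := IsSelection z) hIo hI
    (fun f S T hST hf => ⟨hf.1.mono hST, fun t ht => hf.2 t (hST ht)⟩)
    (fun f S ρ hf => ⟨continuousOn_pi.2 fun i => continuousOn_pi.1 hf.1 (ρ i), fun t ht => by
      obtain ⟨σ, hσ⟩ := hf.2 t ht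
      exact ⟨ρ.trans σ, fun i => hσ (ρ i)⟩⟩)
    (fun f g a b c hab hbc _ hf hg => by
      obtain ⟨σ, hσ⟩ := hf.2 b ⟨hab, le_rfl⟩
      obtain ⟨τ, hτ⟩ := hg.2 b ⟨le_rfl, hbc⟩
      let ρ : Equiv.Perm ι := σ.trans τ.symm
      have hρ : ∀ i, g b (ρ i) = f b i := fun i => by rw [hτ, hσ]; simp [ρ]
      let h : ℝ → ι → ℂ := fun t => if t ≤ b then f t else fun i => g t (ρ i)
      have h1 : EqOn h f (Icc a b) := fun t ht => if_pos ht.2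
      have h2 : EqOn h (fun t i => g t (ρ i)) (Icc b c) := fun t ht => by
        rcases ht.1.eq_or_lt with rfl | hlt
        · funext i
          simp [h, hρ]
        · exact if_neg (not_le.2 hlt)
      refine ⟨ρ, h, ⟨?_, fun t ht => ?_⟩, h1, h2⟩
      · rw [← Icc_union_Icc_eq_Icc hab hbc]
        exact (hf.1.congr h1).union_of_isClosed
          ((continuousOn_pi.2 fun i => continuousOn_pi.1 hg.1 (ρ i)).congr h2) isClosed_Icc isClosed_Icc
      · rcases le_total t b with htb | htb
        · rw [h1 ⟨ht.1, htb⟩]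
          exact hf.2 t ⟨ht.1, htb⟩
        · rw [h2 ⟨htb, ht.2⟩]
          obtain ⟨σ, hσ⟩ := hg.2 t ⟨htb, ht.2⟩
          exact ⟨ρ.trans σ, fun i => hσ (ρ i)⟩)
    loc
  refine ⟨h, fun t ht => ?_, fun t ht => ?_⟩
  · obtain ⟨f, ε, hε, hf, hhf⟩ := hh t ht
    exact ((hf.1.congr hhf).continuousAt (Icc_mem_nhds (by linarith) (by linarith))).continuousWithinAt
  · obtain ⟨f, ε, hε, hf, hhf⟩ := hh t ht
    rw [hhf ⟨by linarith, by linarith⟩]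
    exact hf.2 t ⟨by linarith, by linarith⟩

theorem IsSelection.sum {x : ι → ℝ → ℂ} {p : ι → Prop} [DecidablePred p] {S : Set ℝ}
    {f : ℝ → {i // p i} → ℂ} {g : ℝ → {i // ¬ p i} → ℂ}
    (hf : IsSelection (fun i : {i // p i} => x i) f S)
    (hg : IsSelection (fun i : {i // ¬ p i} => x i) g S) :
    IsSelection x (fun t i => if h : p i then f t ⟨i, h⟩ else g t ⟨i, h⟩) S := by
  refine ⟨continuousOn_pi.2 fun i => ?_, fun t ht => ?_⟩
  · by_cases h : p i
    · simpa [h] using continuousOn_pi.1 hf.1 ⟨i, h⟩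
    · simpa [h] using continuousOn_pi.1 hg.1 ⟨i, h⟩
  · obtain ⟨σ, hσ⟩ := hf.2 t ht
    obtain ⟨τ, hτ⟩ := hg.2 t ht
    refine ⟨Equiv.Perm.subtypeCongr σ τ, fun i => ?_⟩
    by_cases h : p i
    · simp [h, hσ, Equiv.Perm.subtypeCongr.left_apply]
    · simp [h, hτ, Equiv.Perm.subtypeCongr.right_apply]

theorem IsSelection.of_reorder {f : ℝ → ι → ℂ} {S : Set ℝ} {σ : ℝ → Equiv.Perm ι}
    (h : IsSelection (fun i t => z (σ t i) t) f S) : IsSelection z f S :=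
  ⟨h.1, fun t ht => by
    obtain ⟨τ, hτ⟩ := h.2 t ht
    exact ⟨τ.trans (σ t), hτ⟩⟩

/-- Continuous unordered tuples of complex numbers over an open set of reals can be enumerated
continuously. -/
theorem exists_selection [Fintype ι] (z : ι → ℝ → ℂ) {I : Set ℝ} (hI : IsOpen I)
    (hz : ∀ t ∈ I, TupleContinuousAt z t) : ∃ f, IsSelection z f I := by
  classical
  induction hn : Fintype.card ι using Nat.strong_induction_on generalizing ι I with
  | _ n ih =>
  subst hn
  -- On this open set the tuple splits locally into smaller clusters, so the induction hypothesis
  -- yields local enumerations, glued on each component. Outside it all entries coincide, and any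
  -- enumeration is continuous there.
  let O : Set ℝ := {t ∈ I | ∃ i j, z i t ≠ z j t}
  have hO : IsOpen O := by
    rw [isOpen_iff_mem_nhds]
    rintro t ⟨htI, i, j, hij⟩
    have hd : 0 < ‖z i t - z j t‖ / 2 := by
      have := norm_pos_iff.2 (sub_ne_zero.2 hij)
      positivity
    filter_upwards [hI.mem_nhds htI, hz t htI _ hd] with s hs ⟨σ, hσ⟩
    refine ⟨hs, σ i, σ j, fun heq => ?_⟩
    have h1 := hσ i
    have h2 := hσ j
    rw [heq, norm_sub_rev] at h1
    have := norm_sub_le_norm_sub_add_norm_sub (z i t) (z (σ j) s) (z j t)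
    linarith
  have hloc : ∀ t ∈ O, ∃ f, ∃ ε > 0, IsSelection z f (Icc (t - ε) (t + ε)) := by
    rintro t₀ ⟨htI, i₀, j₀, hij⟩
    obtain ⟨r, hr, hsep⟩ := exists_separation (y := fun i => z i t₀) (z i₀ t₀)
    have h1 := (hz t₀ htI r hr).and (hI.mem_nhds htI)
    obtain ⟨δ, hδ, hball⟩ := Metric.eventually_nhds_iff_ball.1 h1
    choose! σ hσ using fun t ht => (hball t ht).1
    let p : ι → Prop := fun i => z i t₀ = z i₀ t₀
    have hx : ∀ t ∈ Metric.ball t₀ δ, ∀ i, (p i → ‖z (σ t i) t - z i₀ t₀‖ < r) ∧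
        (¬ p i → 3 * r < ‖z (σ t i) t - z i₀ t₀‖) := by
      intro t ht i
      have h2 := hσ t ht i
      refine ⟨fun h => ?_, fun h => ?_⟩
      · rw [← show z i t₀ = z i₀ t₀ from h]
        exact h2
      · have h3 := hsep i h
        have := norm_sub_le_norm_sub_add_norm_sub (z i t₀) (z (σ t i) t) (z i₀ t₀)
        rw [norm_sub_rev] at h2
        linarith
    have hres := fun t (ht : t ∈ Metric.ball t₀ δ) =>
      ((hz t (hball t ht).2).reorder σ).restrict hr p
        (eventually_of_mem (Metric.isOpen_ball.mem_nhds ht) hx)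
    obtain ⟨f, hf⟩ := ih _ (Fintype.card_subtype_lt (x := j₀) (p := p) fun h => hij h.symm) _
      Metric.isOpen_ball (fun t ht => (hres t ht).1) rfl
    obtain ⟨g, hg⟩ := ih _ (Fintype.card_subtype_lt (x := i₀) (p := fun i => ¬ p i) fun h => h rfl) _
      Metric.isOpen_ball (fun t ht => (hres t ht).2) rfl
    have hfg := (hf.sum hg).of_reorder
    have hsub : Icc (t₀ - δ / 2) (t₀ + δ / 2) ⊆ Metric.ball t₀ δ := fun t ht => by
      rw [Metric.mem_ball, Real.dist_eq, abs_lt]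
      constructor <;> linarith [ht.1, ht.2]
    exact ⟨_, δ / 2, half_pos hδ, hfg.1.mono hsub, fun t ht => hfg.2 t (hsub ht)⟩
  have hcomp : ∀ U : Set ℝ, ∃ f, IsOpen U → IsPreconnected U → U ⊆ O → IsSelection z f U := fun U => by
    by_cases h : IsOpen U ∧ IsPreconnected U ∧ U ⊆ O
    · obtain ⟨f, hf⟩ := exists_selection_of_local h.1 h.2.1 fun t ht => hloc t (h.2.2 ht)
      exact ⟨f, fun _ _ _ => hf⟩
    · exact ⟨fun _ _ => 0, fun h1 h2 h3 => absurd ⟨h1, h2, h3⟩ h⟩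
  choose H hH using hcomp
  have hHx : ∀ t, IsSelection z (H (connectedComponentIn O t)) (connectedComponentIn O t) := fun t =>
    hH _ hO.connectedComponentIn isPreconnected_connectedComponentIn (connectedComponentIn_subset _ _)
  let f : ℝ → ι → ℂ := fun t => if t ∈ O then H (connectedComponentIn O t) t else fun i => z i t
  have hperm : ∀ t ∈ I, ∃ σ : Equiv.Perm ι, ∀ i, f t i = z (σ i) t := by
    intro t ht
    by_cases hO' : t ∈ O
    · simp only [f, if_pos hO']
      exact (hHx t).2 t (mem_connectedComponentIn hO')
    · exact ⟨1, fun i => by simp [f, hO']⟩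
  refine ⟨f, fun t ht => ContinuousAt.continuousWithinAt ?_, hperm⟩
  by_cases hO' : t ∈ O
  · have hmem : connectedComponentIn O t ∈ 𝓝 t :=
      hO.connectedComponentIn.mem_nhds (mem_connectedComponentIn hO')
    refine ((hHx t).1.continuousAt hmem).congr ?_
    filter_upwards [hmem] with s hs
    simp only [f, if_pos (connectedComponentIn_subset _ _ hs), connectedComponentIn_eq hs]
  · have hall : ∀ i j, z i t = z j t := fun i j => by
      by_contra h
      exact hO' ⟨ht, i, j, h⟩
    refine continuousAt_pi.2 fun i => Metric.tendsto_nhds.2 fun ε hε => ?_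
    filter_upwards [hz t ht ε hε, hI.mem_nhds ht] with s ⟨σ, hσ⟩ hs
    obtain ⟨τ, hτ⟩ := hperm s hs
    obtain ⟨τ', hτ'⟩ := hperm t ht
    have := hσ (σ.symm (τ i))
    rwa [Equiv.apply_symm_apply, hall _ (τ' i), ← hτ, ← hτ', ← dist_eq_norm] at this

end Kato

/-! ### Separation from the absence of infinite order meetings. -/

section NoInfiniteOrder

variable {ι : Type} [Fintype ι] {M : ℕ → ℝ} {z : ι → ℝ → ℂ}

/-- `f` vanishes of infinite order at `0` from the right. -/
def RightFlat (f : ℝ → ℂ) : Prop :=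
  ∀ k : ℕ, ∀ᶠ t in 𝓝[>] (0 : ℝ), ‖f t‖ ≤ t ^ k

/-- At each s the difference equals one of finitely many differences of expansions, each flat or
bounded below by a power. Which one occurs could vary with s, but continuity and connectedness of
(0, δ) fix the alternative. -/
theorem Adm.rightFlat_or_lower (hM : IsRegularSeq M) (hz : Adm M z) (hc : ∀ i, Continuous (z i))
    (a b : ι) : RightFlat (fun t => z a t - z b t) ∨
      ∃ m : ℕ, ∀ᶠ t in 𝓝[>] (0 : ℝ), t ^ m ≤ ‖z a t - z b t‖ := by
  classical
  obtain ⟨N, hN, -, ν, r, hν, hr, h⟩ := hz.hasExpansion hM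
  let ρ : ι → ι → ℝ → ℂ := fun i j s => (ν i s + r i s) - (ν j s + r j s)
  have hρ : ∀ i j, Flat (ρ i j) ∨ ∃ m : ℕ, ∀ᶠ t in 𝓝[≠] (0 : ℝ), |t| ^ m ≤ ‖ρ i j t‖ := fun i j => by
    have hG : GM M fun s => ν i s - ν j s := (hν i).sub hM (hν j)
    have h1 : ρ i j = fun s => (ν i s - ν j s) + (r i s - r j s) := by
      funext s
      simp only [ρ]
      ring
    rw [h1]
    exact hG.flat_or_lower hM ((hr i).sub (hr j))
  have hρ' : ∀ i j, ∃ m : ℕ, Flat (ρ i j) ∨ ∀ᶠ t in 𝓝[≠] (0 : ℝ), |t| ^ m ≤ ‖ρ i j t‖ := fun i j => by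
    rcases hρ i j with h | ⟨m, hm⟩
    · exact ⟨0, Or.inl h⟩
    · exact ⟨m, Or.inr hm⟩
  choose m' hm' using hρ'
  set m := ∑ i, ∑ j, m' i j with hm
  have hgt : 𝓝[>] (0 : ℝ) ≤ 𝓝[≠] 0 := nhdsWithin_mono _ fun x hx => ne_of_gt hx
  have hlt1 : ∀ᶠ s in 𝓝[>] (0 : ℝ), s < 1 := nhdsWithin_le_nhds (gt_mem_nhds one_pos)
  have hdich : ∀ k : ℕ, ∀ᶠ s in 𝓝[>] (0 : ℝ),
      ‖z a (s ^ N) - z b (s ^ N)‖ < s ^ k ∨ s ^ m ≤ ‖z a (s ^ N) - z b (s ^ N)‖ := by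
    intro k
    have h1 : ∀ i j, ∀ᶠ s in 𝓝[>] (0 : ℝ), ‖ρ i j s‖ < s ^ k ∨ s ^ m ≤ ‖ρ i j s‖ := by
      intro i j
      rcases hm' i j with hf | hl
      · filter_upwards [hgt (hf.eventually_lt k), eventually_mem_nhdsWithin] with s hs hs0
        rw [abs_of_pos (show 0 < s from hs0)] at hs
        exact Or.inl hs
      · filter_upwards [hgt hl, eventually_mem_nhdsWithin, hlt1] with s hs hs0 hs1
        have hs0' : 0 < s := hs0
        rw [abs_of_pos hs0'] at hs
        refine Or.inr (le_trans (pow_le_pow_of_le_one hs0'.le hs1.le ?_) hs)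
        calc m' i j ≤ ∑ j, m' i j := Finset.single_le_sum (f := fun j => m' i j)
              (fun _ _ => Nat.zero_le _) (Finset.mem_univ _)
          _ ≤ m := Finset.single_le_sum (f := fun i => ∑ j, m' i j)
              (fun _ _ => Nat.zero_le _) (Finset.mem_univ _)
    filter_upwards [eventually_all.2 fun i => eventually_all.2 (h1 i), nhdsWithin_le_nhds h]
      with s hs ⟨⟨σ, hσ⟩, _⟩
    rw [hσ, hσ]
    exact hs (σ a) (σ b)
  obtain ⟨δ, hδ, hball⟩ := mem_nhdsGT_iff_exists_Ioo_subset.1 ((hdich (m + 1)).and hlt1)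
  have hδ0 : (0 : ℝ) < δ := hδ
  let d : ℝ → ℝ := fun s => ‖z a (s ^ N) - z b (s ^ N)‖
  have hd : Continuous d := by
    have := hc a
    have := hc b
    fun_prop
  have hI : IsPreconnected (Ioo 0 δ) := isPreconnected_Ioo
  -- By the dichotomy with k = m + 1, no value lies strictly between s^(m+1) and s^m, so these two
  -- open conditions are disjoint and cover.
  have hsplit := isPreconnected_iff_subset_of_disjoint.1 hI {s | d s < s ^ m} {s | s ^ (m + 1) < d s}
    (isOpen_lt hd (by fun_prop)) (isOpen_lt (by fun_prop) hd)
    (fun s hs => by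
      obtain ⟨h1, h2⟩ := hball hs
      rcases lt_or_ge (d s) (s ^ m) with h3 | h3
      · exact Or.inl h3
      · refine Or.inr (lt_of_lt_of_le ?_ h3)
        exact pow_lt_pow_right_of_lt_one₀ hs.1 h2 (Nat.lt_succ_self m))
    (by
      rw [Set.eq_empty_iff_forall_notMem]
      rintro s ⟨hs, h1, h2⟩
      rcases (hball hs).1 with h3 | h3
      · exact absurd h2 (not_lt.2 (le_of_lt h3))
      · exact absurd h1 (not_lt.2 h3))
  have hmem : ∀ᶠ s in 𝓝[>] (0 : ℝ), s ∈ Ioo 0 δ := Ioo_mem_nhdsGT hδ0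
  rcases hsplit with h1 | h1
  · left
    intro k
    refine eventually_right_of_pow hN ?_
    filter_upwards [hmem, hdich (N * k)] with s hs hk
    rw [← pow_mul]
    rcases hk with hk | hk
    · exact hk.le
    · exact absurd (h1 hs) (not_lt.2 hk)
  · right
    refine ⟨m + 1, eventually_right_of_pow hN ?_⟩
    filter_upwards [hmem, hlt1] with s hs hs1
    refine le_trans ?_ (le_of_lt (h1 hs))
    rw [← pow_mul]
    exact pow_le_pow_of_le_one hs.1.le hs1.le (Nat.le_mul_of_pos_left _ (by omega))

/-- The product of all differences of two distinct variables. -/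
noncomputable def discPoly (ι : Type) [Fintype ι] [DecidableEq ι] : MvPolynomial ι ℂ :=
  ∏ p : ι × ι with p.1 ≠ p.2, (MvPolynomial.X p.1 - MvPolynomial.X p.2)

theorem discPoly_isSymmetric [DecidableEq ι] : (discPoly ι).IsSymmetric := by
  intro σ
  rw [discPoly, map_prod]
  refine Finset.prod_equiv (Equiv.prodCongr σ σ) ?_ ?_
  · rintro ⟨i, j⟩
    simp
  · rintro ⟨i, j⟩ -
    simp

theorem aeval_discPoly [DecidableEq ι] (y : ι → ℂ) :
    MvPolynomial.aeval y (discPoly ι) = ∏ p : ι × ι with p.1 ≠ p.2, (y p.1 - y p.2) := by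
  simp [discPoly]

/-- The product of all differences is a symmetric function, hence a C^M germ. Flat on the right, it
is flat on both sides, which is impossible if every difference has a power lower bound on the left.
-/
theorem Adm.exists_rightFlat_neg (hM : IsRegularSeq M) (hz : Adm M z) (hc : ∀ i, Continuous (z i))
    {a b : ι} (hab : a ≠ b) (h : RightFlat fun t => z a t - z b t) :
    ∃ c d, c ≠ d ∧ RightFlat fun t => z c (-t) - z d (-t) := by
  classical
  have hG := hz.symm hM discPoly_isSymmetric
  simp only [aeval_discPoly] at hG
  have hflat : Flat fun t => ∏ p : ι × ι with p.1 ≠ p.2, (z p.1 t - z p.2 t) := by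
    refine hG.flat_of_isBigO hM (nhdsWithin_mono _ fun x hx => ne_of_gt hx :
      𝓝[>] (0 : ℝ) ≤ 𝓝[≠] 0) fun k => ?_
    have hmem : (a, b) ∈ ({p : ι × ι | p.1 ≠ p.2} : Finset (ι × ι)) := by simpa using hab
    simp only [← Finset.mul_prod_erase _ _ hmem]
    have h1 : (fun t => z a t - z b t) =O[𝓝[>] (0 : ℝ)] fun t => t ^ k := by
      refine Asymptotics.IsBigO.of_bound 1 ?_
      filter_upwards [h k, eventually_mem_nhdsWithin] with t ht h0
      rw [one_mul, norm_pow, Real.norm_eq_abs, abs_of_pos (show 0 < t from h0)]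
      exact ht
    have h2 : (fun t => ∏ p ∈ ({p : ι × ι | p.1 ≠ p.2} : Finset (ι × ι)).erase (a, b),
        (z p.1 t - z p.2 t)) =O[𝓝[>] (0 : ℝ)] fun _ => (1 : ℝ) := by
      have h3 : Continuous fun t => ∏ p ∈ ({p : ι × ι | p.1 ≠ p.2} : Finset (ι × ι)).erase (a, b),
          (z p.1 t - z p.2 t) := continuous_finsetProd _ fun p _ => (hc p.1).sub (hc p.2)
      exact ((h3.tendsto 0).mono_left nhdsWithin_le_nhds).isBigO_one ℝ
    simpa using h1.mul h2
  by_contra! hno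
  have hl : ∀ p : ι × ι, ∃ m : ℕ, p.1 ≠ p.2 →
      ∀ᶠ t in 𝓝[>] (0 : ℝ), t ^ m ≤ ‖z p.1 (-t) - z p.2 (-t)‖ := by
    rintro ⟨c, d⟩
    by_cases hcd : c = d
    · exact ⟨0, fun h => absurd hcd h⟩
    · rcases (hz.neg hM).rightFlat_or_lower hM (fun i => (hc i).comp continuous_neg) c d with h | ⟨m, h⟩
      · exact absurd h (hno c d hcd)
      · exact ⟨m, fun _ => h⟩
  choose m hm using hl
  have hneg : Tendsto (fun t : ℝ => -t) (𝓝[>] 0) (𝓝[≠] 0) := by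
    refine tendsto_nhdsWithin_iff.2 ⟨?_, ?_⟩
    · have : Tendsto (fun t : ℝ => -t) (𝓝 0) (𝓝 (-0)) := continuous_neg.tendsto 0
      rw [neg_zero] at this
      exact this.mono_left nhdsWithin_le_nhds
    · filter_upwards [eventually_mem_nhdsWithin] with t ht
      exact neg_ne_zero.2 (ne_of_gt ht)
  have h1 : ∀ᶠ t in 𝓝[>] (0 : ℝ), ∀ p : ι × ι, p.1 ≠ p.2 →
      t ^ m p ≤ ‖z p.1 (-t) - z p.2 (-t)‖ := by
    refine eventually_all.2 fun p => ?_
    by_cases hp : p.1 = p.2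
    · exact Eventually.of_forall fun t h => absurd hp h
    · filter_upwards [hm p hp] with t ht _ using ht
  obtain ⟨t, h2, h3, h4⟩ := ((hneg.eventually (hflat.eventually_lt (∑ p : ι × ι with p.1 ≠ p.2, m p))).and
    (h1.and eventually_mem_nhdsWithin)).exists
  rw [abs_neg, abs_of_pos (show 0 < t from h4), norm_prod, ← Finset.prod_pow_eq_pow_sum] at h2
  refine absurd h2 (not_lt.2 (Finset.prod_le_prod (fun p _ => (pow_pos h4 _).le) fun p hp => ?_))
  exact h3 p (by simpa using hp)

/-- Within the cluster of roots meeting `a` at 0, some pair `c`, `d` is flat on the left. Continuing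
`c` by `a` and `d` by `b` across 0 gives continuous roots meeting of infinite order, so the
hypothesis identifies `a` with `b` on the right. -/
theorem Adm.eventually_eq_of_rightFlat (hM : IsRegularSeq M) (hz : Adm M z)
    (hc : ∀ i, Continuous (z i))
    (hno : ∀ lam : ι → ℝ → ℂ, (∀ i, Continuous (lam i)) →
      (∀ t, ∃ σ : Equiv.Perm ι, ∀ i, lam i t = z (σ i) t) →
      ∀ i j, Flat (fun t => lam i t - lam j t) → lam i =ᶠ[𝓝 0] lam j)
    {a b : ι} (h : RightFlat fun t => z a t - z b t) : ∀ᶠ t in 𝓝[>] (0 : ℝ), z a t = z b t := by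
  classical
  by_cases hab : a = b
  · simp [hab]
  have hab0 : z b 0 = z a 0 := by
    have h1 : Tendsto (fun t => z a t - z b t) (𝓝[>] 0) (𝓝 (z a 0 - z b 0)) :=
      (((hc a).sub (hc b)).tendsto 0).mono_left nhdsWithin_le_nhds
    have h2 : Tendsto (fun t => z a t - z b t) (𝓝[>] 0) (𝓝 0) := by
      refine squeeze_zero_norm' (h 1) ?_
      simp only [pow_one]
      exact (continuous_id.tendsto (0 : ℝ)).mono_left nhdsWithin_le_nhds
    exact (sub_eq_zero.1 (tendsto_nhds_unique h1 h2)).symm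
  let p : ι → Prop := fun i => z i 0 = z a 0
  obtain ⟨r, hr, hsep⟩ := exists_separation (y := fun i => z i 0) (z a 0)
  have hres : Adm M fun i : {i // p i} => z i := by
    refine hz.restrict hM p hr (w := z a 0) (eventually_all.2 fun i => ?_)
    have hci : Tendsto (fun t => ‖z i t - z a 0‖) (𝓝 0) (𝓝 ‖z i 0 - z a 0‖) :=
      (((hc i).sub continuous_const).norm).tendsto 0
    by_cases hi : p i
    · have : ‖z i 0 - z a 0‖ < r := by rw [show z i 0 = z a 0 from hi, sub_self, norm_zero]; exact hr
      filter_upwards [hci.eventually (gt_mem_nhds this)] with t ht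
      exact ⟨fun _ => ht, fun h => absurd hi h⟩
    · have : 3 * r < ‖z i 0 - z a 0‖ := by linarith [hsep i hi]
      filter_upwards [hci.eventually (lt_mem_nhds this)] with t ht
      exact ⟨fun h => absurd h hi, fun _ => ht⟩
  obtain ⟨⟨c, hcw⟩, ⟨d, hdw⟩, hcd, hflat⟩ := hres.exists_rightFlat_neg hM (fun i => hc i)
    (a := ⟨a, rfl⟩) (b := ⟨b, hab0⟩) (fun h => hab (congrArg Subtype.val h)) h
  replace hcd : c ≠ d := fun h => hcd (Subtype.ext h)
  simp only at hflat
  have hswap : ∀ i j k : ι, z i 0 = z j 0 → z (Equiv.swap i j k) 0 = z k 0 := by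
    intro i j k hij
    rw [Equiv.swap_apply_def]
    split_ifs with h1 h2
    · rw [h1, hij]
    · rw [h2, hij]
    · rfl
  let τ₀ : Equiv.Perm ι := Equiv.swap c a
  -- This permutation sends c to a and d to b and only exchanges roots with equal value at 0, so
  -- switching labels there keeps continuity.
  let τ : Equiv.Perm ι := τ₀.trans (Equiv.swap (τ₀ d) b)
  have hτ₀ : ∀ k, z (τ₀ k) 0 = z k 0 := fun k => hswap c a k hcw
  have hτ : ∀ k, z (τ k) 0 = z k 0 := fun k =>
    (hswap (τ₀ d) b (τ₀ k) ((hτ₀ d).trans (hdw.trans hab0.symm))).trans (hτ₀ k)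
  have hτd : τ d = b := by simp [τ]
  have hτc : τ c = a := by
    have h1 : τ₀ c = a := Equiv.swap_apply_left c a
    show Equiv.swap (τ₀ d) b (τ₀ c) = a
    rw [h1]
    exact Equiv.swap_apply_of_ne_of_ne (fun h2 => hcd (τ₀.injective (h1.trans h2))) hab
  let lam : ι → ℝ → ℂ := fun i t => if t ≤ 0 then z i t else z (τ i) t
  have hlc : ∀ i, Continuous (lam i) := fun i =>
    Continuous.if_le (hc i) (hc (τ i)) continuous_id continuous_const fun t ht => by
      rw [show t = 0 from ht, hτ]
  have hlp : ∀ t, ∃ σ : Equiv.Perm ι, ∀ i, lam i t = z (σ i) t := fun t => by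
    by_cases ht : t ≤ 0
    · exact ⟨1, fun i => by simp [lam, ht]⟩
    · exact ⟨τ, fun i => by simp [lam, ht]⟩
  have hlf : Flat fun t => lam c t - lam d t := by
    intro k
    refine Asymptotics.IsBigO.of_bound 1 ?_
    have h1 : ∀ᶠ t in 𝓝[≠] (0 : ℝ), ‖lam c t - lam d t‖ ≤ |t| ^ k := by
      rw [← Iio_union_Ioi, nhdsWithin_union, eventually_sup]
      constructor
      · have hneg : Tendsto (fun t : ℝ => -t) (𝓝[<] 0) (𝓝[>] 0) := by
          refine tendsto_nhdsWithin_iff.2 ⟨?_, ?_⟩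
          · have : Tendsto (fun t : ℝ => -t) (𝓝 0) (𝓝 (-0)) := continuous_neg.tendsto 0
            rw [neg_zero] at this
            exact this.mono_left nhdsWithin_le_nhds
          · filter_upwards [eventually_mem_nhdsWithin] with t ht
            exact neg_pos.2 (show t < 0 from ht)
        filter_upwards [hneg.eventually (hflat k), eventually_mem_nhdsWithin] with t ht h0
        have h0' : t < 0 := h0
        rw [neg_neg] at ht
        simpa [lam, h0'.le, abs_of_neg h0'] using ht
      · filter_upwards [h k, eventually_mem_nhdsWithin] with t ht h0
        have h0' : 0 < t := h0
        simpa [lam, not_le.2 h0', hτc, hτd, abs_of_pos h0'] using ht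
    rw [eventually_nhdsWithin_iff] at h1
    filter_upwards [h1] with t ht
    rw [one_mul, norm_pow, Real.norm_eq_abs]
    by_cases h0 : t = 0
    · subst h0
      have : lam c 0 - lam d 0 = 0 := by
        simp only [lam, le_refl, if_true]
        rw [show z c 0 = z a 0 from hcw, show z d 0 = z a 0 from hdw, sub_self]
      rw [this, norm_zero]
      positivity
    · exact ht h0
  filter_upwards [nhdsWithin_le_nhds (hno lam hlc hlp c d hlf), eventually_mem_nhdsWithin] with t ht h0
  simpa [lam, not_le.2 (show (0 : ℝ) < t from h0), hτc, hτd] using ht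

theorem Adm.sepAt_of_no_flat (hM : IsRegularSeq M) (hz : Adm M z) (hc : ∀ i, Continuous (z i))
    (hno : ∀ lam : ι → ℝ → ℂ, (∀ i, Continuous (lam i)) →
      (∀ t, ∃ σ : Equiv.Perm ι, ∀ i, lam i t = z (σ i) t) →
      ∀ i j, Flat (fun t => lam i t - lam j t) → lam i =ᶠ[𝓝 0] lam j) : SepAt z 0 := by
  have hright : ∀ x : ι → ℝ → ℂ, Adm M x → (∀ i, Continuous (x i)) →
      (∀ lam : ι → ℝ → ℂ, (∀ i, Continuous (lam i)) →
        (∀ t, ∃ σ : Equiv.Perm ι, ∀ i, lam i t = x (σ i) t) →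
        ∀ i j, Flat (fun t => lam i t - lam j t) → lam i =ᶠ[𝓝 0] lam j) →
      ∃ m : ℕ, ∀ᶠ t in 𝓝[>] (0 : ℝ), ∀ i j, x i t ≠ x j t → t ^ m ≤ ‖x i t - x j t‖ := by
    intro x hx hxc hxno
    refine right_sep_of_pairs (N := 1) le_rfl (w := x)
      (Eventually.of_forall fun s => ⟨1, fun i => by simp⟩) fun i j => ?_
    rcases hx.rightFlat_or_lower hM hxc i j with hf | ⟨m, hm⟩
    · refine ⟨0, ?_⟩
      filter_upwards [hx.eventually_eq_of_rightFlat hM hxc hxno hf] with t ht hne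
      exact absurd ht hne
    · exact ⟨m, hm.mono fun t ht _ => ht⟩
  refine sepAt_zero_of_right (hright z hz hc hno)
    (hright _ (hz.neg hM) (fun i => (hc i).comp continuous_neg) fun lam hlc hlp i j hf => ?_)
  have hneg : Tendsto (fun t : ℝ => -t) (𝓝 0) (𝓝 0) := by
    simpa using (continuous_neg (G := ℝ)).tendsto 0
  have := hno (fun i t => lam i (-t)) (fun i => (hlc i).comp continuous_neg)
    (fun t => by simpa using hlp (-t)) i j (fun k => by
      refine ((hf k).comp_tendsto hneg).trans ?_
      refine Asymptotics.IsBigO.of_bound 1 (Eventually.of_forall fun s => ?_)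
      simp)
  filter_upwards [hneg.eventually this] with t ht
  simpa using ht

end NoInfiniteOrder

/-! ### Global C^M enumerations and separation at every point. -/

section GlobalRoots

variable {ι : Type} {M : ℕ → ℝ} {z : ι → ℝ → ℂ}

/-- Near `t`, `f` is a `C^M` enumeration of the unordered tuples `z`. -/
def IsDCSelectionAt (M : ℕ → ℝ) (z : ι → ℝ → ℂ) (f : ℝ → ι → ℂ) (t : ℝ) : Prop :=
  (∀ i, GM M fun s => f (t + s) i) ∧ ∀ᶠ s in 𝓝 t, ∃ σ : Equiv.Perm ι, ∀ i, f s i = z (σ i) s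

theorem tendsto_add_nhds_zero (t : ℝ) : Tendsto (fun s : ℝ => t + s) (𝓝 0) (𝓝 t) := by
  have h : Tendsto (fun s : ℝ => t + s) (𝓝 0) (𝓝 (t + 0)) := Continuous.tendsto (by fun_prop) 0
  rwa [add_zero] at h

theorem tendsto_sub_nhds_zero (t : ℝ) : Tendsto (fun s : ℝ => s - t) (𝓝 t) (𝓝 0) := by
  have h : Tendsto (fun s : ℝ => s - t) (𝓝 t) (𝓝 (t - t)) := Continuous.tendsto (by fun_prop) t
  rwa [sub_self] at h

theorem GM.eventually_translate {f : ℝ → ℂ} {t : ℝ} (hf : GM M fun s => f (t + s)) :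
    ∀ᶠ t' in 𝓝 t, GM M fun s => f (t' + s) := by
  obtain ⟨δ, hδ, h⟩ := hf.exists_isDC
  filter_upwards [Ioo_mem_nhds (show t - δ < t by linarith) (show t < t + δ by linarith)] with t' ht'
  have := h.gm isOpen_Ioo (t := t' - t) ⟨by linarith [ht'.1], by linarith [ht'.2]⟩
  have h2 : (fun s => f (t + (t' - t + s))) = fun s => f (t' + s) := by
    funext s
    congr 1
    ring
  rwa [h2] at this

namespace IsDCSelectionAt

variable {f g : ℝ → ι → ℂ} {t : ℝ}

theorem congr (h : IsDCSelectionAt M z f t) (hfg : g =ᶠ[𝓝 t] f) : IsDCSelectionAt M z g t := by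
  refine ⟨fun i => (h.1 i).congr ?_, ?_⟩
  · filter_upwards [(tendsto_add_nhds_zero t).eventually hfg] with s hs
    rw [hs]
  · filter_upwards [h.2, hfg] with s hs hs'
    rwa [hs']

theorem perm (h : IsDCSelectionAt M z f t) (ρ : Equiv.Perm ι) :
    IsDCSelectionAt M z (fun t i => f t (ρ i)) t := by
  refine ⟨fun i => h.1 (ρ i), ?_⟩
  filter_upwards [h.2] with s ⟨σ, hσ⟩
  exact ⟨ρ.trans σ, fun i => hσ (ρ i)⟩

variable [Fintype ι]

theorem eventually (h : IsDCSelectionAt M z f t) : ∀ᶠ t' in 𝓝 t, IsDCSelectionAt M z f t' := by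
  filter_upwards [eventually_all.2 fun i => GM.eventually_translate (f := fun t => f t i) (h.1 i),
    eventually_eventually_nhds.2 h.2] with t' h1 h2
  exact ⟨h1, h2⟩

theorem exists_perm (hM : IsRegularSeq M) (hsep : ∀ t, SepAt z t) (hf : IsDCSelectionAt M z f t)
    (hg : IsDCSelectionAt M z g t) :
    ∃ ρ : Equiv.Perm ι, f =ᶠ[𝓝 t] fun t i => g t (ρ i) := by
  obtain ⟨δ, hδ, hb⟩ := Metric.eventually_nhds_iff_ball.1 (hf.eventually.and hg.eventually)
  rw [Real.ball_eq_Ioo] at hb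
  obtain ⟨ρ, hρ⟩ := exists_perm_of_sepAt (lam := fun i t => g t i) (mu := fun i t => f t i) hM
    isOpen_Ioo isPreconnected_Ioo (fun i t ht => (hb t ht).2.1 i) (fun i t ht => (hb t ht).1.1 i)
    (fun t ht => by
      obtain ⟨σ, hσ⟩ := (hb t ht).1.2.self_of_nhds
      obtain ⟨τ, hτ⟩ := (hb t ht).2.2.self_of_nhds
      exact ⟨σ.trans τ.symm, fun i => by rw [hσ, hτ]; simp⟩)
    (fun t ht => (hsep t).congr (nhdsWithin_le_nhds (hb t ht).2.2))
  refine ⟨ρ, ?_⟩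
  filter_upwards [Ioo_mem_nhds (show t - δ < t by linarith) (show t < t + δ by linarith)] with s hs
  exact _root_.funext fun i => hρ s hs i

/-- Local `C^M` enumerations of tuples with separated entries can be glued. -/
theorem exists_global (hM : IsRegularSeq M) (hsep : ∀ t, SepAt z t)
    (loc : ∀ t, ∃ f, IsDCSelectionAt M z f t) : ∃ f, ∀ t, IsDCSelectionAt M z f t := by
  obtain ⟨h, hh⟩ := exists_glued_perm (I := univ)
    (Sol := fun f S => ∀ t ∈ S, IsDCSelectionAt M z f t) isOpen_univ isPreconnected_univ
    (fun f S T hST hf t ht => hf t (hST ht)) (fun f S ρ hf t ht => (hf t ht).perm ρ)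
    (fun f g a b c hab hbc _ hf hg => by
      -- Rigidity matches the pieces on a whole neighbourhood of b, so the glued function is C^M
      -- there.
      obtain ⟨ρ, hρ⟩ := (hf b ⟨hab, le_rfl⟩).exists_perm hM hsep (hg b ⟨le_rfl, hbc⟩)
      let h : ℝ → ι → ℂ := fun t => if t ≤ b then f t else fun i => g t (ρ i)
      have h1 : ∀ t ≤ b, h t = f t := fun t ht => if_pos ht
      have h2 : ∀ t, b < t → h t = fun i => g t (ρ i) := fun t ht => if_neg (not_le.2 ht)
      have h3 : h =ᶠ[𝓝 b] f := by
        filter_upwards [hρ] with t ht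
        rcases le_or_gt t b with htb | htb
        · exact h1 t htb
        · rw [h2 t htb, ht]
      refine ⟨ρ, h, fun t ht => ?_, fun t ht => h1 t ht.2, fun t ht => ?_⟩
      · rcases lt_trichotomy t b with htb | rfl | htb
        · refine (hf t ⟨ht.1, htb.le⟩).congr ?_
          filter_upwards [Iio_mem_nhds htb] with s hs using h1 s (le_of_lt hs)
        · exact (hf t ⟨hab, le_rfl⟩).congr h3
        · refine ((hg t ⟨htb.le, ht.2⟩).perm ρ).congr ?_
          filter_upwards [Ioi_mem_nhds htb] with s hs using h2 s hs
      · rcases ht.1.eq_or_lt with rfl | hlt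
        · rw [h1 _ le_rfl, hρ.self_of_nhds]
        · exact h2 t hlt)
    (fun t _ => by
      obtain ⟨f, hf⟩ := loc t
      obtain ⟨δ, hδ, hb⟩ := Metric.eventually_nhds_iff_ball.1 hf.eventually
      refine ⟨f, δ / 2, half_pos hδ, fun s hs => hb s ?_⟩
      rw [Metric.mem_ball, Real.dist_eq, abs_lt]
      constructor <;> linarith [hs.1, hs.2])
  refine ⟨h, fun t => ?_⟩
  obtain ⟨f, ε, hε, hf, hhf⟩ := hh t (mem_univ t)
  refine (hf t ⟨by linarith, by linarith⟩).congr ?_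
  filter_upwards [Icc_mem_nhds (show t - ε < t by linarith) (show t < t + ε by linarith)] with s hs
    using hhf hs

end IsDCSelectionAt

theorem SepAt.translate {t₀ : ℝ} (h : SepAt (fun i s => z i (t₀ + s)) 0) : SepAt z t₀ := by
  have := h.comp (κ := fun t => t - t₀) (s₀ := t₀) (k := 1) ?_ (Eventually.of_forall fun s => by simp)
  · simpa using this
  · refine tendsto_nhdsWithin_iff.2 ⟨?_, ?_⟩
    · exact (tendsto_sub_nhds_zero t₀).mono_left nhdsWithin_le_nhds
    · filter_upwards [eventually_mem_nhdsWithin] with s hs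
      exact sub_ne_zero.2 hs

/-- A nonzero derivative gives |κ s - κ s₀| ≥ |d||s - s₀|/2 near s₀; exponent 2 absorbs the
constant. -/
theorem SepAt.comp_hasDerivAt {κ : ℝ → ℝ} {s₀ d : ℝ} (h : SepAt z (κ s₀)) (hκ : HasDerivAt κ d s₀)
    (hd : d ≠ 0) : SepAt (fun i s => z i (κ s)) s₀ := by
  refine h.comp (k := 2) (hκ.tendsto_nhdsNE hd) ?_
  have h1 := (hasDerivAt_iff_tendsto_slope.1 hκ).abs.eventually
    (lt_mem_nhds (half_lt_self (abs_pos.2 hd)))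
  have h2 : ∀ᶠ s in 𝓝[≠] s₀, |s - s₀| < |d| / 2 := by
    have : Tendsto (fun s : ℝ => |s - s₀|) (𝓝 s₀) (𝓝 |s₀ - s₀|) := Continuous.tendsto (by fun_prop) s₀
    rw [sub_self, abs_zero] at this
    exact nhdsWithin_le_nhds (this.eventually (gt_mem_nhds (half_pos (abs_pos.2 hd))))
  filter_upwards [h1, h2, eventually_mem_nhdsWithin] with s hs hs2 hne
  have hpos : 0 < |s - s₀| := abs_pos.2 (sub_ne_zero.2 hne)
  rw [slope_def_field, abs_div, lt_div_iff₀ hpos] at hs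
  nlinarith

theorem SepAt.comp_pow_everywhere (h : ∀ t, SepAt z t) {t₀ ε : ℝ} (hε : ε = 1 ∨ ε = -1) {N : ℕ}
    (hN : 1 ≤ N) (s₀ : ℝ) : SepAt (fun i s => z i (t₀ + ε * s ^ N)) s₀ := by
  by_cases hs₀ : s₀ = 0
  · subst hs₀
    exact (h t₀).comp_add_mul_pow hε hN
  · have hε0 : ε ≠ 0 := by rcases hε with rfl | rfl <;> norm_num
    refine SepAt.comp_hasDerivAt (κ := fun s => t₀ + ε * s ^ N) (h _)
      (((hasDerivAt_pow N s₀).const_mul ε).const_add t₀) ?_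
    have : (N : ℝ) ≠ 0 := by positivity
    exact mul_ne_zero hε0 (mul_ne_zero this (pow_ne_zero _ hs₀))

variable [Fintype ι]

/-- The hypothesis speaks of continuous families only, so the roots are replaced by a continuous
enumeration; separation does not depend on the labelling. -/
theorem sepAt_of_no_flat_meeting (hM : IsRegularSeq M) (hz : ∀ t, Adm M fun i s => z i (t + s))
    (hno : ∀ lam : ι → ℝ → ℂ, (∀ i, Continuous (lam i)) →
      (∀ t, ∃ σ : Equiv.Perm ι, ∀ i, lam i t = z (σ i) t) →
      ∀ i j t₀, MeetInfiniteOrder (lam i) (lam j) t₀ → lam i =ᶠ[𝓝 t₀] lam j) (t₀ : ℝ) :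
    SepAt z t₀ := by
  obtain ⟨f, hfc, hf⟩ := exists_selection z isOpen_univ fun t _ ε hε => by
    have := (tendsto_sub_nhds_zero t).eventually (eventually_perm_near (fun k => (hz t).continuousAt k) hε)
    simpa using this
  have hfc' : ∀ i, Continuous fun t => f t i := fun i =>
    (continuous_apply i).comp (continuousOn_univ.1 hfc)
  have hA : Adm M fun i s => f (t₀ + s) i :=
    (hz t₀).congr (Eventually.of_forall fun s => hf (t₀ + s) (mem_univ _))
  have hS : SepAt (fun i s => f (t₀ + s) i) 0 := by
    refine hA.sepAt_of_no_flat hM (fun i => (hfc' i).comp (continuous_const.add continuous_id))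
      fun lam hlc hlp i j hflat => ?_
    have h1 := hno (fun i t => lam i (t - t₀))
      (fun i => (hlc i).comp (continuous_id.sub continuous_const))
      (fun t => by
        obtain ⟨σ, hσ⟩ := hlp (t - t₀)
        obtain ⟨τ, hτ⟩ := hf t (mem_univ t)
        exact ⟨σ.trans τ, fun i => by rw [hσ, add_sub_cancel, hτ]; rfl⟩) i j t₀
      fun k => (hflat k).comp_tendsto (tendsto_sub_nhds_zero t₀)
    filter_upwards [(tendsto_add_nhds_zero t₀).eventually h1] with s hs
    simpa using hs
  refine SepAt.congr (SepAt.translate (z := fun i t => f t i) hS) (Eventually.of_forall fun t => ?_)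
  obtain ⟨σ, hσ⟩ := hf t (mem_univ t)
  exact ⟨σ.symm, fun i => by rw [hσ]; simp⟩

end GlobalRoots

/-! ### Polynomial curves and the four assertions. -/

section PolyCurve

variable {n : ℕ} {a : Fin n → ℝ → ℂ} {M : ℕ → ℝ}

theorem polyCurve_monic_natDegree (a : Fin n → ℝ → ℂ) (t : ℝ) :
    (polyCurve a t).Monic ∧ (polyCurve a t).natDegree = n := by
  have hdeg : (∑ i : Fin n, C ((-1) ^ ((i : ℕ) + 1) * a i t) * X ^ (n - ((i : ℕ) + 1))).degree <
      (n : WithBot ℕ) := by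
    refine (degree_sum_le _ _).trans_lt ((Finset.sup_lt_iff (WithBot.bot_lt_coe n)).2 fun i _ => ?_)
    refine (degree_C_mul_X_pow_le _ _).trans_lt ?_
    have := i.2
    exact Nat.cast_lt.2 (by omega)
  refine ⟨monic_X_pow_add hdeg, ?_⟩
  exact natDegree_eq_of_degree_eq_some (by
    rw [polyCurve, degree_add_eq_left_of_degree_lt (by rwa [degree_X_pow]), degree_X_pow])

theorem exists_parametrizesRoots (a : Fin n → ℝ → ℂ) :
    ∃ z : Fin n → ℝ → ℂ, ParametrizesRoots (polyCurve a) univ z := by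
  have h : ∀ t, ∃ y : Fin n → ℂ, (polyCurve a t).roots = Finset.univ.val.map y := by
    intro t
    have hcard : Multiset.card (polyCurve a t).roots = n := by
      exact (IsAlgClosed.splits (polyCurve a t)).natDegree_eq_card_roots.symm.trans
        (polyCurve_monic_natDegree a t).2
    obtain ⟨l, hl⟩ := Quot.exists_rep (polyCurve a t).roots
    have hl' : (l : Multiset ℂ) = (polyCurve a t).roots := hl
    rw [← hl', Multiset.coe_card] at hcard
    subst hcard
    refine ⟨l.get, ?_⟩
    rw [← hl', Fin.univ_val_map, List.ofFn_get]
  choose y hy using h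
  exact ⟨fun i t => y t i, fun t _ => hy t⟩

theorem ParametrizesRoots.exists_perm {P : ℝ → ℂ[X]} {S : Set ℝ} {lam mu : Fin n → ℝ → ℂ}
    (hl : ParametrizesRoots P S lam) (hm : ParametrizesRoots P S mu) {t : ℝ} (ht : t ∈ S) :
    ∃ σ : Equiv.Perm (Fin n), ∀ i, mu i t = lam (σ i) t :=
  exists_perm_of_map_eq ((hm t ht).symm.trans (hl t ht))

theorem ParametrizesRoots.of_perm {P : ℝ → ℂ[X]} {S : Set ℝ} {lam mu : Fin n → ℝ → ℂ}
    (hl : ParametrizesRoots P S lam)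
    (h : ∀ t ∈ S, ∃ σ : Equiv.Perm (Fin n), ∀ i, mu i t = lam (σ i) t) :
    ParametrizesRoots P S mu := by
  intro t ht
  obtain ⟨σ, hσ⟩ := h t ht
  rw [hl t ht]
  simp only [hσ]
  conv_lhs => rw [← Multiset.map_univ_val_equiv σ, Multiset.map_map]
  rfl

variable {z : Fin n → ℝ → ℂ}

theorem ParametrizesRoots.es_eq (hz : ParametrizesRoots (polyCurve a) univ z) (i : Fin n) (t : ℝ) :
    (es (i + 1) fun j => z j t) = a i t := by
  have h1 : polyCurve a t = ∏ j, (X - C (z j t)) := by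
    have h2 := (IsAlgClosed.splits (polyCurve a t)).eq_prod_roots_of_monic
      (polyCurve_monic_natDegree a t).1
    rw [hz t (mem_univ t), Multiset.map_map] at h2
    exact h2
  have h3 := congrArg (fun p => p.coeff (n - (i + 1))) (h1.trans (prod_X_sub_C_eq _))
  have hi := i.2
  have h4 : ∀ j, j ∈ Finset.range (n + 1) →
      ((-1) ^ j * (C (es j fun k => z k t) * X ^ (n - j)) : ℂ[X]).coeff (n - (i + 1)) =
        if j = i + 1 then (-1) ^ j * es j fun k => z k t else 0 := by
    intro j hj
    rw [Finset.mem_range] at hj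
    rw [show ((-1) ^ j * (C (es j fun k => z k t) * X ^ (n - j)) : ℂ[X]) =
      C ((-1) ^ j * es j fun k => z k t) * X ^ (n - j) by simp [mul_assoc], coeff_C_mul_X_pow]
    exact if_congr (by omega) rfl rfl
  have h5 : ∀ j : Fin n,
      (C ((-1) ^ ((j : ℕ) + 1) * a j t) * X ^ (n - ((j : ℕ) + 1)) : ℂ[X]).coeff (n - (i + 1)) =
        if j = i then (-1) ^ ((j : ℕ) + 1) * a j t else 0 := by
    intro j
    have := j.2
    rw [coeff_C_mul_X_pow]
    exact if_congr (by rw [Fin.ext_iff]; omega) rfl rfl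
  simp only [polyCurve, coeff_add, finsetSum_coeff, Fintype.card_fin, h5] at h3
  rw [Finset.sum_congr rfl h4, coeff_X_pow, if_neg (by omega), zero_add] at h3
  simp only [Finset.sum_ite_eq', Finset.mem_univ, Finset.mem_range, if_true] at h3
  rw [if_pos (by omega)] at h3
  exact (mul_left_cancel₀ (pow_ne_zero _ (by norm_num)) h3).symm

theorem ParametrizesRoots.adm (hM : IsRegularSeq M) (ha : ∀ i, IsDC M univ (a i))
    (hz : ParametrizesRoots (polyCurve a) univ z) (t : ℝ) : Adm M fun i s => z i (t + s) := by
  intro k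
  rcases Nat.eq_zero_or_pos k with rfl | hk
  · simpa [es] using GM.const hM 1
  by_cases hkn : k ≤ n
  · have := (ha ⟨k - 1, by omega⟩).gm isOpen_univ (mem_univ t)
    refine this.congr (Eventually.of_forall fun s => ?_)
    have h1 := hz.es_eq ⟨k - 1, by omega⟩ (t + s)
    simp only [Nat.sub_add_cancel hk] at h1
    exact h1.symm
  · have h0 : (fun s => es k fun i => z i (t + s)) = fun _ => 0 := by
      funext s
      rw [es_eq_sum, Finset.powersetCard_eq_empty.2 (by rw [Finset.card_fin]; omega), Finset.sum_empty]
    rw [h0]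
    exact GM.const hM 0

theorem hasDCRootsAfterPower_of_sepAt (hM : IsRegularSeq M) (ha : ∀ i, IsDC M univ (a i))
    (hz : ParametrizesRoots (polyCurve a) univ z) (hsep : ∀ t, SepAt z t) (t₀ : ℝ) :
    HasDCRootsAfterPower n M (polyCurve a) t₀ := by
  constructor
  · have hA : ∀ ε : ℝ, (ε = 1 ∨ ε = -1) → Adm M fun i s => z i (t₀ + ε * s) := fun ε hε => by
      simpa using (hz.adm hM ha t₀).comp_mul_pow hM (ε := ε) (by rcases hε with rfl | rfl <;> simp)
        le_rfl
    obtain ⟨N₁, hN₁, -, h₁⟩ := (hA 1 (Or.inl rfl)).hasExpansion hM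
    obtain ⟨N₂, hN₂, -, h₂⟩ := (hA (-1) (Or.inr rfl)).hasExpansion hM
    -- One exponent has to serve both signs.
    have hN : 1 ≤ N₁ * N₂ := Nat.mul_pos hN₁ hN₂
    refine ⟨N₁ * N₂, hN, fun ε hε => ?_⟩
    have hexp : HasExpansion M (fun i s => z i (t₀ + ε * s)) (N₁ * N₂) := by
      rcases hε with rfl | rfl
      · exact h₁.comp_pow hM hN₂
      · rw [mul_comm]
        exact h₂.comp_pow hM hN₁
    obtain ⟨ν, hν, hperm⟩ := hexp.exact hN (by
      simpa using (hsep t₀).comp_add_mul_pow hε (N := 1) le_rfl)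
    choose δ hδ hD using fun i => (hν i).exists_isDC
    obtain ⟨η, hη, hb⟩ := Metric.eventually_nhds_iff_ball.1
      (hperm.and (eventually_all.2 fun i => Ioo_mem_nhds (neg_lt_zero.2 (hδ i)) (hδ i)))
    rw [Real.ball_eq_Ioo, zero_sub, zero_add] at hb
    refine ⟨η, hη, ν, fun i => ?_, ?_⟩
    · exact isDC_of_gm hM.pos fun t ht => (hD i).gm isOpen_Ioo ((hb t ht).2 i)
    · refine ParametrizesRoots.of_perm (lam := fun i s => z i (t₀ + ε * s ^ (N₁ * N₂)))
        (fun s _ => hz _ (mem_univ _)) fun s hs => ?_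
      obtain ⟨σ, hσ⟩ := (hb s hs).1
      exact ⟨σ.symm, fun i => by rw [hσ]; simp⟩
  · intro N hN ε hε δ hδ lam mu hl hm
    have hz' : ParametrizesRoots (fun s => polyCurve a (t₀ + ε * s ^ N)) (Ioo (-δ) δ)
        fun i s => z i (t₀ + ε * s ^ N) := fun s _ => hz _ (mem_univ _)
    obtain ⟨σ, hσ⟩ := exists_perm_of_sepAt hM isOpen_Ioo isPreconnected_Ioo
      (fun i t ht => (hl.1 i).gm isOpen_Ioo ht) (fun i t ht => (hm.1 i).gm isOpen_Ioo ht)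
      (fun t ht => hl.2.exists_perm hm.2 ht)
      (fun s hs => (SepAt.comp_pow_everywhere hsep hε hN s).congr <| nhdsWithin_le_nhds <| by
        -- Uniqueness on the whole interval needs separation at each s: at 0 through the power
        -- itself, elsewhere because s ↦ t₀ + εs^N has nonzero derivative.
        filter_upwards [Ioo_mem_nhds hs.1 hs.2] with t ht using hz'.exists_perm hl.2 ht)
    exact ⟨σ, fun i s hs => hσ s hs i⟩

theorem hasRealDCRoots_of_sepAt (hM : IsRegularSeq M) (ha : ∀ i, IsDC M univ (a i))
    (hyp : IsHyperbolic (polyCurve a)) (hz : ParametrizesRoots (polyCurve a) univ z)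
    (hsep : ∀ t, SepAt z t) : HasRealDCRoots n M (polyCurve a) := by
  have him : ∀ i t, (z i t).im = 0 := fun i t => hyp t _ (isRoot_of_mem_roots (by
    rw [hz t (mem_univ t)]
    exact Multiset.mem_map_of_mem (fun i => z i t) (Finset.mem_univ i)))
  constructor
  · have loc : ∀ t, ∃ f, IsDCSelectionAt M z f t := by
      intro t
      obtain ⟨N, -, hN, h⟩ := (hz.adm hM ha t).hasExpansion hM
      obtain rfl := hN (Eventually.of_forall fun s i => him i _)
      obtain ⟨ν, hν, hperm⟩ := h.exact le_rfl (by
        simpa using (hsep t).comp_add_mul_pow (Or.inl rfl) (N := 1) le_rfl)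
      refine ⟨fun s i => ν i (s - t), fun i => by simpa using hν i, ?_⟩
      filter_upwards [(tendsto_sub_nhds_zero t).eventually hperm] with s ⟨σ, hσ⟩
      refine ⟨σ.symm, fun i => ?_⟩
      have := hσ (σ.symm i)
      rw [pow_one, add_sub_cancel, Equiv.apply_symm_apply] at this
      exact this.symm
    obtain ⟨f, hf⟩ := IsDCSelectionAt.exists_global hM hsep loc
    have hre : ∀ i t, ((f t i).re : ℂ) = f t i := fun i t => by
      obtain ⟨σ, hσ⟩ := (hf t).2.self_of_nhds
      refine Complex.ext rfl ?_
      rw [hσ, him, Complex.ofReal_im]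
    refine ⟨fun i t => (f t i).re, fun i => ?_, ?_⟩
    · rw [← isDC_ofReal_iff hM.pos isOpen_univ]
      simp only [hre]
      exact isDC_of_gm hM.pos fun t _ => (hf t).1 i
    · simp only [hre]
      exact hz.of_perm fun t _ => (hf t).2.self_of_nhds
  · intro lam mu hl hm
    obtain ⟨σ, hσ⟩ := exists_perm_of_sepAt hM isOpen_univ isPreconnected_univ
      (fun i t ht => ((isDC_ofReal_iff hM.pos isOpen_univ).2 (hl.1 i)).gm isOpen_univ ht)
      (fun i t ht => ((isDC_ofReal_iff hM.pos isOpen_univ).2 (hm.1 i)).gm isOpen_univ ht)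
      (fun t ht => hl.2.exists_perm hm.2 ht)
      (fun s _ => (hsep s).congr (Eventually.of_forall fun t => hz.exists_perm hl.2 (mem_univ t)))
    exact ⟨σ, fun i t => by exact_mod_cast hσ t (mem_univ t) i⟩

end PolyCurve

theorem IsQSeq.isRegularSeq {Q : ℕ → ℝ} (h : IsQSeq Q) : IsRegularSeq Q :=
  ⟨h.weight, h.logConvex, h.derivationClosed⟩

theorem IsLSeq.isRegularSeq {L : ℕ → ℝ} (h : IsLSeq L) : IsRegularSeq L :=
  ⟨h.weight, h.logConvex, h.derivationClosed⟩

theorem mainTheorem3 (n : ℕ) (a : Fin n → ℝ → ℂ) :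
    (∀ Q : ℕ → ℝ, IsQSeq Q → (∀ i, IsDC Q univ (a i)) → IsHyperbolic (polyCurve a) →
      HasRealDCRoots n Q (polyCurve a)) ∧
    (∀ L : ℕ → ℝ, IsLSeq L → (∀ i, IsDC L univ (a i)) → IsHyperbolic (polyCurve a) →
      NoInfiniteOrderMeeting n (polyCurve a) →
      HasRealDCRoots n L (polyCurve a)) ∧
    (∀ Q : ℕ → ℝ, IsQSeq Q → (∀ i, IsDC Q univ (a i)) →
      ∀ t₀ : ℝ, HasDCRootsAfterPower n Q (polyCurve a) t₀) ∧
    (∀ L : ℕ → ℝ, IsLSeq L → (∀ i, IsDC L univ (a i)) →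
      NoInfiniteOrderMeeting n (polyCurve a) →
      ∀ t₀ : ℝ, HasDCRootsAfterPower n L (polyCurve a) t₀) := by
  obtain ⟨z, hz⟩ := exists_parametrizesRoots a
  have hQ : ∀ Q : ℕ → ℝ, IsQSeq Q → (∀ i, IsDC Q univ (a i)) → ∀ t, SepAt z t := fun Q hQ ha t =>
    ((hz.adm hQ.isRegularSeq ha t).sepAt_of_quasianalytic hQ.isRegularSeq hQ.quasianalytic).translate
  have hL : ∀ L : ℕ → ℝ, IsLSeq L → (∀ i, IsDC L univ (a i)) →
      NoInfiniteOrderMeeting n (polyCurve a) → ∀ t, SepAt z t := fun L hL ha hno =>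
    sepAt_of_no_flat_meeting hL.isRegularSeq (hz.adm hL.isRegularSeq ha) fun lam hc hp =>
      hno lam hc (hz.of_perm fun t _ => hp t)
  exact ⟨fun Q h ha hyp => hasRealDCRoots_of_sepAt h.isRegularSeq ha hyp hz (hQ Q h ha),
    fun L h ha hyp hno => hasRealDCRoots_of_sepAt h.isRegularSeq ha hyp hz (hL L h ha hno),
    fun Q h ha => hasDCRootsAfterPower_of_sepAt h.isRegularSeq ha hz (hQ Q h ha),
    fun L h ha hno => hasDCRootsAfterPower_of_sepAt h.isRegularSeq ha hz (hL L h ha hno)⟩
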